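/- **Setting.** Let $\omega>0$, let $H$ be a complex Hilbert space and let $\mathcal H=L^2=L^2([0,\omega],H)$ with $\langle x,y\rangle=\frac1\omega\int_0^\omega\langle x(s),y(s)\rangle_H\,ds$. For $x\in L^2$ and $\ell\in\mathbb Z$ put $\widehat x(\ell)=\frac1\omega\int_0^\omega x(\tau)e^{-i2\pi\ell\tau/\omega}\,d\tau$ and $(P_\ell x)(s)=\widehat x(\ell)e^{i2\pi\ell s/\omega}$. Put $P_{(k)}=\sum_{|\ell|\le k}P_\ell$, $\mathcal H_\ell=\operatorname{Im}P_\ell$ and $\mathcal H_{(k)}=\operatorname{Im}P_{(k)}$. For $X\in B(\mathcal H)$ let $\|X\|_{2,\mathcal P}=\big(\sum_{j,\ell\in\mathbb Z}\|P_jXP_\ell\|^2\big)^{1/2}$, and write $X\in\mathfrak S_2(\mathcal H,\mathcal P)$ if this is finite. Let $\mathcal V:[0,\omega]\to B(H)$ be such that $s\mapsto\mathcal V(s)x$ belongs to $L^2$ for every $x\in H$, let $\widehat{\mathcal V}(n)x=\frac1\omega\int_0^\omega\mathcal V(s)x\,e^{-i2\pi ns/\omega}\,ds$, and assume $$\sum_{n\in\mathbb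 Z}\|\widehat{\mathcal V}(n)\|^2<\infty,\qquad \sum_{j,\ell\in\mathbb Z}\Big\|\sum_{n\ne\ell}\frac{\widehat{\mathcal V}(j+n)\widehat{\mathcal V}(\ell+n)}{\ell-n}\Big\|^2<\infty .$$ Let $L$ be the operator $(Ly)(s)=y'(s)-\mathcal V(s)y(\omega-s)$ in $L^2$ with domain $D(L)=\{y\in W_2^1([0,\omega],H):y(0)=y(\omega)\}$. **Theorem 2.9.** The operator $L$ generates a $C_0$-group $T:\mathbb R\to B(\mathcal H)$. There are a number $k\in\mathbb Z_+$, an invertible operator $U=I+W\in B(\mathcal H)$ with $W\in\mathfrak S_2(\mathcal H,\mathcal P)$, and operators $B_{(k)}\in B(\mathcal H_{(k)})$, $B_\ell\in B(\mathcal H_\ell)$ for $|\ell|>k$, with $\sum_{|\ell|>k}\|B_\ell\|^2<\infty$, such that for all $t\in\mathbb R$ $$U^{-1}T(t)U=e^{tB_{(k)}}\oplus\bigoplus_{|\ell|>k}e^{t(\frac{i2\pi\ell}{\omega}I_\ell+B_\ell)}$$ with respect to the orthogonal decomposition $\mathcal H=\mathcal H_{(k)}\oplus\bigoplus_{|\ell|>k}\mathcal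 H_\ell$. For any such $k,U,W,B_{(k)},(B_\ell)$, put $\gamma_\ell=\|B_\ell\|$ and $\beta_\ell=\|P_\ell W\|_{2,\mathcal P}$ for $|\ell|>k$, and $\kappa_m=\sup_{|\ell|\ge m}\|B_\ell\|$ for $m>k$. Then there is a constant $C>0$, independent of $n$, $t$ and $\psi$, such that for every $\psi\in L^2$, every integer $n>k$ and every $t\in\mathbb R$ the sums below converge and $$\begin{aligned} &\Big\|T(t)U\psi-Ue^{tB_{(k)}}P_{(k)}\psi-\sum_{k<|\ell|\le n}Ue^{t(\frac{i2\pi\ell}{\omega}I_\ell+B_\ell)}P_\ell\psi\Big\|\\ &\qquad\le C\Big(\sum_{|\ell|\ge n+1}e^{2\gamma_\ell|t|}\big(\|\widehat\psi(\ell)\|^2+\beta_\ell^2\|\psi\|^2\big)\Big)^{1/2}\\ &\qquad\le Ce^{\kappa_{n+1}|t|}\Big(\sum_{|\ell|\ge n+1}\big(\|\widehat\psi(\ell)\|^2+\beta_\ell^2\|\psi\|^2\big)\Big)^{1/2}. \end{aligned}$$ -/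

import Mathlib

open MeasureTheory Filter Topology

noncomputable section

namespace MixedProblem

/-! ### The Hilbert space `L² = L²([0, ω], H)` and its Fourier decomposition -/

/-- The normalized Lebesgue measure `ds / ω` on `[0, ω]`. -/
def normMeasure (ω : ℝ) : Measure ℝ :=
  (ENNReal.ofReal ω)⁻¹ • volume.restrict (Set.Icc 0 ω)

instance (ω : ℝ) : IsFiniteMeasure (normMeasure ω) := by
  refine ⟨lt_of_le_of_lt (b := 1) ?_ ENNReal.one_lt_top⟩
  simp only [normMeasure, Measure.smul_apply, Measure.restrict_apply_univ, Real.volume_Icc,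
    sub_zero, smul_eq_mul]
  exact ENNReal.inv_mul_le_one _

variable {H : Type*} [NormedAddCommGroup H] [InnerProductSpace ℂ H]

/-- `L²([0, ω], H)`, with `⟨x, y⟩ = (1/ω) ∫₀^ω ⟨x(s), y(s)⟩ ds`. -/
abbrev L2 (ω : ℝ) (H : Type*) [NormedAddCommGroup H] : Type _ :=
  Lp H 2 (normMeasure ω)

/-- The exponential `e_ℓ(s) = exp(i 2πℓ s / ω)`. -/
def expo (ω : ℝ) (ℓ : ℤ) (s : ℝ) : ℂ :=
  Complex.exp (2 * Real.pi * Complex.I * ℓ / ω * s)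

lemma norm_expo (ω : ℝ) (ℓ : ℤ) (s : ℝ) : ‖expo ω ℓ s‖ = 1 := by
  have : (2 * Real.pi * Complex.I * ℓ / ω * s : ℂ)
      = ((2 * Real.pi * ℓ / ω * s : ℝ) : ℂ) * Complex.I := by
    push_cast; ring
  rw [expo, this, Complex.norm_exp_ofReal_mul_I]

lemma continuous_expo (ω : ℝ) (ℓ : ℤ) : Continuous (expo ω ℓ) := by
  unfold expo; fun_prop

lemma memLp_expo_smul (ω : ℝ) (ℓ : ℤ) {f : ℝ → H} (hf : MemLp f 2 (normMeasure ω)) :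
    MemLp (fun s => expo ω ℓ s • f s) 2 (normMeasure ω) :=
  hf.of_le ((continuous_expo ω ℓ).aestronglyMeasurable.smul hf.1)
    (Eventually.of_forall fun s => by simp [norm_smul, norm_expo])

/-- The `ℓ`-th Fourier coefficient `x̂(ℓ) = (1/ω) ∫₀^ω x(τ) exp(-i 2πℓ τ / ω) dτ`, as a bounded
operator `L² → H`. -/
def coeff (ω : ℝ) (ℓ : ℤ) : L2 ω H →L[ℂ] H :=
  LinearMap.mkContinuousOfExistsBound
    { toFun := fun x => ∫ τ, expo ω (-ℓ) τ • x τ ∂(normMeasure ω)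
      map_add' := fun x y => by
        have hi : ∀ z : L2 ω H,
            Integrable (fun τ => expo ω (-ℓ) τ • z τ) (normMeasure ω) := fun z =>
          (memLp_expo_smul ω (-ℓ) (Lp.memLp z)).integrable (by norm_num)
        rw [← integral_add (hi x) (hi y)]
        refine integral_congr_ae ?_
        filter_upwards [Lp.coeFn_add x y] with τ h
        simp only [h, Pi.add_apply, smul_add]
      map_smul' := fun c x => by
        rw [RingHom.id_apply, ← integral_smul]
        refine integral_congr_ae ?_
        filter_upwards [Lp.coeFn_smul c x] with τ h
        simp [h, smul_comm c] }
    (by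
      refine ⟨((normMeasure ω) Set.univ ^ ((1 : ENNReal).toReal⁻¹ - (2 : ENNReal).toReal⁻¹)).toReal,
        fun x => ?_⟩
      have hx := Lp.memLp x
      refine (norm_integral_le_integral_norm _).trans ?_
      simp only [norm_smul, norm_expo, one_mul]
      have h1 : ∫ τ, ‖x τ‖ ∂(normMeasure ω) = (eLpNorm x 1 (normMeasure ω)).toReal := by
        rw [eLpNorm_one_eq_lintegral_enorm, integral_norm_eq_lintegral_enorm hx.1]
      rw [h1, Lp.norm_def, ← ENNReal.toReal_mul]
      have h2 := eLpNorm_le_eLpNorm_mul_rpow_measure_univ (μ := normMeasure ω) (p := 1) (q := 2)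
        (by norm_num) hx.1
      refine ENNReal.toReal_mono ?_ ((h2.trans (le_of_eq ?_)))
      · refine ENNReal.mul_ne_top (ENNReal.rpow_ne_top_of_nonneg (by norm_num) ?_) hx.2.ne
        exact measure_ne_top _ _
      · rw [mul_comm]; simp)

/-- The map `h ↦ e_ℓ h` from `H` to `L²`. -/
def harmonic (ω : ℝ) (ℓ : ℤ) : H →L[ℂ] L2 ω H :=
  LinearMap.mkContinuousOfExistsBound
    { toFun := fun h => (memLp_expo_smul ω ℓ (memLp_const h)).toLp (fun s => expo ω ℓ s • h)
      map_add' := fun x y => by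
        rw [← MemLp.toLp_add]
        congr 1
        funext s
        simp [smul_add]
      map_smul' := fun c x => by
        rw [RingHom.id_apply, ← MemLp.toLp_const_smul]
        congr 1
        funext s
        simp [smul_comm c] }
    (by
      refine ⟨((normMeasure ω) Set.univ ^ (1 / (2 : ENNReal).toReal)).toReal, fun h => ?_⟩
      change ‖(memLp_expo_smul ω ℓ (memLp_const h)).toLp (fun s => expo ω ℓ s • h)‖ ≤ _
      have h1 : eLpNorm (fun s => expo ω ℓ s • h) 2 (normMeasure ω)
          = eLpNorm (fun _ => h) 2 (normMeasure ω) :=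
        eLpNorm_congr_norm_ae (Eventually.of_forall fun s => by simp [norm_smul, norm_expo])
      rw [Lp.norm_toLp, h1, eLpNorm_const' _ (by norm_num) (by norm_num), ENNReal.toReal_mul,
        mul_comm]
      simp)

/-- The spectral projection `P_ℓ` of `d/ds` with periodic boundary conditions at the eigenvalue
`i 2πℓ / ω`: `(P_ℓ x)(s) = x̂(ℓ) exp(i 2πℓ s / ω)`. -/
def proj (ω : ℝ) (ℓ : ℤ) : L2 ω H →L[ℂ] L2 ω H :=
  (harmonic ω ℓ).comp (coeff ω ℓ)

/-- `P_(k) = ∑_{|ℓ| ≤ k} P_ℓ`. -/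
def projBlock (ω : ℝ) (k : ℕ) : L2 ω H →L[ℂ] L2 ω H :=
  ∑ ℓ ∈ Finset.Icc (-(k : ℤ)) k, proj ω ℓ

/-- `𝓗_ℓ = Im P_ℓ`. -/
abbrev specSpace (ω : ℝ) (H : Type*) [NormedAddCommGroup H] [InnerProductSpace ℂ H] (ℓ : ℤ) :
    Submodule ℂ (L2 ω H) :=
  LinearMap.range (proj (H := H) ω ℓ).toLinearMap

/-- `𝓗_(k) = Im P_(k)`. -/
abbrev specBlock (ω : ℝ) (H : Type*) [NormedAddCommGroup H] [InnerProductSpace ℂ H] (k : ℕ) :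
    Submodule ℂ (L2 ω H) :=
  LinearMap.range (projBlock (H := H) ω k).toLinearMap

/-- `X ∈ 𝔖₂(𝓗, 𝒫)`: `∑_{j,ℓ} ‖P_j X P_ℓ‖² < ∞`. -/
def IsHilbertSchmidt (ω : ℝ) (X : L2 ω H →L[ℂ] L2 ω H) : Prop :=
  Summable fun p : ℤ × ℤ => ‖(proj ω p.1).comp (X.comp (proj ω p.2))‖ ^ 2

/-- `‖X‖_{2,𝒫} = (∑_{j,ℓ} ‖P_j X P_ℓ‖²)^{1/2}`. -/
def hsNorm (ω : ℝ) (X : L2 ω H →L[ℂ] L2 ω H) : ℝ :=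
  Real.sqrt (∑' p : ℤ × ℤ, ‖(proj ω p.1).comp (X.comp (proj ω p.2))‖ ^ 2)

/-! ### The potential and the operator `L` -/

/-- The potential `V : [0, ω] → B(H)` belongs to `L²` in the strong sense: `s ↦ V(s) x` is in
`L²([0, ω], H)` for every `x ∈ H`. -/
def IsStrongL2 (ω : ℝ) (V : ℝ → H →L[ℂ] H) : Prop :=
  ∀ x : H, MemLp (fun s => V s x) 2 (normMeasure ω)

/-- The map `x ↦ V(·) x` from `H` to `L²`; it is bounded by the closed graph theorem. -/
def potentialMap [CompleteSpace H] (ω : ℝ) (V : ℝ → H →L[ℂ] H) (hV : IsStrongL2 ω V) :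
    H →L[ℂ] L2 ω H :=
  ContinuousLinearMap.ofSeqClosedGraph
    (g :=
      { toFun := fun x => (hV x).toLp (fun s => V s x)
        map_add' := fun x y => by
          rw [← MemLp.toLp_add]
          congr 1
          funext s
          simp
        map_smul' := fun c x => by
          rw [RingHom.id_apply, ← MemLp.toLp_const_smul]
          congr 1
          funext s
          simp })
    (by
      intro u x y hu hy
      have hm := tendstoInMeasure_of_tendsto_Lp hy
      obtain ⟨ns, hns, hae⟩ := hm.exists_seq_tendsto_ae
      refine Lp.ext ?_
      have hall : ∀ᵐ s ∂(normMeasure ω), ∀ n,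
          ((hV (u n)).toLp (fun s => V s (u n)) : ℝ → H) s = V s (u n) :=
        ae_all_iff.2 fun n => (hV (u n)).coeFn_toLp
      filter_upwards [hae, hall, (hV x).coeFn_toLp] with s h1 h2 h3
      have h4 : Tendsto (fun i => V s (u (ns i))) atTop (𝓝 (V s x)) :=
        ((V s).continuous.tendsto x).comp (hu.comp hns.tendsto_atTop)
      have h5 : Tendsto (fun i => V s (u (ns i))) atTop (𝓝 (y s)) := by
        refine h1.congr fun i => ?_
        exact h2 (ns i)
      change y s = ((hV x).toLp (fun s => V s x) : ℝ → H) s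
      rw [h3]
      exact tendsto_nhds_unique h5 h4)

/-- The Fourier coefficient `V̂(n) ∈ B(H)`:
`V̂(n) x = (1/ω) ∫₀^ω V(s) x exp(-i 2πn s / ω) ds`. -/
def potCoeff [CompleteSpace H] (ω : ℝ) (V : ℝ → H →L[ℂ] H) (hV : IsStrongL2 ω V) (n : ℤ) :
    H →L[ℂ] H :=
  (coeff ω n).comp (potentialMap ω V hV)

/-- `y ∈ W₂¹([0, ω], H)` with derivative `g ∈ L²` and `y(0) = y(ω)`; elements of `W₂¹` are
identified with their (absolutely) continuous representatives on `[0, ω]`. -/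
def IsPeriodicW12 [CompleteSpace H] (ω : ℝ) (y : ℝ → H) (g : L2 ω H) : Prop :=
  (∀ s ∈ Set.Icc 0 ω, y s = y 0 + ∫ τ in (0 : ℝ)..s, g τ) ∧ y 0 = y ω

/-- The domain `D(L) = {y ∈ W₂¹ : y(0) = y(ω)}`, as a subset of `L²`. -/
def domL [CompleteSpace H] (ω : ℝ) : Set (L2 ω H) :=
  {f | ∃ (y : ℝ → H) (g : L2 ω H), IsPeriodicW12 ω y g ∧ f =ᵐ[normMeasure ω] y}

/-- `f ∈ D(L)` and `L f = h`, where `(L y)(s) = y'(s) - V(s) y(ω - s)`. -/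
def IsValueL [CompleteSpace H] (ω : ℝ) (V : ℝ → H →L[ℂ] H) (f h : L2 ω H) : Prop :=
  ∃ (y : ℝ → H) (g : L2 ω H), IsPeriodicW12 ω y g ∧ f =ᵐ[normMeasure ω] y ∧
    h =ᵐ[normMeasure ω] fun s => g s - V s (y (ω - s))

/-! ### Operator groups -/

/-- A strongly continuous group (`C₀`-group) of bounded operators. -/
structure C0Group (E : Type*) [NormedAddCommGroup E] [NormedSpace ℂ E] where
  op : ℝ → E →L[ℂ] E
  op_zero : op 0 = ContinuousLinearMap.id ℂ E
  op_add : ∀ s t, op (s + t) = (op s).comp (op t)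
  continuous_op : ∀ x, Continuous fun t => op t x

/-- `f` is in the domain of the infinitesimal generator of `T`, which maps it to `h`. -/
def C0Group.IsGeneratorValue {E : Type*} [NormedAddCommGroup E] [NormedSpace ℂ E] (T : C0Group E)
    (f h : E) : Prop :=
  Tendsto (fun t : ℝ => ((t : ℂ)⁻¹) • (T.op t f - f)) (𝓝[≠] 0) (𝓝 h)

/-- `L` is the infinitesimal generator of `T`: the generator has domain `D(L)` and acts as `L`. -/
def IsGroupOfL [CompleteSpace H] (ω : ℝ) (V : ℝ → H →L[ℂ] H) (T : C0Group (L2 ω H)) : Prop :=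
  (∀ f, (∃ h, T.IsGeneratorValue f h) ↔ f ∈ domL ω) ∧
    ∀ f h, T.IsGeneratorValue f h → IsValueL ω V f h

/-- The exponential `e^A` of a bounded operator `A`. -/
def opExp {E : Type*} [NormedAddCommGroup E] [NormedSpace ℂ E] (A : E →L[ℂ] E) : E →L[ℂ] E :=
  NormedSpace.exp A

/-- `e^{t((i 2πℓ/ω) I_ℓ + B_ℓ)} P_ℓ x` for `B_ℓ ∈ B(𝓗_ℓ)`. -/
def partExp (ω : ℝ) (ℓ : ℤ) (B : specSpace ω H ℓ →L[ℂ] specSpace ω H ℓ) (t : ℝ) (x : L2 ω H) :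
    L2 ω H :=
  (opExp ((t : ℂ) • ((2 * Real.pi * Complex.I * ℓ / ω : ℂ) •
    ContinuousLinearMap.id ℂ (specSpace ω H ℓ) + B))
    ((proj ω ℓ).toLinearMap.rangeRestrict x) : specSpace ω H ℓ)

/-- `e^{t B_(k)} P_(k) x` for `B_(k) ∈ B(𝓗_(k))`. -/
def blockExp (ω : ℝ) (k : ℕ) (B : specBlock ω H k →L[ℂ] specBlock ω H k) (t : ℝ) (x : L2 ω H) :
    L2 ω H :=
  (opExp ((t : ℂ) • B)
    ((projBlock ω k).toLinearMap.rangeRestrict x) : specBlock ω H k)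

/-- The operator `U = I + W` block diagonalizes the group `T`: `W ∈ 𝔖₂(𝓗, 𝒫)`,
`∑_{|ℓ| > k} ‖B_ℓ‖² < ∞`, and `U⁻¹ T(t) U` is the orthogonal direct sum of `e^{t B_(k)}` on `𝓗_(k)`
and of `e^{t((i 2πℓ/ω) I_ℓ + B_ℓ)}` on `𝓗_ℓ`, `|ℓ| > k`, that is, it sends every `x` to the
unconditionally convergent sum of these operators applied to the components of `x`.
The values `B ℓ` with `|ℓ| ≤ k` play no role. -/
structure IsBlockDiagonalization (ω : ℝ) (T : C0Group (L2 ω H)) (k : ℕ) (U : L2 ω H ≃L[ℂ] L2 ω H)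
    (W : L2 ω H →L[ℂ] L2 ω H) (Bk : specBlock ω H k →L[ℂ] specBlock ω H k)
    (B : ∀ ℓ : ℤ, specSpace ω H ℓ →L[ℂ] specSpace ω H ℓ) : Prop where
  eq_id_add : (U : L2 ω H →L[ℂ] L2 ω H) = ContinuousLinearMap.id ℂ (L2 ω H) + W
  hilbertSchmidt : IsHilbertSchmidt ω W
  summable : Summable fun ℓ : {ℓ : ℤ // (k : ℤ) < |ℓ|} => ‖B ℓ‖ ^ 2
  directSum : ∀ (t : ℝ) (x : L2 ω H),
    HasSum (fun ℓ : {ℓ : ℤ // (k : ℤ) < |ℓ|} => partExp ω ℓ (B ℓ) t x)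
      (U.symm (T.op t (U x)) - blockExp ω k Bk t x)

/-- `κ_m = sup_{|ℓ| ≥ m} ‖B_ℓ‖`. -/
def kappa (ω : ℝ) (B : ∀ ℓ : ℤ, specSpace ω H ℓ →L[ℂ] specSpace ω H ℓ) (m : ℕ) : ℝ :=
  ⨆ ℓ : {ℓ : ℤ // (m : ℤ) ≤ |ℓ|}, ‖B ℓ‖

/-- `β_ℓ = ‖P_ℓ W‖_{2,𝒫}`. -/
def beta (ω : ℝ) (W : L2 ω H →L[ℂ] L2 ω H) (ℓ : ℤ) : ℝ :=
  hsNorm ω ((proj ω ℓ).comp W)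

/-- The `n`-th approximation `U e^{t B_(k)} P_(k) ψ + ∑_{k < |ℓ| ≤ n} U e^{t(i 2πℓ/ω + B_ℓ)} P_ℓ ψ`
of `T(t) U ψ`. -/
def partialSum (ω : ℝ) (k : ℕ) (U : L2 ω H ≃L[ℂ] L2 ω H)
    (Bk : specBlock ω H k →L[ℂ] specBlock ω H k)
    (B : ∀ ℓ : ℤ, specSpace ω H ℓ →L[ℂ] specSpace ω H ℓ) (n : ℕ) (t : ℝ) (ψ : L2 ω H) : L2 ω H :=
  U (blockExp ω k Bk t ψ) +
    ∑ ℓ ∈ (Finset.Icc (-(n : ℤ)) n).filter (fun ℓ => (k : ℤ) < |ℓ|), U (partExp ω ℓ (B ℓ) t ψ)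

end MixedProblem

end

open MixedProblem

/-! In Fourier coefficients d/ds is the diagonal operator with entries i2πℓ/ω, and y ↦ V(s)y(ω − s)
has the matrix V̂(j + ℓ), because reflection turns e_ℓ into e_{-ℓ}. The perturbation is not assumed
bounded on L², but its columns `pot hV ℓ` are bounded uniformly in ℓ, and the coefficients of an
element of D(L) are absolutely summable. So L can be handled entirely through the relation
`IsFourierValueL`.

The core is a similarity transform built column by column. For large |ℓ| one seeks a column x_ℓ such
that the range of e_ℓ + x_ℓ is invariant under L, with block i2πℓ/ω + b_ℓ. With the reduced
resolvent Γ of d/ds at the ℓ-th eigenvalue and K = (perturbation)·Γ, put x = Γy, y = p + z, where p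
= `pot hV ℓ`. This gives a quadratic equation for z (`exists_riccati_solution`). Neither p nor K is
known to be small, so the contraction argument uses that K² tends to 0
(`IsReducedResolvent.tendsto_norm_sq`), which gives a uniform bound for (1 − K)⁻¹, and that Γp, Kp
and the ℓ-th coefficient of p are square summable in ℓ. The second assumption on V is precisely the
statement about Kp; the other two follow from the first.

The columns with |ℓ| > k form a Hilbert–Schmidt operator W₀ with ‖W₀‖ ≤ 1/2, and (1 + W₀)⁻¹L(1 + W₀)
is block triangular: only the finitely many low harmonics still couple to the rest. A Sylvester
equation, solvable in the rows |j| > m, removes this coupling by an operator Y with Y² = 0. Then U =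
(1 + W₀)(1 + Y), and the rows |j| ≤ m form the finite block (`exists_blockDiagonalization`).

The block diagonal model generates an explicit group. So far U only maps the graph of the model into
that of L; equality follows because, for large real μ, the model minus μ is onto while L − μ is
injective (`isFourierValueL_iff_of_blockDiagonal`). Conjugating by U gives T.

The estimate holds for any block diagonalization: U⁻¹T(t)Uψ minus the partial sum consists of the
harmonics |ℓ| > n, each of norm at most e^{γ_ℓ|t|}‖ψ̂(ℓ)‖, so Parseval and ‖U‖ finish. The terms
with β_ℓ are nonnegative slack. -/

noncomputable section

namespace MixedProblem

section CauchySchwarz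

variable {ι : Type*} {f g : ι → ℝ}

lemma summable_mul_and_tsum_mul_le (hf₀ : ∀ i, 0 ≤ f i) (hg₀ : ∀ i, 0 ≤ g i)
    (hf : Summable fun i => f i ^ 2) (hg : Summable fun i => g i ^ 2) :
    (Summable fun i => f i * g i) ∧
      ∑' i, f i * g i ≤ Real.sqrt (∑' i, f i ^ 2) * Real.sqrt (∑' i, g i ^ 2) := by
  have h := Real.summable_and_inner_le_Lp_mul_Lq_tsum_of_nonneg
    (p := 2) (q := 2) (Real.HolderConjugate.two_two) hf₀ hg₀ (by simpa using hf) (by simpa using hg)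
  simpa [Real.sqrt_eq_rpow] using h

end CauchySchwarz

/-! ### Exponentials, frequencies and the normalized measure. -/

section Exponentials

/-- The eigenvalue `i 2πℓ / ω` of `d/ds` with periodic boundary conditions. -/
def freq (ω : ℝ) (ℓ : ℤ) : ℂ := 2 * Real.pi * Complex.I * ℓ / ω

lemma freq_sub (ω : ℝ) (j ℓ : ℤ) : freq ω j - freq ω ℓ = freq ω (j - ℓ) := by
  simp only [freq]; push_cast; ring

@[simp] lemma freq_zero (ω : ℝ) : freq ω 0 = 0 := by simp [freq]

lemma norm_freq {ω : ℝ} (hω : 0 < ω) (ℓ : ℤ) : ‖freq ω ℓ‖ = 2 * Real.pi / ω * |(ℓ : ℝ)| := by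
  simp only [freq, norm_div, norm_mul, Complex.norm_I, Complex.norm_real, Complex.norm_ofNat,
    Real.norm_eq_abs, abs_of_pos Real.pi_pos, abs_of_pos hω, Complex.norm_intCast]
  ring

lemma freq_re (ω : ℝ) (ℓ : ℤ) : (freq ω ℓ).re = 0 := by
  have : freq ω ℓ = ((2 * Real.pi * ℓ / ω : ℝ) : ℂ) * Complex.I := by
    simp only [freq]; push_cast; ring
  rw [this]; simp

lemma freq_ne_zero {ω : ℝ} (hω : 0 < ω) {ℓ : ℤ} (hℓ : ℓ ≠ 0) : freq ω ℓ ≠ 0 := by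
  rw [← norm_ne_zero_iff, norm_freq hω]
  have := Real.pi_pos
  have : (ℓ : ℝ) ≠ 0 := by exact_mod_cast hℓ
  positivity

lemma expo_mul (ω : ℝ) (j ℓ : ℤ) (s : ℝ) : expo ω j s * expo ω ℓ s = expo ω (j + ℓ) s := by
  simp only [expo, ← Complex.exp_add]; congr 1; push_cast; ring

@[simp] lemma expo_zero_left (ω s : ℝ) : expo ω 0 s = 1 := by simp [expo]

@[simp] lemma expo_zero_right (ω : ℝ) (ℓ : ℤ) : expo ω ℓ 0 = 1 := by simp [expo]

lemma expo_period {ω : ℝ} (hω : 0 < ω) (ℓ : ℤ) : expo ω ℓ ω = 1 := by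
  have : (ω : ℂ) ≠ 0 := by exact_mod_cast hω.ne'
  rw [expo, Complex.exp_eq_one_iff]
  exact ⟨ℓ, by field_simp⟩

lemma expo_reflect {ω : ℝ} (hω : 0 < ω) (ℓ : ℤ) (s : ℝ) :
    expo ω ℓ (ω - s) = expo ω (-ℓ) s := by
  have h : expo ω ℓ (ω - s) = expo ω ℓ ω * expo ω (-ℓ) s := by
    simp only [expo, ← Complex.exp_add]; congr 1; push_cast; ring
  rw [h, expo_period hω, one_mul]

lemma conj_expo (ω : ℝ) (ℓ : ℤ) (s : ℝ) : (starRingEnd ℂ) (expo ω ℓ s) = expo ω (-ℓ) s := by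
  have h2 : (starRingEnd ℂ) 2 = 2 := map_ofNat _ 2
  rw [expo, expo, ← Complex.exp_conj]
  congr 1
  simp [h2]

lemma hasDerivAt_expo (ω : ℝ) (ℓ : ℤ) (s : ℝ) :
    HasDerivAt (expo ω ℓ) (freq ω ℓ * expo ω ℓ s) s := by
  have h1 : HasDerivAt (fun z : ℂ => freq ω ℓ * z) (freq ω ℓ) (s : ℂ) := by
    simpa using (hasDerivAt_id (s : ℂ)).const_mul (freq ω ℓ)
  have := (h1.cexp).comp_ofReal
  rw [mul_comm] at this
  exact this

lemma integral_freq_mul_expo (ω : ℝ) (ℓ : ℤ) (t : ℝ) :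
    ∫ s in (0 : ℝ)..t, freq ω ℓ * expo ω ℓ s = expo ω ℓ t - 1 := by
  rw [intervalIntegral.integral_eq_sub_of_hasDerivAt (fun s _ => hasDerivAt_expo ω ℓ s)]
  · simp
  · exact (continuous_const.mul (continuous_expo ω ℓ)).intervalIntegrable _ _

lemma normMeasure_univ {ω : ℝ} (hω : 0 < ω) : normMeasure ω Set.univ = 1 := by
  simp only [normMeasure, Measure.smul_apply, Measure.restrict_apply_univ, Real.volume_Icc,
    sub_zero, smul_eq_mul]
  exact ENNReal.inv_mul_cancel (by simpa using hω) ENNReal.ofReal_ne_top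

lemma isProbabilityMeasure_normMeasure {ω : ℝ} (hω : 0 < ω) :
    IsProbabilityMeasure (normMeasure ω) := ⟨normMeasure_univ hω⟩

lemma ae_normMeasure_iff {ω : ℝ} {p : ℝ → Prop} :
    (∀ᵐ s ∂(normMeasure ω), p s) ↔ ∀ᵐ s ∂(volume.restrict (Set.Icc 0 ω)), p s := by
  rw [normMeasure, Measure.ae_ennreal_smul_measure_iff]
  simp

lemma integral_normMeasure {E : Type*} [NormedAddCommGroup E] [NormedSpace ℝ E] {ω : ℝ}
    (hω : 0 < ω) (f : ℝ → E) :
    ∫ s, f s ∂(normMeasure ω) = ω⁻¹ • ∫ s in (0 : ℝ)..ω, f s := by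
  rw [normMeasure, integral_smul_measure, intervalIntegral.integral_of_le hω.le,
    integral_Icc_eq_integral_Ioc]
  simp [ENNReal.toReal_ofReal hω.le]

lemma integral_expo {ω : ℝ} (hω : 0 < ω) (ℓ : ℤ) :
    ∫ s, expo ω ℓ s ∂(normMeasure ω) = if ℓ = 0 then 1 else 0 := by
  split_ifs with h
  · subst h
    have := isProbabilityMeasure_normMeasure hω
    simp
  · have h1 := integral_freq_mul_expo ω ℓ ω
    rw [expo_period hω, sub_self, intervalIntegral.integral_const_mul] at h1
    rw [integral_normMeasure hω, (mul_eq_zero.1 h1).resolve_left (freq_ne_zero hω h), smul_zero]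

end Exponentials

/-! ### Fourier series with values in a Hilbert space; operators built from coefficients. -/

section Fourier

variable {H : Type*} [NormedAddCommGroup H] [InnerProductSpace ℂ H]

lemma coeff_apply (ω : ℝ) (ℓ : ℤ) (x : L2 ω H) :
    coeff ω ℓ x = ∫ τ, expo ω (-ℓ) τ • x τ ∂(normMeasure ω) := rfl

lemma harmonic_apply (ω : ℝ) (ℓ : ℤ) (h : H) :
    harmonic ω ℓ h = (memLp_expo_smul ω ℓ (memLp_const h)).toLp (fun s => expo ω ℓ s • h) := rfl

lemma coeFn_harmonic (ω : ℝ) (ℓ : ℤ) (h : H) :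
    harmonic ω ℓ h =ᵐ[normMeasure ω] fun s => expo ω ℓ s • h :=
  MemLp.coeFn_toLp (memLp_expo_smul ω ℓ (memLp_const h))

lemma proj_apply (ω : ℝ) (ℓ : ℤ) (x : L2 ω H) : proj ω ℓ x = harmonic ω ℓ (coeff ω ℓ x) := rfl

lemma norm_harmonic {ω : ℝ} (hω : 0 < ω) (ℓ : ℤ) (h : H) : ‖harmonic ω ℓ h‖ = ‖h‖ := by
  have := isProbabilityMeasure_normMeasure hω
  rw [harmonic_apply, Lp.norm_toLp]
  have h1 : eLpNorm (fun s => expo ω ℓ s • h) 2 (normMeasure ω)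
      = eLpNorm (fun _ => h) 2 (normMeasure ω) :=
    eLpNorm_congr_norm_ae (Eventually.of_forall fun s => by simp [norm_smul, norm_expo])
  rw [h1, eLpNorm_const _ (by norm_num) (IsProbabilityMeasure.ne_zero _)]
  simp

/-- `harmonic` as an isometry. -/
def harmonicₗᵢ {ω : ℝ} (hω : 0 < ω) (ℓ : ℤ) : H →ₗᵢ[ℂ] L2 ω H :=
  { (harmonic ω ℓ).toLinearMap with norm_map' := norm_harmonic hω ℓ }

lemma harmonicₗᵢ_apply {ω : ℝ} (hω : 0 < ω) (ℓ : ℤ) (h : H) :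
    harmonicₗᵢ hω ℓ h = harmonic ω ℓ h := rfl

variable [CompleteSpace H]

lemma coeff_harmonic {ω : ℝ} (hω : 0 < ω) (j ℓ : ℤ) (h : H) :
    coeff ω j (harmonic ω ℓ h) = if j = ℓ then h else 0 := by
  have h1 : coeff ω j (harmonic ω ℓ h) = ∫ s, expo ω (ℓ - j) s • h ∂(normMeasure ω) := by
    rw [coeff_apply]
    refine integral_congr_ae ?_
    filter_upwards [coeFn_harmonic ω ℓ h] with s hs
    rw [hs, smul_smul, expo_mul]
    congr 2
    ring
  rw [h1, integral_smul_const, integral_expo hω]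
  simp only [sub_eq_zero, eq_comm (a := ℓ)]
  split_ifs <;> simp

lemma inner_harmonic (ω : ℝ) (ℓ : ℤ) (h : H) (x : L2 ω H) :
    inner ℂ (harmonic ω ℓ h) x = inner ℂ h (coeff ω ℓ x) := by
  have hi : Integrable (fun τ => expo ω (-ℓ) τ • x τ) (normMeasure ω) :=
    (memLp_expo_smul ω (-ℓ) (Lp.memLp x)).integrable (by norm_num)
  rw [coeff_apply, ← integral_inner hi, L2.inner_def]
  refine integral_congr_ae ?_
  filter_upwards [coeFn_harmonic ω ℓ h] with s hs
  rw [hs, inner_smul_left, inner_smul_right, conj_expo]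

lemma orthogonalFamily_harmonic {ω : ℝ} (hω : 0 < ω) :
    OrthogonalFamily ℂ (fun _ : ℤ => H) (harmonicₗᵢ hω) := by
  intro j ℓ hjl x y
  rw [harmonicₗᵢ_apply, harmonicₗᵢ_apply, inner_harmonic, coeff_harmonic hω, if_neg hjl,
    inner_zero_right]

/-- Scalar Parseval applied to s ↦ ⟨h, x(s)⟩ makes it vanish a.e. for each h. The null set depends
on h and H need not be separable; the essentially separable range of x removes this dependence. -/
lemma eq_zero_of_forall_coeff_eq_zero {ω : ℝ} (hω : 0 < ω) {x : L2 ω H}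
    (hx : ∀ ℓ, coeff ω ℓ x = 0) : x = 0 := by
  obtain ⟨t, ht, hxt⟩ := (Lp.aestronglyMeasurable x).isSeparable_ae_range
  have key : ∀ h : H, (fun s => inner ℂ h (x s)) =ᵐ[normMeasure ω] 0 := by
    intro h
    have hφ : MemLp (fun s => inner ℂ h (x s)) 2 (normMeasure ω) :=
      (Lp.memLp x).const_inner h
    have hφ' : MemLp (fun s => inner ℂ h (x s)) 2 (volume.restrict (Set.Ioc 0 ω)) := by
      have h0 : volume.restrict (Set.Ioc 0 ω) ≤ ENNReal.ofReal ω • normMeasure ω := by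
        rw [normMeasure, smul_smul, ENNReal.mul_inv_cancel (by simpa using hω)
          ENNReal.ofReal_ne_top, one_smul]
        exact Measure.restrict_mono Set.Ioc_subset_Icc_self le_rfl
      exact hφ.of_measure_le_smul ENNReal.ofReal_ne_top h0
    have hc : ∀ n, fourierCoeffOn hω (fun s => inner ℂ h (x s)) n = 0 := by
      intro n
      have hi : Integrable (fun τ => expo ω (-n) τ • x τ) (normMeasure ω) :=
        (memLp_expo_smul ω (-n) (Lp.memLp x)).integrable (by norm_num)
      have h1 : inner ℂ h (coeff ω n x) = 0 := by rw [hx, inner_zero_right]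
      rw [coeff_apply, ← integral_inner hi, integral_normMeasure hω] at h1
      rw [fourierCoeffOn_eq_integral, ← h1, sub_zero, one_div]
      congr 1
      refine intervalIntegral.integral_congr fun s _ => ?_
      simp only [inner_smul_right, smul_eq_mul, fourier_coe_apply, expo]
      congr 2
      push_cast
      ring
    have hs := hasSum_sq_fourierCoeffOn hω hφ'
    simp only [hc, norm_zero, ne_eq, OfNat.ofNat_ne_zero, not_false_eq_true, zero_pow,
      sub_zero] at hs
    have h0 := hs.unique hasSum_zero
    rw [smul_eq_mul, mul_eq_zero, or_iff_right (inv_ne_zero hω.ne'),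
      intervalIntegral.integral_of_le hω.le,
      integral_eq_zero_iff_of_nonneg (fun s => by positivity)] at h0
    · change ∀ᵐ s ∂(normMeasure ω), _
      rw [ae_normMeasure_iff, ← restrict_Ioc_eq_restrict_Icc]
      filter_upwards [h0] with s hs
      simpa using hs
    · exact (memLp_two_iff_integrable_sq_norm hφ'.1).1 hφ'
  have := ae_eq_zero_of_forall_dual_of_isSeparable ℂ ht (f := x) (μ := normMeasure ω)
    (fun c => by
      filter_upwards [key ((InnerProductSpace.toDual ℂ H).symm c)] with s hs
      simpa using hs) hxt
  exact (Lp.eq_zero_iff_ae_eq_zero).2 this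

lemma isHilbertSum_harmonic {ω : ℝ} (hω : 0 < ω) :
    IsHilbertSum ℂ (fun _ : ℤ => H) (harmonicₗᵢ (H := H) hω) := by
  refine IsHilbertSum.mk (orthogonalFamily_harmonic hω) ?_
  rw [top_le_iff, Submodule.topologicalClosure_eq_top_iff, Submodule.eq_bot_iff]
  intro x hx
  refine eq_zero_of_forall_coeff_eq_zero hω fun ℓ => ?_
  rw [Submodule.mem_orthogonal] at hx
  have h1 := hx (harmonic ω ℓ (coeff ω ℓ x))
    (Submodule.mem_iSup_of_mem ℓ ⟨coeff ω ℓ x, rfl⟩)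
  rwa [inner_harmonic, inner_self_eq_zero] at h1

lemma ext_coeff {ω : ℝ} (hω : 0 < ω) {x y : L2 ω H} (h : ∀ ℓ, coeff ω ℓ x = coeff ω ℓ y) :
    x = y := by
  rw [← sub_eq_zero]
  refine eq_zero_of_forall_coeff_eq_zero hω fun ℓ => ?_
  rw [map_sub, h, sub_self]

lemma linearIsometryEquiv_apply_eq_coeff {ω : ℝ} (hω : 0 < ω) (x : L2 ω H) (ℓ : ℤ) :
    (isHilbertSum_harmonic hω).linearIsometryEquiv x ℓ = coeff ω ℓ x := by
  set e := (isHilbertSum_harmonic (H := H) hω).linearIsometryEquiv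
  have h1 := ((isHilbertSum_harmonic hω).hasSum_linearIsometryEquiv_symm (e x)).mapL (coeff ω ℓ)
  have h2 : e.symm (e x) = x := e.symm_apply_apply x
  rw [h2] at h1
  simp only [harmonicₗᵢ_apply, coeff_harmonic hω] at h1
  refine HasSum.unique ?_ h1
  convert hasSum_ite_eq ℓ (e x ℓ) using 2 with j
  by_cases hj : j = ℓ
  · subst hj; simp
  · simp [hj, Ne.symm hj]

lemma hasSum_proj {ω : ℝ} (hω : 0 < ω) (x : L2 ω H) : HasSum (fun ℓ => proj ω ℓ x) x := by
  have h1 := (isHilbertSum_harmonic hω).hasSum_linearIsometryEquiv_symm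
    ((isHilbertSum_harmonic hω).linearIsometryEquiv x)
  rw [LinearIsometryEquiv.symm_apply_apply] at h1
  simp only [harmonicₗᵢ_apply, linearIsometryEquiv_apply_eq_coeff] at h1
  exact h1

lemma hasSum_norm_coeff_sq {ω : ℝ} (hω : 0 < ω) (x : L2 ω H) :
    HasSum (fun ℓ => ‖coeff ω ℓ x‖ ^ 2) (‖x‖ ^ 2) := by
  have h1 := lp.hasSum_norm (p := 2) (by norm_num)
    ((isHilbertSum_harmonic hω).linearIsometryEquiv x)
  simpa [linearIsometryEquiv_apply_eq_coeff] using h1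

lemma exists_coeff_eq {ω : ℝ} (hω : 0 < ω) {a : ℤ → H} (ha : Summable fun ℓ => ‖a ℓ‖ ^ 2) :
    ∃ x : L2 ω H, ∀ ℓ, coeff ω ℓ x = a ℓ := by
  have hm : Memℓp a 2 := memℓp_gen (by simpa using ha)
  refine ⟨(isHilbertSum_harmonic hω).linearIsometryEquiv.symm ⟨a, hm⟩, fun ℓ => ?_⟩
  rw [← linearIsometryEquiv_apply_eq_coeff hω, LinearIsometryEquiv.apply_symm_apply]

lemma norm_coeff_le {ω : ℝ} (hω : 0 < ω) (ℓ : ℤ) (x : L2 ω H) : ‖coeff ω ℓ x‖ ≤ ‖x‖ := by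
  have h := (hasSum_norm_coeff_sq hω x)
  have := le_hasSum h ℓ fun j _ => by positivity
  exact (sq_le_sq₀ (norm_nonneg _) (norm_nonneg _)).1 this

lemma opNorm_coeff_le {ω : ℝ} (hω : 0 < ω) (ℓ : ℤ) : ‖coeff (H := H) ω ℓ‖ ≤ 1 :=
  ContinuousLinearMap.opNorm_le_bound _ zero_le_one fun x => by
    simpa using norm_coeff_le hω ℓ x

/-- A family of operators `a ℓ : E → H` which is square summable in the strong sense assembles to an
operator `E → L²`. -/
lemma exists_ofCoeff {E : Type*} [NormedAddCommGroup E] [NormedSpace ℂ E] {ω : ℝ} (hω : 0 < ω)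
    (a : ℤ → E →L[ℂ] H) {M : ℝ} (hM : 0 ≤ M) (hs : ∀ f, Summable fun ℓ => ‖a ℓ f‖ ^ 2)
    (hb : ∀ f, ∑' ℓ, ‖a ℓ f‖ ^ 2 ≤ (M * ‖f‖) ^ 2) :
    ∃ S : E →L[ℂ] L2 ω H, (∀ ℓ f, coeff ω ℓ (S f) = a ℓ f) ∧ ‖S‖ ≤ M := by
  choose S hS using fun f => exists_coeff_eq hω (hs f)
  have hn : ∀ f, ‖S f‖ ≤ M * ‖f‖ := by
    intro f
    refine (sq_le_sq₀ (norm_nonneg _) (by positivity)).1 ?_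
    have h := (hasSum_norm_coeff_sq hω (S f)).tsum_eq
    simp only [hS] at h
    exact h ▸ hb f
  let L : E →ₗ[ℂ] L2 ω H :=
    { toFun := S
      map_add' := fun f g => ext_coeff hω fun ℓ => by simp [hS]
      map_smul' := fun c f => ext_coeff hω fun ℓ => by simp [hS] }
  exact ⟨L.mkContinuous M hn, fun ℓ f => hS f ℓ, L.mkContinuous_norm_le hM hn⟩

/-- Block diagonal operators. -/
lemma exists_diag {ω : ℝ} (hω : 0 < ω) (F : ℤ → H →L[ℂ] H) {M : ℝ} (hM : 0 ≤ M)
    (hF : ∀ ℓ, ‖F ℓ‖ ≤ M) :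
    ∃ S : L2 ω H →L[ℂ] L2 ω H, (∀ ℓ f, coeff ω ℓ (S f) = F ℓ (coeff ω ℓ f)) ∧ ‖S‖ ≤ M := by
  have hle : ∀ f ℓ, ‖F ℓ (coeff ω ℓ f)‖ ^ 2 ≤ M ^ 2 * ‖coeff ω ℓ f‖ ^ 2 := fun f ℓ => by
    rw [← mul_pow]
    gcongr
    exact (F ℓ).le_of_opNorm_le (hF ℓ) _
  have hsum := fun f : L2 ω H => (hasSum_norm_coeff_sq hω f).mul_left (M ^ 2)
  have hs := fun f : L2 ω H =>
    Summable.of_nonneg_of_le (fun ℓ => by positivity) (hle f) (hsum f).summable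
  refine exists_ofCoeff hω (fun ℓ => (F ℓ).comp (coeff ω ℓ)) hM hs fun f => ?_
  rw [mul_pow, ← (hsum f).tsum_eq]
  exact (hs f).tsum_le_tsum (hle f) (hsum f).summable

/-- A square summable family of columns `c ℓ : H → E` assembles to an operator `L² → E`. -/
lemma exists_ofColumns {E : Type*} [NormedAddCommGroup E] [NormedSpace ℂ E] [CompleteSpace E]
    {ω : ℝ} (hω : 0 < ω) (c : ℤ → H →L[ℂ] E) (hc : Summable fun ℓ => ‖c ℓ‖ ^ 2) :
    ∃ S : L2 ω H →L[ℂ] E, (∀ f, HasSum (fun ℓ => c ℓ (coeff ω ℓ f)) (S f)) ∧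
      (∀ f : L2 ω H, Summable fun ℓ => ‖c ℓ‖ * ‖coeff ω ℓ f‖) ∧
      (∀ f, ‖S f‖ ≤ ∑' ℓ, ‖c ℓ‖ * ‖coeff ω ℓ f‖) ∧
      ‖S‖ ≤ Real.sqrt (∑' ℓ, ‖c ℓ‖ ^ 2) := by
  have hcs := fun f : L2 ω H => summable_mul_and_tsum_mul_le (f := fun ℓ => ‖c ℓ‖)
    (g := fun ℓ => ‖coeff ω ℓ f‖) (fun _ => norm_nonneg _) (fun _ => norm_nonneg _) hc
    (hasSum_norm_coeff_sq hω f).summable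
  have hle : ∀ (f : L2 ω H) ℓ, ‖c ℓ (coeff ω ℓ f)‖ ≤ ‖c ℓ‖ * ‖coeff ω ℓ f‖ := fun f ℓ =>
    (c ℓ).le_opNorm _
  have hs := fun f : L2 ω H => Summable.of_norm_bounded (hcs f).1 (hle f)
  have hn : ∀ f : L2 ω H, ‖∑' ℓ, c ℓ (coeff ω ℓ f)‖ ≤ ∑' ℓ, ‖c ℓ‖ * ‖coeff ω ℓ f‖ := fun f =>
    tsum_of_norm_bounded (hcs f).1.hasSum (hle f)
  have hn' : ∀ f : L2 ω H, ‖∑' ℓ, c ℓ (coeff ω ℓ f)‖ ≤ Real.sqrt (∑' ℓ, ‖c ℓ‖ ^ 2) * ‖f‖ :=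
    fun f => by
      refine (hn f).trans ((hcs f).2.trans_eq ?_)
      rw [(hasSum_norm_coeff_sq hω f).tsum_eq, Real.sqrt_sq (norm_nonneg _)]
  let L : L2 ω H →ₗ[ℂ] E :=
    { toFun := fun f => ∑' ℓ, c ℓ (coeff ω ℓ f)
      map_add' := fun f g => by
        simp only [map_add]
        exact (hs f).tsum_add (hs g)
      map_smul' := fun a f => by
        simp only [map_smul, RingHom.id_apply]
        exact tsum_const_smul'' a }
  exact ⟨L.mkContinuous _ hn', fun f => (hs f).hasSum, fun f => (hcs f).1, hn,
    L.mkContinuous_norm_le (Real.sqrt_nonneg _) hn'⟩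

end Fourier

/-! ### The domain of L and the action of L in Fourier coefficients. -/

section PeriodicDerivative

lemma summable_norm_freq_inv_sq {ω : ℝ} (hω : 0 < ω) :
    Summable fun ℓ : ℤ => ‖(freq ω ℓ)⁻¹‖ ^ 2 := by
  have h := (Real.summable_one_div_int_pow (p := 2)).2 (by norm_num)
  refine (h.mul_left ((2 * Real.pi / ω)⁻¹ ^ 2)).congr fun ℓ => ?_
  rw [norm_inv, norm_freq hω, mul_inv, mul_pow, one_div, inv_pow, inv_pow, sq_abs]

variable {H : Type*} [NormedAddCommGroup H] [InnerProductSpace ℂ H]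

section LpLemmas

lemma ae_eq_of_hasSum {α : Type*} [MeasurableSpace α] {μ : Measure α} {F : ℤ → Lp H 2 μ}
    {S : Lp H 2 μ} (hF : HasSum F S) {φ : α → H} (hφ : ∀ᵐ s ∂μ, HasSum (fun ℓ => F ℓ s) (φ s)) :
    S =ᵐ[μ] φ := by
  have hm := tendstoInMeasure_of_tendsto_Lp (hF.comp (Finset.tendsto_Icc_neg (R := ℤ)))
  obtain ⟨ns, hns, hae⟩ := hm.exists_seq_tendsto_ae
  have hall : ∀ᵐ s ∂μ, ∀ n : ℕ, (∑ ℓ ∈ Finset.Icc (-(n : ℤ)) n, F ℓ : Lp H 2 μ) s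
      = ∑ ℓ ∈ Finset.Icc (-(n : ℤ)) n, F ℓ s := ae_all_iff.2 fun n => by
    filter_upwards [Lp.coeFn_finsetSum (Finset.Icc (-(n : ℤ)) n) F] with s hs
    simpa using hs
  filter_upwards [hae, hall, hφ] with s h1 h2 h3
  refine tendsto_nhds_unique h1 ?_
  refine ((h3.comp (Finset.tendsto_Icc_neg (R := ℤ))).comp hns.tendsto_atTop).congr fun i => ?_
  exact (h2 (ns i)).symm

lemma setIntegral_normMeasure {E : Type*} [NormedAddCommGroup E] [NormedSpace ℝ E] {ω : ℝ}
    (hω : 0 < ω) {s : ℝ} (hs : s ∈ Set.Icc 0 ω) (f : ℝ → E) :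
    ∫ τ in Set.Ioc 0 s, f τ ∂(normMeasure ω) = ω⁻¹ • ∫ τ in (0 : ℝ)..s, f τ := by
  have h : Set.Ioc 0 s ∩ Set.Icc 0 ω = Set.Ioc 0 s :=
    Set.inter_eq_left.2 fun x hx => ⟨hx.1.le, hx.2.trans hs.2⟩
  rw [normMeasure, Measure.restrict_smul, integral_smul_measure,
    Measure.restrict_restrict measurableSet_Ioc, h, intervalIntegral.integral_of_le hs.1]
  simp [ENNReal.toReal_ofReal hω.le]

end LpLemmas

/-- `f ∈ D(d/ds)` and `g = f'`, in terms of Fourier coefficients. -/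
def IsDeriv (ω : ℝ) (f g : L2 ω H) : Prop := ∀ ℓ, coeff ω ℓ g = freq ω ℓ • coeff ω ℓ f

variable [CompleteSpace H]

/-- Writes a component of the primitive as an L² pairing, hence as a continuous functional of g;
this is what permits termwise integration of a series that converges only in L². -/
lemma inner_primitive {ω : ℝ} (hω : 0 < ω) {s : ℝ} (hs : s ∈ Set.Icc 0 ω) (c : H) (g : L2 ω H) :
    inner ℂ c (ω⁻¹ • ∫ τ in (0 : ℝ)..s, g τ)
      = inner ℂ (indicatorConstLp 2 (μ := normMeasure ω) (measurableSet_Ioc (a := 0) (b := s))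
        (measure_ne_top _ _) c) g := by
  rw [L2.inner_indicatorConstLp_eq_inner_setIntegral, setIntegral_normMeasure hω hs]

lemma primitive_proj {ω : ℝ} {s : ℝ} (hs : s ∈ Set.Icc 0 ω) {f g : L2 ω H}
    (h : IsDeriv ω f g) (ℓ : ℤ) :
    ∫ τ in (0 : ℝ)..s, proj ω ℓ g τ = (expo ω ℓ s - 1) • coeff ω ℓ f := by
  have h1 : ∫ τ in (0 : ℝ)..s, proj ω ℓ g τ
      = ∫ τ in (0 : ℝ)..s, (freq ω ℓ * expo ω ℓ τ) • coeff ω ℓ f := by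
    rw [intervalIntegral.integral_of_le hs.1, intervalIntegral.integral_of_le hs.1]
    refine integral_congr_ae ?_
    have h2 := coeFn_harmonic ω ℓ (coeff ω ℓ g)
    have h3 := ae_normMeasure_iff.1 h2
    have h4 : ∀ᵐ τ ∂(volume.restrict (Set.Ioc 0 s)), _ :=
      ae_restrict_of_ae_restrict_of_subset
        (fun x hx => ⟨hx.1.le, hx.2.trans hs.2⟩ : Set.Ioc 0 s ⊆ Set.Icc 0 ω) h3
    filter_upwards [h4] with τ hτ
    rw [proj_apply, hτ, h ℓ, smul_smul, mul_comm]
  rw [h1, intervalIntegral.integral_smul_const, integral_freq_mul_expo]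

namespace IsDeriv

variable {ω : ℝ} {f g : L2 ω H}

lemma summable_coeff (hω : 0 < ω) (h : IsDeriv ω f g) : Summable fun ℓ => ‖coeff ω ℓ f‖ := by
  have h1 := (summable_mul_and_tsum_mul_le (fun ℓ => norm_nonneg (freq ω ℓ)⁻¹)
    (fun ℓ => norm_nonneg (coeff ω ℓ g)) (summable_norm_freq_inv_sq hω)
    (hasSum_norm_coeff_sq hω g).summable).1
  have h2 : Summable fun ℓ : ℤ => if ℓ = 0 then ‖coeff ω 0 f‖ else 0 :=
    (hasSum_ite_eq 0 _).summable
  refine (h1.add h2).congr fun ℓ => ?_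
  by_cases hℓ : ℓ = 0
  · subst hℓ; simp
  · rw [if_neg hℓ, add_zero, h ℓ, norm_smul, norm_inv,
      inv_mul_cancel_left₀ (norm_ne_zero_iff.2 (freq_ne_zero hω hℓ))]

lemma hasSum_trig (hω : 0 < ω) (h : IsDeriv ω f g) (s : ℝ) :
    HasSum (fun ℓ => expo ω ℓ s • coeff ω ℓ f) (∑' ℓ, expo ω ℓ s • coeff ω ℓ f) := by
  refine (Summable.of_norm ?_).hasSum
  simpa only [norm_smul, norm_expo, one_mul] using h.summable_coeff hω

lemma ae_eq_trig (hω : 0 < ω) (h : IsDeriv ω f g) :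
    f =ᵐ[normMeasure ω] fun s => ∑' ℓ, expo ω ℓ s • coeff ω ℓ f := by
  refine ae_eq_of_hasSum (hasSum_proj hω f) ?_
  have hall : ∀ᵐ s ∂(normMeasure ω), ∀ ℓ, proj ω ℓ f s = expo ω ℓ s • coeff ω ℓ f :=
    ae_all_iff.2 fun ℓ => coeFn_harmonic ω ℓ (coeff ω ℓ f)
  filter_upwards [hall] with s hs
  simpa only [hs] using h.hasSum_trig hω s

lemma primitive_eq (hω : 0 < ω) (h : IsDeriv ω f g) {s : ℝ} (hs : s ∈ Set.Icc 0 ω) :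
    ∫ τ in (0 : ℝ)..s, g τ
      = ∑' ℓ, expo ω ℓ s • coeff ω ℓ f - ∑' ℓ, expo ω ℓ 0 • coeff ω ℓ f := by
  have h1 := (h.hasSum_trig hω s).sub (h.hasSum_trig hω 0)
  have hω' : ω⁻¹ ≠ 0 := inv_ne_zero hω.ne'
  -- Both sides are compared after pairing with an arbitrary c; the L² expansion of g is then
  -- integrated term by term.
  refine smul_right_injective H hω' (ext_inner_left ℂ fun c => ?_)
  dsimp only
  have h2 := ((h1.const_smul ω⁻¹).mapL (innerSL ℂ c))
  have h3 := (hasSum_proj hω g).mapL (innerSL ℂ (indicatorConstLp 2 (μ := normMeasure ω)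
    (measurableSet_Ioc (a := 0) (b := s)) (measure_ne_top _ _) c))
  simp only [innerSL_apply_apply, ← inner_primitive hω hs, primitive_proj hs h] at h3
  simp only [innerSL_apply_apply, expo_zero_right, ← sub_smul] at h2
  simp only [expo_zero_right]
  exact h3.unique h2

lemma isPeriodicW12 (hω : 0 < ω) (h : IsDeriv ω f g) :
    IsPeriodicW12 ω (fun s => ∑' ℓ, expo ω ℓ s • coeff ω ℓ f) g := by
  refine ⟨fun s hs => ?_, ?_⟩
  · rw [h.primitive_eq hω hs]; abel
  · simp [expo_period hω]

end IsDeriv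

/-- Periodicity of y forces the mean of g to vanish, so g has a periodic primitive f' obtained by
dividing coefficients by the frequencies. As f and f' have the same derivative, they differ by a
constant, which only affects the coefficient at frequency 0. -/
lemma isDeriv_of_isPeriodicW12 {ω : ℝ} (hω : 0 < ω) {f g : L2 ω H} {y : ℝ → H}
    (hy : IsPeriodicW12 ω y g) (hf : f =ᵐ[normMeasure ω] y) : IsDeriv ω f g := by
  have h0 : coeff ω 0 g = 0 := by
    have h1 := hy.1 ω ⟨hω.le, le_rfl⟩
    rw [← hy.2, left_eq_add] at h1
    rw [coeff_apply, integral_normMeasure hω]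
    simp [h1]
  have hle : ∀ ℓ, ‖(freq ω ℓ)⁻¹ • coeff ω ℓ g‖ ^ 2 ≤ ‖(freq ω ℓ)⁻¹‖ ^ 2 * ‖g‖ ^ 2 := fun ℓ => by
    rw [norm_smul, mul_pow]
    gcongr
    exact norm_coeff_le hω ℓ g
  obtain ⟨f', hf'⟩ := exists_coeff_eq hω (a := fun ℓ => (freq ω ℓ)⁻¹ • coeff ω ℓ g)
    (Summable.of_nonneg_of_le (fun ℓ => by positivity) hle
      ((summable_norm_freq_inv_sq hω).mul_right _))
  have hd : IsDeriv ω f' g := fun ℓ => by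
    by_cases hℓ : ℓ = 0
    · subst hℓ; simp [h0]
    · rw [hf', smul_inv_smul₀ (freq_ne_zero hω hℓ)]
  obtain ⟨c, hc⟩ : ∃ c : H, f = f' + harmonic ω 0 c := by
    refine ⟨y 0 - ∑' ℓ, expo ω ℓ 0 • coeff ω ℓ f', Lp.ext ?_⟩
    have hmem : ∀ᵐ s ∂(normMeasure ω), s ∈ Set.Icc 0 ω :=
      ae_normMeasure_iff.2 (ae_restrict_mem measurableSet_Icc)
    filter_upwards [hf, hd.ae_eq_trig hω, coeFn_harmonic ω 0
      (y 0 - ∑' ℓ, expo ω ℓ 0 • coeff ω ℓ f'), Lp.coeFn_add f' (harmonic ω 0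
      (y 0 - ∑' ℓ, expo ω ℓ 0 • coeff ω ℓ f')), hmem] with s h1 h2 h3 h4 h5
    rw [h1, h4, Pi.add_apply, h2, h3, hy.1 s h5, hd.primitive_eq hω h5, expo_zero_left, one_smul]
    abel
  intro ℓ
  rw [hc, hd ℓ, map_add, smul_add, coeff_harmonic hω]
  by_cases hℓ : ℓ = 0 <;> simp [hℓ]

lemma mem_domL_iff {ω : ℝ} (hω : 0 < ω) (f : L2 ω H) : f ∈ domL ω ↔ ∃ g, IsDeriv ω f g :=
  ⟨fun ⟨_, g, hy, hf⟩ => ⟨g, isDeriv_of_isPeriodicW12 hω hy hf⟩,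
    fun ⟨g, h⟩ => ⟨_, g, h.isPeriodicW12 hω, h.ae_eq_trig hω⟩⟩

section Potential

variable {ω : ℝ} {V : ℝ → H →L[ℂ] H}

lemma IsStrongL2.expo_smul (hV : IsStrongL2 ω V) (ℓ : ℤ) :
    IsStrongL2 ω fun s => expo ω ℓ s • V s :=
  fun x => memLp_expo_smul ω ℓ (hV x)

lemma coeFn_potentialMap (hV : IsStrongL2 ω V) (x : H) :
    potentialMap ω V hV x =ᵐ[normMeasure ω] fun s => V s x := by
  rw [potentialMap, ContinuousLinearMap.coeFn_ofSeqClosedGraph]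
  exact (hV x).coeFn_toLp

/-- The operator `h ↦ V(s) e_ℓ(ω - s) h` from `H` to `L²`. -/
def pot (hV : IsStrongL2 ω V) (ℓ : ℤ) : H →L[ℂ] L2 ω H :=
  potentialMap ω (fun s => expo ω (-ℓ) s • V s) (hV.expo_smul (-ℓ))

lemma coeFn_pot (hV : IsStrongL2 ω V) (ℓ : ℤ) (x : H) :
    pot hV ℓ x =ᵐ[normMeasure ω] fun s => expo ω (-ℓ) s • V s x :=
  coeFn_potentialMap (hV.expo_smul (-ℓ)) x

lemma norm_pot_le (hV : IsStrongL2 ω V) (ℓ : ℤ) : ‖pot hV ℓ‖ ≤ ‖potentialMap ω V hV‖ := by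
  refine ContinuousLinearMap.opNorm_le_bound _ (by positivity) fun x => ?_
  refine le_trans (Lp.norm_le_norm_of_ae_le ?_) ((potentialMap ω V hV).le_opNorm x)
  filter_upwards [coeFn_pot hV ℓ x, coeFn_potentialMap hV x] with s h1 h2
  rw [h1, h2, norm_smul, norm_expo, one_mul]

lemma coeff_pot (hV : IsStrongL2 ω V) (j ℓ : ℤ) (x : H) :
    coeff ω j (pot hV ℓ x) = potCoeff ω V hV (j + ℓ) x := by
  change _ = coeff ω (j + ℓ) (potentialMap ω V hV x)
  rw [coeff_apply, coeff_apply]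
  refine integral_congr_ae ?_
  filter_upwards [coeFn_pot hV ℓ x, coeFn_potentialMap hV x] with s h1 h2
  rw [h1, h2, smul_smul, expo_mul]
  congr 2
  ring

/-- `f ∈ D(L)` and `L f = h`, in terms of Fourier coefficients. -/
def IsFourierValueL (hV : IsStrongL2 ω V) (f h : L2 ω H) : Prop :=
  ∃ g, IsDeriv ω f g ∧ h = g - ∑' ℓ, pot hV ℓ (coeff ω ℓ f)

/-- The columns of the perturbation are uniformly bounded and the coefficients of f are absolutely
summable, so the series is absolutely convergent in L². -/
lemma IsDeriv.hasSum_pot (hω : 0 < ω) (hV : IsStrongL2 ω V) {f g : L2 ω H} (h : IsDeriv ω f g) :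
    HasSum (fun ℓ => pot hV ℓ (coeff ω ℓ f)) (∑' ℓ, pot hV ℓ (coeff ω ℓ f)) := by
  refine (Summable.of_norm_bounded
    ((h.summable_coeff hω).mul_left ‖potentialMap ω V hV‖) fun ℓ => ?_).hasSum
  exact (pot hV ℓ).le_of_opNorm_le (norm_pot_le hV ℓ) _

/-- For almost every s the series also converges pointwise to V(s) applied to the trigonometric
series at ω − s, and an L² sum agrees a.e. with a pointwise sum. -/
lemma IsFourierValueL.isValueL (hω : 0 < ω) (hV : IsStrongL2 ω V) {f h : L2 ω H}
    (hL : IsFourierValueL hV f h) : IsValueL ω V f h := by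
  obtain ⟨g, hd, rfl⟩ := hL
  refine ⟨_, g, hd.isPeriodicW12 hω, hd.ae_eq_trig hω, ?_⟩
  have h1 : (∑' ℓ, pot hV ℓ (coeff ω ℓ f) : L2 ω H) =ᵐ[normMeasure ω]
      fun s => V s (∑' ℓ, expo ω ℓ (ω - s) • coeff ω ℓ f) := by
    refine ae_eq_of_hasSum (hd.hasSum_pot hω hV) ?_
    have hall : ∀ᵐ s ∂(normMeasure ω), ∀ ℓ,
        pot hV ℓ (coeff ω ℓ f) s = expo ω (-ℓ) s • V s (coeff ω ℓ f) :=
      ae_all_iff.2 fun ℓ => coeFn_pot hV ℓ (coeff ω ℓ f)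
    filter_upwards [hall] with s hs
    simpa only [hs, map_smul, expo_reflect hω] using (hd.hasSum_trig hω (ω - s)).mapL (V s)
  filter_upwards [h1, Lp.coeFn_sub g (∑' ℓ, pot hV ℓ (coeff ω ℓ f))] with s h2 h3
  rw [h3, Pi.sub_apply, h2]

end Potential

end PeriodicDerivative

/-! ### The resolvent of L at large real points; linearity and closedness of L. -/

section Resolvent

lemma exists_rightInverse_one_sub {E : Type*} [NormedAddCommGroup E] [NormedSpace ℂ E]
    [CompleteSpace E] {K : E →L[ℂ] E} (hK : ‖K‖ < 1) :
    ∃ S : E →L[ℂ] E, (∀ x, S x - K (S x) = x) ∧ ∀ x, S (x - K x) = x := by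
  obtain ⟨u, hu⟩ := isUnit_one_sub_of_norm_lt_one hK
  refine ⟨(u⁻¹ : (E →L[ℂ] E)ˣ), fun x => ?_, fun x => ?_⟩
  · have := congrArg (fun T : E →L[ℂ] E => T x) u.mul_inv
    rw [hu] at this
    exact this
  · have := congrArg (fun T : E →L[ℂ] E => T x) u.inv_mul
    rw [hu] at this
    exact this

lemma normSMulClass_continuousLinearMap (E F : Type*) [NormedAddCommGroup E] [NormedSpace ℂ E]
    [NormedAddCommGroup F] [NormedSpace ℂ F] : NormSMulClass ℂ (E →L[ℂ] F) := inferInstance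

instance (ω : ℝ) (E H : Type*) [NormedAddCommGroup E] [NormedSpace ℂ E] [NormedAddCommGroup H]
    [InnerProductSpace ℂ H] : NormSMulClass ℂ (E →L[ℂ] L2 ω H) :=
  normSMulClass_continuousLinearMap E (L2 ω H)

lemma norm_freq_sub_inv_le (ω : ℝ) (ℓ : ℤ) {μ : ℝ} (hμ : 0 < μ) :
    ‖(freq ω ℓ - μ)⁻¹‖ ≤ μ⁻¹ := by
  rw [norm_inv]
  refine inv_anti₀ hμ ?_
  have := Complex.abs_re_le_norm (freq ω ℓ - μ)
  rw [Complex.sub_re, freq_re, Complex.ofReal_re, zero_sub, abs_neg, abs_of_pos hμ] at this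
  exact this

lemma freq_sub_ne_zero (ω : ℝ) (ℓ : ℤ) {μ : ℝ} (hμ : 0 < μ) : freq ω ℓ - μ ≠ 0 := by
  intro h
  have := congrArg Complex.re h
  rw [Complex.sub_re, freq_re, Complex.ofReal_re, Complex.zero_re] at this
  linarith

/-- The frequencies are purely imaginary, so a real shift only moves them away from 0. The extra 1
at ℓ = 0 compensates the convention 0⁻¹ = 0 and gives a summable majorant independent of μ. -/
lemma norm_freq_sub_inv_sq_le {ω : ℝ} (hω : 0 < ω) (ℓ : ℤ) {μ : ℝ} (hμ : 1 ≤ μ) :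
    ‖(freq ω ℓ - μ)⁻¹‖ ^ 2 ≤ ‖(freq ω ℓ)⁻¹‖ ^ 2 + if ℓ = 0 then 1 else 0 := by
  split_ifs with h
  · have h1 := norm_freq_sub_inv_le ω ℓ (by linarith : 0 < μ)
    have h2 : μ⁻¹ ≤ 1 := inv_le_one_of_one_le₀ hμ
    have h3 : ‖(freq ω ℓ - μ)⁻¹‖ ^ 2 ≤ 1 := pow_le_one₀ (norm_nonneg _) (h1.trans h2)
    have : 0 ≤ ‖(freq ω ℓ)⁻¹‖ ^ 2 := by positivity
    linarith
  · rw [add_zero, norm_inv, norm_inv]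
    have h0 : 0 < ‖freq ω ℓ‖ := norm_pos_iff.2 (freq_ne_zero hω h)
    have h1 : ‖freq ω ℓ‖ ≤ ‖freq ω ℓ - μ‖ := by
      rw [Complex.norm_def, Complex.norm_def, Complex.normSq_apply, Complex.normSq_apply]
      refine Real.sqrt_le_sqrt ?_
      simp only [Complex.sub_re, Complex.sub_im, freq_re, Complex.ofReal_re, Complex.ofReal_im]
      nlinarith
    gcongr

variable {H : Type*} [NormedAddCommGroup H] [InnerProductSpace ℂ H] [CompleteSpace H]
  {ω : ℝ} {V : ℝ → H →L[ℂ] H}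

/-- For large `μ` the operator `L - μ` has a bounded inverse. -/
lemma eventually_exists_resolvent (hω : 0 < ω) (hV : IsStrongL2 ω V) :
    ∀ᶠ μ : ℝ in atTop, ∃ R : L2 ω H →L[ℂ] L2 ω H,
      ∀ f h, IsFourierValueL hV f h ↔ f = R (h - (μ : ℂ) • f) := by
  set M := ‖potentialMap ω V hV‖ with hM
  have hM0 : 0 ≤ M := by positivity
  have hbound : Summable fun ℓ : ℤ =>
      (‖(freq ω ℓ)⁻¹‖ ^ 2 + if ℓ = 0 then (1 : ℝ) else 0) * M ^ 2 :=
    ((summable_norm_freq_inv_sq hω).add (hasSum_ite_eq 0 (1 : ℝ)).summable).mul_right _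
  have hle : ∀ μ : ℝ, 1 ≤ μ → ∀ ℓ : ℤ, ‖(freq ω ℓ - μ)⁻¹ • pot hV ℓ‖ ^ 2
      ≤ (‖(freq ω ℓ)⁻¹‖ ^ 2 + if ℓ = 0 then (1 : ℝ) else 0) * M ^ 2 := fun μ hμ ℓ => by
    rw [norm_smul, mul_pow]
    gcongr
    · exact norm_freq_sub_inv_sq_le hω ℓ hμ
    · exact norm_pot_le hV ℓ
  -- Dominated convergence makes the square sum of the column norms of K = (perturbation)(d/ds −
  -- μ)⁻¹ tend to 0, hence ‖K‖ < 1 for large μ.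
  have hlim : Tendsto (fun μ : ℝ => ∑' ℓ : ℤ, ‖(freq ω ℓ - μ)⁻¹ • pot hV ℓ‖ ^ 2) atTop (𝓝 0) := by
    have h0 : (0 : ℝ) = ∑' _ : ℤ, (0 : ℝ) := tsum_zero.symm
    rw [h0]
    refine tendsto_tsum_of_dominated_convergence hbound (fun ℓ => ?_) ?_
    · have h1 : Tendsto (fun μ : ℝ => (μ⁻¹ * ‖pot hV ℓ‖) ^ 2) atTop (𝓝 0) := by
        simpa using ((tendsto_inv_atTop_zero (𝕜 := ℝ)).mul_const ‖pot hV ℓ‖).pow 2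
      refine squeeze_zero' (Eventually.of_forall fun μ => by positivity) ?_ h1
      filter_upwards [eventually_gt_atTop 0] with μ hμ
      rw [norm_smul]
      gcongr
      exact norm_freq_sub_inv_le ω ℓ hμ
    · filter_upwards [eventually_ge_atTop 1] with μ hμ ℓ
      rw [Real.norm_of_nonneg (by positivity)]
      exact hle μ hμ ℓ
  filter_upwards [hlim.eventually_lt_const zero_lt_one, eventually_ge_atTop 1] with μ hμ1 hμ
  have hμ0 : 0 < μ := by linarith
  obtain ⟨K, hK, -, -, hKn⟩ := exists_ofColumns hω (fun ℓ => (freq ω ℓ - μ)⁻¹ • pot hV ℓ)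
    (Summable.of_nonneg_of_le (fun _ => by positivity) (hle μ hμ) hbound)
  have hK1 : ‖K‖ < 1 := hKn.trans_lt (by rw [Real.sqrt_lt' one_pos]; simpa using hμ1)
  obtain ⟨S, hS1, hS2⟩ := exists_rightInverse_one_sub hK1
  obtain ⟨R, hR, -⟩ := exists_diag hω
    (fun ℓ => (freq ω ℓ - μ)⁻¹ • ContinuousLinearMap.id ℂ H) (M := μ⁻¹) (by positivity)
    (fun ℓ => by
      rw [norm_smul]
      calc _ ≤ μ⁻¹ * 1 := by
            gcongr
            · exact norm_freq_sub_inv_le ω ℓ hμ0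
            · exact ContinuousLinearMap.norm_id_le
        _ = μ⁻¹ := mul_one _)
  have hR' : ∀ ℓ f, coeff ω ℓ (R f) = (freq ω ℓ - μ)⁻¹ • coeff ω ℓ f := fun ℓ f => by simp [hR]
  have hKR : ∀ u, K u = ∑' ℓ, pot hV ℓ (coeff ω ℓ (R u)) := fun u => by
    rw [← (hK u).tsum_eq]
    simp [hR']
  -- With u = (d/ds − μ)f, the relation Lf = h reads u − Ku = h − μf, so the inverse of L − μ is
  -- (d/ds − μ)⁻¹(1 − K)⁻¹.
  refine ⟨R.comp S, fun f h => ⟨?_, fun hf => ?_⟩⟩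
  · rintro ⟨g, hd, rfl⟩
    have hf : R (g - (μ : ℂ) • f) = f := ext_coeff hω fun ℓ => by
      rw [hR', map_sub, map_smul, hd ℓ, ← sub_smul, inv_smul_smul₀ (freq_sub_ne_zero ω ℓ hμ0)]
    have h1 : g - ∑' ℓ, pot hV ℓ (coeff ω ℓ f) - (μ : ℂ) • f
        = (g - (μ : ℂ) • f) - K (g - (μ : ℂ) • f) := by rw [hKR, hf]; abel
    rw [h1, ContinuousLinearMap.comp_apply, hS2, hf]
  · set u := S (h - (μ : ℂ) • f) with hu
    have hf' : f = R u := hf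
    refine ⟨u + (μ : ℂ) • f, fun ℓ => ?_, ?_⟩
    · have h1 : coeff ω ℓ u = (freq ω ℓ - μ) • coeff ω ℓ f := by
        rw [hf', hR', smul_inv_smul₀ (freq_sub_ne_zero ω ℓ hμ0)]
      rw [map_add, map_smul, h1, ← add_smul, sub_add_cancel]
    · have h1 := hS1 (h - (μ : ℂ) • f)
      rw [← hu, hKR, ← hf'] at h1
      rw [add_sub_right_comm, h1, sub_add_cancel]

/-- In the form f = R(h − μf) with R bounded, the relation is visibly linear and closed; no series
needs rearranging. The same device serves `IsFourierValueL.zero` and `IsFourierValueL.of_hasSum`. -/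
lemma IsFourierValueL.add (hω : 0 < ω) (hV : IsStrongL2 ω V) {f f' h h' : L2 ω H}
    (h₁ : IsFourierValueL hV f h) (h₂ : IsFourierValueL hV f' h') :
    IsFourierValueL hV (f + f') (h + h') := by
  obtain ⟨μ, R, hR⟩ := (eventually_exists_resolvent hω hV).exists
  rw [hR] at *
  conv_lhs => rw [h₁, h₂]
  rw [← map_add]
  congr 1
  rw [smul_add]
  abel

lemma IsFourierValueL.zero (hω : 0 < ω) (hV : IsStrongL2 ω V) :
    IsFourierValueL hV (0 : L2 ω H) 0 := by
  obtain ⟨μ, R, hR⟩ := (eventually_exists_resolvent hω hV).exists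
  rw [hR]
  simp

lemma IsFourierValueL.sum (hω : 0 < ω) (hV : IsStrongL2 ω V) {ι : Type*} (s : Finset ι)
    {f h : ι → L2 ω H} (hs : ∀ i ∈ s, IsFourierValueL hV (f i) (h i)) :
    IsFourierValueL hV (∑ i ∈ s, f i) (∑ i ∈ s, h i) := by
  classical
  induction s using Finset.induction_on with
  | empty => simpa using IsFourierValueL.zero hω hV
  | insert a s ha ih =>
    rw [Finset.sum_insert ha, Finset.sum_insert ha]
    exact (hs a (Finset.mem_insert_self a s)).add hω hV
      (ih fun i hi => hs i (Finset.mem_insert_of_mem hi))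

/-- `L` is a closed operator. -/
lemma IsFourierValueL.of_hasSum (hω : 0 < ω) (hV : IsStrongL2 ω V) {ι : Type*}
    {f h : ι → L2 ω H} {F G : L2 ω H} (hs : ∀ i, IsFourierValueL hV (f i) (h i))
    (hf : HasSum f F) (hh : HasSum h G) : IsFourierValueL hV F G := by
  obtain ⟨μ, R, hR⟩ := (eventually_exists_resolvent hω hV).exists
  have h1 := (hh.sub (hf.const_smul (μ : ℂ))).mapL R
  have h2 : (fun i => R (h i - (μ : ℂ) • f i)) = f := funext fun i => ((hR _ _).1 (hs i)).symm
  rw [h2] at h1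
  exact (hR _ _).2 (hf.unique h1)

end Resolvent

/-! ### The quadratic equation for one column, by contraction. -/

section Riccati

lemma exists_fixedPoint_of_contracting {E : Type*} [NormedAddCommGroup E] [CompleteSpace E]
    {G : E → E} {r : ℝ} (hG : ∀ z z', ‖z‖ ≤ r → ‖z'‖ ≤ r → ‖G z - G z'‖ ≤ 1 / 2 * ‖z - z'‖)
    (h0 : ‖G 0‖ ≤ r / 2) : ∃ z, G z = z ∧ ‖z‖ ≤ 2 * ‖G 0‖ := by
  have hr : 0 ≤ r := by linarith [norm_nonneg (G 0)]
  have hb : ∀ z, ‖z‖ ≤ r → ‖G z‖ ≤ ‖G 0‖ + 1 / 2 * ‖z‖ := fun z hz => by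
    have h1 := hG z 0 hz (by simpa using hr)
    have h2 := norm_sub_norm_le (G z) (G 0)
    rw [sub_zero] at h1
    linarith
  have hmaps : Set.MapsTo G (Metric.closedBall 0 r) (Metric.closedBall 0 r) := fun z hz => by
    rw [mem_closedBall_zero_iff] at hz ⊢
    linarith [hb z hz]
  have hc : ContractingWith (1 / 2 : NNReal) (hmaps.restrict G _ _) := by
    refine ⟨by rw [one_div]; exact inv_lt_one_of_one_lt₀ one_lt_two, ?_⟩
    refine LipschitzWith.of_dist_le_mul fun z z' => ?_
    have hz := mem_closedBall_zero_iff.1 z.2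
    have hz' := mem_closedBall_zero_iff.1 z'.2
    simpa [Subtype.dist_eq, dist_eq_norm] using hG z z' hz hz'
  obtain ⟨z, hz, hfix, -⟩ := hc.exists_fixedPoint' Metric.isClosed_closedBall.isComplete hmaps
    (x := 0) (by simpa using hr) (edist_ne_top _ _)
  refine ⟨z, hfix, ?_⟩
  have h1 := hb z (mem_closedBall_zero_iff.1 hz)
  rw [hfix] at h1
  linarith

variable {H X : Type*} [NormedAddCommGroup H] [NormedSpace ℂ H]
  [NormedAddCommGroup X] [NormedSpace ℂ X] [CompleteSpace X]

/-- The factorization 1 − K² = (1 − K)(1 + K) gives the inverse (1 + K)(1 − K²)⁻¹, where only K² has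
to be small. -/
lemma exists_rightInverse_of_sq_small {K : X →L[ℂ] X} {M : ℝ} (hK : ‖K‖ ≤ M)
    (hK2 : ‖K.comp K‖ ≤ 1 / 2) :
    ∃ S : X →L[ℂ] X, (∀ x, S x - K (S x) = x) ∧ ‖S‖ ≤ (1 + M) * 2 := by
  obtain ⟨N, hN, -⟩ := exists_rightInverse_one_sub (hK2.trans_lt (by norm_num))
  have hM : 0 ≤ M := (norm_nonneg _).trans hK
  have hN2 : ‖N‖ ≤ 2 := ContinuousLinearMap.opNorm_le_bound _ (by norm_num) fun x => by
    have h1 : N x = x + (K.comp K) (N x) := by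
      conv_rhs => enter [1]; rw [← hN x]
      abel
    have h2 := (norm_add_le x ((K.comp K) (N x)))
    rw [← h1] at h2
    have h3 := (K.comp K).le_of_opNorm_le hK2 (N x)
    linarith
  refine ⟨N + K.comp N, fun x => ?_, ?_⟩
  · have := hN x
    simp only [add_apply, ContinuousLinearMap.comp_apply, map_add] at this ⊢
    conv_rhs => rw [← this]
    abel
  · calc ‖N + K.comp N‖ ≤ ‖N‖ + ‖K‖ * ‖N‖ :=
          (norm_add_le _ _).trans (by gcongr; exact ContinuousLinearMap.opNorm_comp_le _ _)
      _ ≤ 2 + M * 2 := by gcongr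
      _ = (1 + M) * 2 := by ring

/-- A quadratic equation for a column of the transformation operator. -/
lemma exists_riccati_solution {M : ℝ} (hM : 1 ≤ M) :
    ∃ ε > 0, ∃ C : ℝ, ∀ (K Γ : X →L[ℂ] X) (κ : X →L[ℂ] H) (p : H →L[ℂ] X),
      ‖K‖ ≤ M → ‖Γ‖ ≤ M → ‖κ‖ ≤ 1 → ‖K.comp K‖ ≤ 1 / 2 → ‖Γ.comp p‖ ≤ ε → ‖K.comp p‖ ≤ ε →
      ‖κ.comp p‖ ≤ ε →
      ∃ z : H →L[ℂ] X, z = K.comp p + K.comp z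
          - (Γ.comp (p + z)).comp (κ.comp p + κ.comp (K.comp p) + κ.comp (K.comp z)) ∧
        ‖z‖ ≤ C * (‖K.comp p‖ + ‖κ.comp p‖) := by
  set s : ℝ := (1 + M) * 2 with hs
  have hs4 : 4 ≤ s := by rw [hs]; linarith
  have hs0 : 0 < s := by linarith
  have hM0 : 0 < M := by linarith
  -- Here s bounds ‖(1 − K)⁻¹‖. The radius r and then ε are chosen so that the Lipschitz constant
  -- s·M·3ε + s·M·2Mr of G on the r-ball is at most 1/4 + 1/4 and ‖G 0‖ ≤ 3sε ≤ r/2.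
  set r : ℝ := 1 / (8 * s * M ^ 2) with hr
  have hr0 : 0 < r := by positivity
  have hr1 : s * M * (2 * M * r) = 1 / 4 := by rw [hr]; field_simp; norm_num
  set ε : ℝ := min 1 (min (1 / (12 * s * M)) (r / (6 * s))) with hε
  have hε0 : 0 < ε := by positivity
  have hε1 : ε ≤ 1 := min_le_left _ _
  have hε2 : s * M * (3 * ε) ≤ 1 / 4 := by
    have h : ε ≤ 1 / (12 * s * M) := (min_le_right _ _).trans (min_le_left _ _)
    rw [le_div_iff₀ (by positivity)] at h
    linarith
  have hε3 : s * (3 * ε) ≤ r / 2 := by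
    have h : ε ≤ r / (6 * s) := (min_le_right _ _).trans (min_le_right _ _)
    rw [le_div_iff₀ (by positivity)] at h
    linarith
  refine ⟨ε, hε0, 2 * (s * 2), fun K Γ κ p hK hΓ hκ hK2 h1 h2 h3 => ?_⟩
  obtain ⟨S, hS, hSn⟩ := exists_rightInverse_of_sq_small hK hK2
  set β : (H →L[ℂ] X) → (H →L[ℂ] H) := fun z => κ.comp p + κ.comp (K.comp p) + κ.comp (K.comp z)
    with hβ
  set F : (H →L[ℂ] X) → (H →L[ℂ] X) := fun z => (Γ.comp (p + z)).comp (β z) with hF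
  -- The linear term Kz is moved to the left and inverted by S. Only the products Γp, Kp and κp then
  -- enter the estimates, so p itself need not be small.
  set G : (H →L[ℂ] X) → (H →L[ℂ] X) := fun z => S.comp (K.comp p - F z) with hG
  have hκK : ∀ z : H →L[ℂ] X, ‖κ.comp (K.comp z)‖ ≤ M * ‖z‖ := fun z => by
    calc _ ≤ ‖κ‖ * (‖K‖ * ‖z‖) := (ContinuousLinearMap.opNorm_comp_le _ _).trans
          (by gcongr; exact ContinuousLinearMap.opNorm_comp_le _ _)
      _ ≤ 1 * (M * ‖z‖) := by gcongr
      _ = M * ‖z‖ := one_mul _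
  have hκKp : ‖κ.comp (K.comp p)‖ ≤ ‖K.comp p‖ := by
    calc _ ≤ ‖κ‖ * ‖K.comp p‖ := ContinuousLinearMap.opNorm_comp_le _ _
      _ ≤ 1 * ‖K.comp p‖ := by gcongr
      _ = _ := one_mul _
  have hΓz : ∀ z : H →L[ℂ] X, ‖Γ.comp z‖ ≤ M * ‖z‖ := fun z =>
    (ContinuousLinearMap.opNorm_comp_le _ _).trans (by gcongr)
  have hβb : ∀ z : H →L[ℂ] X, ‖z‖ ≤ r → ‖β z‖ ≤ 2 * ε + M * r := fun z hz => by
    calc ‖β z‖ ≤ ‖κ.comp p‖ + ‖κ.comp (K.comp p)‖ + ‖κ.comp (K.comp z)‖ := norm_add₃_le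
      _ ≤ ε + ε + M * r := by
          gcongr
          · exact hκKp.trans h2
          · exact (hκK z).trans (by gcongr)
      _ = _ := by ring
  have hxb : ∀ z : H →L[ℂ] X, ‖z‖ ≤ r → ‖Γ.comp (p + z)‖ ≤ ε + M * r := fun z hz => by
    rw [ContinuousLinearMap.comp_add]
    exact (norm_add_le _ _).trans (add_le_add h1 ((hΓz z).trans (by gcongr)))
  have hSc : ∀ z : H →L[ℂ] X, ‖S.comp z‖ ≤ s * ‖z‖ := fun z =>
    (ContinuousLinearMap.opNorm_comp_le _ _).trans (by gcongr)
  have hGlip : ∀ z z', ‖z‖ ≤ r → ‖z'‖ ≤ r → ‖G z - G z'‖ ≤ 1 / 2 * ‖z - z'‖ := by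
    intro z z' hz hz'
    have hFF : F z - F z' = (Γ.comp (z - z')).comp (β z)
        + (Γ.comp (p + z')).comp (κ.comp (K.comp (z - z'))) := by
      ext h
      simp only [hF, hβ, sub_apply, add_apply,
        ContinuousLinearMap.comp_apply, map_add, map_sub]
      abel
    have hFn : ‖F z - F z'‖ ≤ M * ‖z - z'‖ * (2 * ε + M * r)
        + (ε + M * r) * (M * ‖z - z'‖) := by
      rw [hFF]
      refine (norm_add_le _ _).trans (add_le_add ?_ ?_)
      · refine (ContinuousLinearMap.opNorm_comp_le _ _).trans ?_
        gcongr
        · exact hΓz _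
        · exact hβb z hz
      · refine (ContinuousLinearMap.opNorm_comp_le _ _).trans ?_
        gcongr
        · exact hxb z' hz'
        · exact hκK _
    have hGG : G z - G z' = S.comp (-(F z - F z')) := by
      ext h
      simp only [hG, sub_apply, neg_apply,
        ContinuousLinearMap.comp_apply, map_neg, map_sub]
      abel
    rw [hGG]
    refine (hSc _).trans ?_
    rw [norm_neg]
    calc s * ‖F z - F z'‖ ≤ s * (M * ‖z - z'‖ * (2 * ε + M * r)
          + (ε + M * r) * (M * ‖z - z'‖)) := by gcongr
      _ = (s * M * (3 * ε) + s * M * (2 * M * r)) * ‖z - z'‖ := by ring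
      _ ≤ (1 / 4 + 1 / 4) * ‖z - z'‖ := by rw [hr1]; gcongr
      _ = 1 / 2 * ‖z - z'‖ := by ring
  have hG0' : ‖G 0‖ ≤ s * (‖K.comp p‖ + ε * (‖κ.comp p‖ + ‖K.comp p‖)) := by
    refine (hSc _).trans ?_
    gcongr
    refine (norm_sub_le _ _).trans ?_
    gcongr
    refine (ContinuousLinearMap.opNorm_comp_le _ _).trans ?_
    rw [add_zero]
    gcongr
    have : β 0 = κ.comp p + κ.comp (K.comp p) := by simp [hβ]
    rw [this]
    exact (norm_add_le _ _).trans (by gcongr)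
  have hG0 : ‖G 0‖ ≤ r / 2 := by
    refine hG0'.trans (le_trans ?_ hε3)
    gcongr
    nlinarith
  obtain ⟨z, hz, hzn⟩ := exists_fixedPoint_of_contracting hGlip hG0
  refine ⟨z, ?_, hzn.trans ?_⟩
  · have h4 : z - K.comp z = K.comp p - F z := by
      ext h
      have h5 := hS ((K.comp p - F z) h)
      have h6 : S ((K.comp p - F z) h) = z h := by
        conv_rhs => rw [← hz]
        rfl
      rw [h6] at h5
      exact h5
    rw [sub_eq_iff_eq_add] at h4
    conv_lhs => rw [h4]
    simp only [hF, hβ]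
    abel
  · have h7 : ‖K.comp p‖ + ε * (‖κ.comp p‖ + ‖K.comp p‖)
        ≤ 2 * (‖K.comp p‖ + ‖κ.comp p‖) := by
      nlinarith [norm_nonneg (κ.comp p), norm_nonneg (K.comp p)]
    calc 2 * ‖G 0‖ ≤ 2 * (s * (2 * (‖K.comp p‖ + ‖κ.comp p‖))) := by
          gcongr
          exact hG0'.trans (by gcongr)
      _ = _ := by ring

end Riccati

/-! ### The convolution estimate that makes K² small. -/

section Convolution

/-- The pairs `(n, m)` in the coordinates `(n + m, m - ℓ)`. -/
def shearEquiv (ℓ : ℤ) : ℤ × ℤ ≃ ℤ × ℤ where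
  toFun q := (q.1 + q.2, q.2 - ℓ)
  invFun q := (q.1 - q.2 - ℓ, q.2 + ℓ)
  left_inv q := by ext <;> simp; ring
  right_inv q := by ext <;> simp

lemma abs_rpow_le_one (n : ℤ) : |(n : ℝ)| ^ (-(1 / 2) : ℝ) ≤ 1 := by
  rcases eq_or_ne n 0 with rfl | hn
  · rw [Int.cast_zero, abs_zero, Real.zero_rpow (by norm_num)]; exact zero_le_one
  · refine Real.rpow_le_one_of_one_le_of_nonpos ?_ (by norm_num)
    exact_mod_cast Int.one_le_abs hn

/-- The weight is at most 1 and, for each fixed pair, decays as |ℓ| grows; dominated convergence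
with majorant v²u² applies. -/
lemma tendsto_convolution_weight {u v : ℤ → ℝ} (hu : Summable fun n => u n ^ 2)
    (hv : Summable fun n => v n ^ 2) :
    (∀ ℓ : ℤ, Summable fun q : ℤ × ℤ =>
      |((q.1 - q.2 - 2 * ℓ : ℤ) : ℝ)| ^ (-(1 / 2) : ℝ) * (v q.1 ^ 2 * u q.2 ^ 2)) ∧
    Tendsto (fun ℓ : ℤ => ∑' q : ℤ × ℤ,
      |((q.1 - q.2 - 2 * ℓ : ℤ) : ℝ)| ^ (-(1 / 2) : ℝ) * (v q.1 ^ 2 * u q.2 ^ 2))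
      cofinite (𝓝 0) := by
  have hs : Summable fun q : ℤ × ℤ => v q.1 ^ 2 * u q.2 ^ 2 :=
    hv.mul_of_nonneg hu (fun n => sq_nonneg (v n)) (fun n => sq_nonneg (u n))
  have hle : ∀ (ℓ : ℤ) (q : ℤ × ℤ),
      |((q.1 - q.2 - 2 * ℓ : ℤ) : ℝ)| ^ (-(1 / 2) : ℝ) * (v q.1 ^ 2 * u q.2 ^ 2)
        ≤ v q.1 ^ 2 * u q.2 ^ 2 := fun ℓ q =>
    mul_le_of_le_one_left (by positivity) (abs_rpow_le_one _)
  refine ⟨fun ℓ => Summable.of_nonneg_of_le (fun q => by positivity) (hle ℓ) hs, ?_⟩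
  have h0 : (0 : ℝ) = ∑' _ : ℤ × ℤ, (0 : ℝ) := tsum_zero.symm
  rw [h0]
  refine tendsto_tsum_of_dominated_convergence hs (fun q => ?_)
    (Eventually.of_forall fun ℓ q => ?_)
  · have hinj : Function.Injective fun ℓ : ℤ => q.1 - q.2 - 2 * ℓ := fun a b h => by
      simp only at h; omega
    have h1 : Tendsto (fun n : ℤ => |(n : ℝ)|) cofinite atTop := by
      exact tendsto_norm_cocompact_atTop.comp Int.tendsto_coe_cofinite
    have h2 := ((tendsto_rpow_neg_atTop (y := 1 / 2) (by norm_num)).comp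
      (h1.comp hinj.tendsto_cofinite)).mul_const (v q.1 ^ 2 * u q.2 ^ 2)
    rw [zero_mul] at h2
    exact h2
  · rw [Real.norm_of_nonneg (by positivity)]
    exact hle ℓ q

/-- The estimate behind the smallness of the square of the operator with matrix
`v (n + m) * u (m - ℓ)`. -/
lemma tsum_convolution_le {u v ζ : ℤ → ℝ} {c : ℝ} (hc : 0 ≤ c)
    (hu : ∀ n : ℤ, u n = c * |(n : ℝ)|⁻¹) (hv₀ : ∀ n, 0 ≤ v n) (hζ₀ : ∀ n, 0 ≤ ζ n)
    (hus : Summable fun n => u n ^ 2)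
    (hv : Summable fun n => v n ^ 2) (hζ : Summable fun n => ζ n ^ 2) (ℓ : ℤ) :
    (Summable fun q : ℤ × ℤ => u (q.1 - ℓ) * (u (q.2 - ℓ) * v (q.1 + q.2) * ζ q.2)) ∧
    ∑' q : ℤ × ℤ, u (q.1 - ℓ) * (u (q.2 - ℓ) * v (q.1 + q.2) * ζ q.2)
      ≤ Real.sqrt (∑' q : ℤ × ℤ,
          |((q.1 - q.2 - 2 * ℓ : ℤ) : ℝ)| ^ (-(1 / 2) : ℝ) * (v q.1 ^ 2 * u q.2 ^ 2))
        * (c * Real.sqrt ((∑' n : ℤ, |(n : ℝ)| ^ (-(3 / 2) : ℝ)) * ∑' n, ζ n ^ 2)) := by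
  have hu₀ : ∀ n, 0 ≤ u n := fun n => by rw [hu]; positivity
  have hpow : ∀ (x : ℝ) (y : ℝ), 0 ≤ x → (x ^ y) ^ 2 = x ^ (y * 2) := fun x y hx => by
    rw [Real.rpow_mul hx]; exact_mod_cast rfl
  have hsplit : ∀ n : ℤ, |(n : ℝ)|⁻¹
      = |(n : ℝ)| ^ (-(1 / 4) : ℝ) * |(n : ℝ)| ^ (-(3 / 4) : ℝ) := fun n => by
    rcases eq_or_ne n 0 with rfl | hn
    · rw [Int.cast_zero, abs_zero, Real.zero_rpow (by norm_num)]; simp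
    · have : 0 < |(n : ℝ)| := by positivity
      rw [← Real.rpow_add this, ← Real.rpow_neg_one]; norm_num
  -- Cauchy–Schwarz after splitting |n − ℓ|⁻¹ into exponents −1/4 and −3/4. Squared, the second is
  -- summable with exponent −3/2, while the first leaves a weight that, in the coordinates n + m and
  -- m − ℓ of `shearEquiv`, still tends to 0 with ℓ.
  set F : ℤ × ℤ → ℝ := fun q =>
    |((q.1 - ℓ : ℤ) : ℝ)| ^ (-(1 / 4) : ℝ) * (v (q.1 + q.2) * u (q.2 - ℓ)) with hF
  set G : ℤ × ℤ → ℝ := fun q => c * (|((q.1 - ℓ : ℤ) : ℝ)| ^ (-(3 / 4) : ℝ) * ζ q.2) with hG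
  have hFG : ∀ q : ℤ × ℤ,
      u (q.1 - ℓ) * (u (q.2 - ℓ) * v (q.1 + q.2) * ζ q.2) = F q * G q := fun q => by
    rw [hu (q.1 - ℓ), hsplit]; simp only [hF, hG]; ring
  have hF2 : ∀ q, F q ^ 2 = (fun q : ℤ × ℤ =>
      |((q.1 - q.2 - 2 * ℓ : ℤ) : ℝ)| ^ (-(1 / 2) : ℝ) * (v q.1 ^ 2 * u q.2 ^ 2))
        (shearEquiv ℓ q) := fun q => by
    simp only [hF, shearEquiv, Equiv.coe_fn_mk, mul_pow]
    rw [hpow _ _ (abs_nonneg _)]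
    congr 2
    · congr 2; ring
    · norm_num
  have hG2 : ∀ q, G q ^ 2 = c ^ 2 * (|((q.1 - ℓ : ℤ) : ℝ)| ^ (-(3 / 2) : ℝ) * ζ q.2 ^ 2) :=
    fun q => by
      simp only [hG, mul_pow]
      rw [hpow _ _ (abs_nonneg _)]
      norm_num
  have h32 : Summable fun n : ℤ => |((n - ℓ : ℤ) : ℝ)| ^ (-(3 / 2) : ℝ) :=
    (Real.summable_abs_int_rpow (b := 3 / 2) (by norm_num)).comp_injective
      (i := fun n : ℤ => n - ℓ) (sub_left_injective)
  have h32' : ∑' n : ℤ, |((n - ℓ : ℤ) : ℝ)| ^ (-(3 / 2) : ℝ)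
      = ∑' n : ℤ, |(n : ℝ)| ^ (-(3 / 2) : ℝ) :=
    (Equiv.subRight ℓ).tsum_eq fun n : ℤ => |(n : ℝ)| ^ (-(3 / 2) : ℝ)
  have hGp : Summable fun q : ℤ × ℤ => |((q.1 - ℓ : ℤ) : ℝ)| ^ (-(3 / 2) : ℝ) * ζ q.2 ^ 2 :=
    h32.mul_of_nonneg hζ (fun _ => by positivity) (fun n => sq_nonneg (ζ n))
  have hFs : Summable fun q => F q ^ 2 := by
    simp only [hF2]
    exact ((shearEquiv ℓ).summable_iff).2 ((tendsto_convolution_weight hus hv).1 ℓ)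
  have hGs : Summable fun q => G q ^ 2 := by
    simp only [hG2]
    exact hGp.mul_left _
  have h := summable_mul_and_tsum_mul_le (f := F) (g := G)
    (fun q => mul_nonneg (by positivity) (mul_nonneg (hv₀ _) (hu₀ _)))
    (fun q => mul_nonneg hc (mul_nonneg (by positivity) (hζ₀ _))) hFs hGs
  simp only [hFG]
  refine ⟨h.1, h.2.trans_eq ?_⟩
  congr 1
  · congr 1
    exact (tsum_congr hF2).trans ((shearEquiv ℓ).tsum_eq fun q : ℤ × ℤ =>
      |((q.1 - q.2 - 2 * ℓ : ℤ) : ℝ)| ^ (-(1 / 2) : ℝ) * (v q.1 ^ 2 * u q.2 ^ 2))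
  · simp only [hG2]
    rw [tsum_mul_left, Real.sqrt_mul (sq_nonneg c), Real.sqrt_sq hc, ← h32',
      h32.tsum_mul_tsum hζ hGp]

end Convolution

/-! ### Reduced resolvents of d/ds and their products with the perturbation. -/

lemma norm_freq_inv {ω : ℝ} (hω : 0 < ω) (n : ℤ) :
    ‖(freq ω n)⁻¹‖ = (2 * Real.pi / ω)⁻¹ * |(n : ℝ)|⁻¹ := by
  rw [norm_inv, norm_freq hω, mul_inv]

lemma summable_norm_freq_sub_inv_sq {ω : ℝ} (hω : 0 < ω) (ℓ : ℤ) :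
    Summable fun n : ℤ => ‖(freq ω (n - ℓ))⁻¹‖ ^ 2 :=
  (summable_norm_freq_inv_sq hω).comp_injective (i := fun n : ℤ => n - ℓ) sub_left_injective

lemma tsum_norm_freq_sub_inv_sq (ω : ℝ) (ℓ : ℤ) :
    ∑' n : ℤ, ‖(freq ω (n - ℓ))⁻¹‖ ^ 2 = ∑' n : ℤ, ‖(freq ω n)⁻¹‖ ^ 2 :=
  (Equiv.subRight ℓ).tsum_eq fun n : ℤ => ‖(freq ω n)⁻¹‖ ^ 2

section Operators

variable {H : Type*} [NormedAddCommGroup H] [InnerProductSpace ℂ H] [CompleteSpace H]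
  {ω : ℝ} {V : ℝ → H →L[ℂ] H}

/-- The reduced resolvent `Γ` of `d/ds` at the `ℓ`-th eigenvalue, and the product `K` of the
perturbation and `Γ`. -/
structure IsReducedResolvent (hV : IsStrongL2 ω V) (M : ℝ) (ℓ : ℤ)
    (Γ K : L2 ω H →L[ℂ] L2 ω H) : Prop where
  coeff_left : ∀ n z, coeff ω n (Γ z) = (freq ω (n - ℓ))⁻¹ • coeff ω n z
  hasSum_right : ∀ z, HasSum (fun n => pot hV n (coeff ω n (Γ z))) (K z)
  norm_left : ‖Γ‖ ≤ M
  norm_right : ‖K‖ ≤ M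
  norm_apply_le : ∀ z, (Summable fun n => ‖(freq ω (n - ℓ))⁻¹‖ * ‖coeff ω n z‖) ∧
    ‖K z‖ ≤ M * ∑' n, ‖(freq ω (n - ℓ))⁻¹‖ * ‖coeff ω n z‖

/-- The bound is uniform in ℓ because shifting the index does not change the sum of the squared
inverse frequencies. The convention 0⁻¹ = 0 deletes the ℓ-th coefficient, which is what makes the
resolvent reduced. -/
lemma exists_isReducedResolvent (hω : 0 < ω) (hV : IsStrongL2 ω V) :
    ∃ M, 1 ≤ M ∧ ∀ ℓ, ∃ Γ K, IsReducedResolvent hV M ℓ Γ K := by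
  set m := ‖potentialMap ω V hV‖
  have hm : 0 ≤ m := by positivity
  set σ := Real.sqrt (∑' n : ℤ, ‖(freq ω n)⁻¹‖ ^ 2) with hσ
  have hσ0 : 0 ≤ σ := Real.sqrt_nonneg _
  have hle : ∀ n, ‖(freq ω n)⁻¹‖ ≤ σ := fun n =>
    Real.le_sqrt_of_sq_le ((summable_norm_freq_inv_sq hω).le_tsum n fun _ _ => by positivity)
  -- The summands account for M ≥ 1, ‖Γ‖ ≤ σ, the factor m in the weighted bound for ‖Kz‖, and ‖K‖ ≤
  -- mσ.
  refine ⟨1 + σ + m + m * σ, by nlinarith, fun ℓ => ?_⟩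
  obtain ⟨Γ, hΓ, hΓn⟩ := exists_diag hω
    (fun n => (freq ω (n - ℓ))⁻¹ • ContinuousLinearMap.id ℂ H) (M := σ) hσ0
    (fun n => by
      rw [norm_smul]
      calc _ ≤ σ * 1 := by
            gcongr
            · exact hle _
            · exact ContinuousLinearMap.norm_id_le
        _ = σ := mul_one _)
  have hc : ∀ n, ‖(freq ω (n - ℓ))⁻¹ • pot hV n‖ ≤ m * ‖(freq ω (n - ℓ))⁻¹‖ := fun n => by
    rw [norm_smul, mul_comm]
    gcongr
    exact norm_pot_le hV n
  have hc2 : ∀ n, ‖(freq ω (n - ℓ))⁻¹ • pot hV n‖ ^ 2 ≤ m ^ 2 * ‖(freq ω (n - ℓ))⁻¹‖ ^ 2 :=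
    fun n => by
      rw [← mul_pow]
      gcongr
      exact hc n
  have hs2 := (summable_norm_freq_sub_inv_sq hω ℓ).mul_left (m ^ 2)
  have hcs := Summable.of_nonneg_of_le (fun _ => by positivity) hc2 hs2
  obtain ⟨K, hK, hKs, hKb, hKn⟩ := exists_ofColumns hω _ hcs
  have hΓ' : ∀ n z, coeff ω n (Γ z) = (freq ω (n - ℓ))⁻¹ • coeff ω n z := fun n z => by simp [hΓ]
  refine ⟨Γ, K, hΓ', fun z => ?_, by nlinarith, ?_, fun z => ?_⟩
  · simpa [hΓ'] using hK z
  · have h1 : Real.sqrt (∑' n, ‖(freq ω (n - ℓ))⁻¹ • pot hV n‖ ^ 2) ≤ m * σ := by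
      refine Real.sqrt_le_iff.2 ⟨by positivity, ?_⟩
      rw [mul_pow, hσ, Real.sq_sqrt (tsum_nonneg fun _ => by positivity),
        ← tsum_norm_freq_sub_inv_sq ω ℓ, ← tsum_mul_left]
      exact hcs.tsum_le_tsum hc2 hs2
    nlinarith
  · have hs := (summable_mul_and_tsum_mul_le (fun n => norm_nonneg (freq ω (n - ℓ))⁻¹)
      (fun n => norm_nonneg (coeff ω n z)) (summable_norm_freq_sub_inv_sq hω ℓ)
      (hasSum_norm_coeff_sq hω z).summable).1
    refine ⟨hs, (hKb z).trans ?_⟩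
    calc _ ≤ ∑' n, m * (‖(freq ω (n - ℓ))⁻¹‖ * ‖coeff ω n z‖) := by
          refine (hKs z).tsum_le_tsum (fun n => ?_) (hs.mul_left m)
          rw [← mul_assoc]
          gcongr
          exact hc n
      _ = m * ∑' n, ‖(freq ω (n - ℓ))⁻¹‖ * ‖coeff ω n z‖ := tsum_mul_left
      _ ≤ _ := by
          gcongr
          nlinarith

namespace IsReducedResolvent

variable {hV : IsStrongL2 ω V} {M : ℝ}

lemma hasSum_coeff {ℓ : ℤ} {Γ K : L2 ω H →L[ℂ] L2 ω H} (h : IsReducedResolvent hV M ℓ Γ K)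
    (n : ℤ) (z : L2 ω H) :
    HasSum (fun m => (freq ω (m - ℓ))⁻¹ • potCoeff ω V hV (n + m) (coeff ω m z))
      (coeff ω n (K z)) := by
  have := (h.hasSum_right z).mapL (coeff ω n)
  simpa only [coeff_pot, h.coeff_left, map_smul] using this

/-- The outer K is estimated by the weighted sum of `norm_apply_le`, the inner one entrywise by its
matrix V̂(n + m)/(i2π(m − ℓ)/ω); what results is the double sum of `tsum_convolution_le`. -/
lemma norm_sq_le (hω : 0 < ω) (hV₁ : Summable fun n : ℤ => ‖potCoeff ω V hV n‖ ^ 2) (hM : 0 ≤ M)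
    {ℓ : ℤ} {Γ K : L2 ω H →L[ℂ] L2 ω H} (h : IsReducedResolvent hV M ℓ Γ K) :
    ‖K.comp K‖ ≤ M * (Real.sqrt (∑' q : ℤ × ℤ, |((q.1 - q.2 - 2 * ℓ : ℤ) : ℝ)| ^ (-(1 / 2) : ℝ) *
        (‖potCoeff ω V hV q.1‖ ^ 2 * ‖(freq ω q.2)⁻¹‖ ^ 2)) *
      ((2 * Real.pi / ω)⁻¹ * Real.sqrt (∑' n : ℤ, |(n : ℝ)| ^ (-(3 / 2) : ℝ)))) := by
  have hπ := Real.pi_pos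
  refine ContinuousLinearMap.opNorm_le_bound _ (by positivity) fun z => ?_
  obtain ⟨hs, hle⟩ := tsum_convolution_le (u := fun n => ‖(freq ω n)⁻¹‖)
    (v := fun n => ‖potCoeff ω V hV n‖) (ζ := fun n => ‖coeff ω n z‖)
    (c := (2 * Real.pi / ω)⁻¹) (by positivity) (norm_freq_inv hω) (fun _ => norm_nonneg _)
    (fun _ => norm_nonneg _) (summable_norm_freq_inv_sq hω) hV₁
    (hasSum_norm_coeff_sq hω z).summable ℓ
  rw [(hasSum_norm_coeff_sq hω z).tsum_eq, Real.sqrt_mul (tsum_nonneg fun _ => by positivity),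
    Real.sqrt_sq (norm_nonneg _)] at hle
  obtain ⟨hs', hle'⟩ := h.norm_apply_le (K z)
  rw [ContinuousLinearMap.comp_apply]
  refine hle'.trans ?_
  rw [mul_assoc]
  gcongr
  refine le_trans ?_ (hle.trans_eq (by ring))
  rw [hs.tsum_prod]
  refine hs'.tsum_le_tsum (fun n => ?_) hs.prod
  have h1 := (h.hasSum_coeff n z).const_smul (freq ω (n - ℓ))⁻¹
  rw [← norm_smul, ← h1.tsum_eq]
  refine tsum_of_norm_bounded (hs.prod_factor n).hasSum fun m => ?_
  rw [norm_smul, norm_smul]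
  dsimp only
  rw [mul_assoc _ ‖potCoeff ω V hV (n + m)‖]
  gcongr
  exact (potCoeff ω V hV (n + m)).le_opNorm _

lemma tendsto_norm_sq (hω : 0 < ω) (hV₁ : Summable fun n : ℤ => ‖potCoeff ω V hV n‖ ^ 2)
    (hM : 0 ≤ M) {Γ K : ℤ → L2 ω H →L[ℂ] L2 ω H} (h : ∀ ℓ, IsReducedResolvent hV M ℓ (Γ ℓ) (K ℓ)) :
    Tendsto (fun ℓ => ‖(K ℓ).comp (K ℓ)‖) cofinite (𝓝 0) := by
  have h1 := (tendsto_convolution_weight (summable_norm_freq_inv_sq hω) hV₁).2.sqrt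
  have h2 := (h1.mul_const
    ((2 * Real.pi / ω)⁻¹ * Real.sqrt (∑' n : ℤ, |(n : ℝ)| ^ (-(3 / 2) : ℝ)))).const_mul M
  rw [Real.sqrt_zero, zero_mul, mul_zero] at h2
  exact squeeze_zero (fun ℓ => norm_nonneg _) (fun ℓ => (h ℓ).norm_sq_le hω hV₁ hM) h2

end IsReducedResolvent

end Operators

/-! ### Invariant columns of L. -/

lemma exists_forall_of_eventually_cofinite {P : ℤ → Prop} (h : ∀ᶠ ℓ in cofinite, P ℓ) :
    ∃ k : ℕ, ∀ ℓ : ℤ, (k : ℤ) < |ℓ| → P ℓ := by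
  obtain ⟨k, hk⟩ := ((eventually_cofinite.1 h).image Int.natAbs).bddAbove
  refine ⟨k, fun ℓ hℓ => ?_⟩
  by_contra hP
  have : ℓ.natAbs ≤ k := hk ⟨ℓ, hP, rfl⟩
  rw [Int.abs_eq_natAbs] at hℓ
  omega

lemma eventually_le_of_summable_sq {ι : Type*} {a : ι → ℝ} (ha : ∀ i, 0 ≤ a i)
    (h : Summable fun i => a i ^ 2) {ε : ℝ} (hε : 0 < ε) : ∀ᶠ i in cofinite, a i ≤ ε := by
  filter_upwards [h.tendsto_cofinite_zero.eventually_le_const (pow_pos hε 2)] with i hi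
  exact (sq_le_sq₀ (ha i) hε.le).1 hi

lemma summable_sq_add {ι : Type*} {a b : ι → ℝ}
    (ha : Summable fun i => a i ^ 2) (hb : Summable fun i => b i ^ 2) :
    Summable fun i => (a i + b i) ^ 2 := by
  refine Summable.of_nonneg_of_le (fun _ => by positivity) (fun i => ?_)
    ((ha.mul_left 2).add (hb.mul_left 2))
  nlinarith [sq_nonneg (a i - b i)]

lemma summable_sq_of_le {ι : Type*} {a b : ι → ℝ} (ha : ∀ i, 0 ≤ a i) (hab : ∀ i, a i ≤ b i)
    (hb : Summable fun i => b i ^ 2) : Summable fun i => a i ^ 2 :=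
  Summable.of_nonneg_of_le (fun _ => by positivity)
    (fun i => pow_le_pow_left₀ (ha i) (hab i) 2) hb

section Columns

variable {H : Type*} [NormedAddCommGroup H] [InnerProductSpace ℂ H] [CompleteSpace H]
  {ω : ℝ} {V : ℝ → H →L[ℂ] H}

lemma opNorm_sq_le_tsum {E : Type*} [NormedAddCommGroup E] [NormedSpace ℂ E] (hω : 0 < ω)
    (c : E →L[ℂ] L2 ω H) (hc : Summable fun j => ‖(coeff ω j).comp c‖ ^ 2) :
    ‖c‖ ^ 2 ≤ ∑' j, ‖(coeff ω j).comp c‖ ^ 2 := by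
  have h0 : 0 ≤ ∑' j, ‖(coeff ω j).comp c‖ ^ 2 := tsum_nonneg fun _ => by positivity
  refine (Real.le_sqrt (by positivity) h0).1
    (ContinuousLinearMap.opNorm_le_bound _ (Real.sqrt_nonneg _) fun x => ?_)
  refine (sq_le_sq₀ (norm_nonneg _) (by positivity)).1 ?_
  rw [mul_pow, Real.sq_sqrt h0, ← (hasSum_norm_coeff_sq hω (c x)).tsum_eq, ← tsum_mul_right]
  refine (hasSum_norm_coeff_sq hω (c x)).summable.tsum_le_tsum (fun j => ?_) (hc.mul_right _)
  rw [← mul_pow]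
  gcongr
  exact ((coeff ω j).comp c).le_opNorm x

lemma coeff_comp_pot (hV : IsStrongL2 ω V) (j ℓ : ℤ) :
    (coeff ω j).comp (pot hV ℓ) = potCoeff ω V hV (j + ℓ) :=
  ContinuousLinearMap.ext fun x => coeff_pot hV j ℓ x

lemma summable_coeff_comp_pot {hV : IsStrongL2 ω V}
    (hV₁ : Summable fun n : ℤ => ‖potCoeff ω V hV n‖ ^ 2) :
    Summable fun ℓ => ‖(coeff ω ℓ).comp (pot hV ℓ)‖ ^ 2 := by
  simp only [coeff_comp_pot]
  exact hV₁.comp_injective (i := fun ℓ : ℤ => ℓ + ℓ) fun a b h => by simp only at h; omega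

lemma IsReducedResolvent.coeff_comp {hV : IsStrongL2 ω V} {M : ℝ} {ℓ : ℤ}
    {Γ K : L2 ω H →L[ℂ] L2 ω H} (h : IsReducedResolvent hV M ℓ Γ K) (j : ℤ) (c : H →L[ℂ] L2 ω H) :
    (coeff ω j).comp (Γ.comp c) = (freq ω (j - ℓ))⁻¹ • (coeff ω j).comp c :=
  ContinuousLinearMap.ext fun x => h.coeff_left j (c x)

/-- The (j, ℓ) entry is V̂(j + ℓ) divided by the frequency of j − ℓ, and (j, ℓ) ↦ (j − ℓ, j + ℓ) is
injective, so the double series is a subseries of a product of two convergent ones. -/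
lemma summable_first_column (hω : 0 < ω) {hV : IsStrongL2 ω V}
    (hV₁ : Summable fun n : ℤ => ‖potCoeff ω V hV n‖ ^ 2) {M : ℝ}
    {Γ K : ℤ → L2 ω H →L[ℂ] L2 ω H} (h : ∀ ℓ, IsReducedResolvent hV M ℓ (Γ ℓ) (K ℓ)) :
    Summable fun q : ℤ × ℤ => ‖(coeff ω q.1).comp ((Γ q.2).comp (pot hV q.2))‖ ^ 2 := by
  have h1 := (summable_norm_freq_inv_sq hω).mul_of_nonneg hV₁ (fun _ => by positivity)
    (fun _ => by positivity)
  have hinj : Function.Injective fun q : ℤ × ℤ => (q.1 - q.2, q.1 + q.2) := fun a b hab => by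
    simp only [Prod.mk.injEq] at hab
    ext <;> omega
  refine (h1.comp_injective hinj).congr fun q => ?_
  rw [(h q.2).coeff_comp, coeff_comp_pot, norm_smul, mul_pow]
  rfl

lemma norm_int_inv_le_one (a b : ℤ) : ‖((a : ℂ) - b)⁻¹‖ ≤ 1 := by
  rw [← Int.cast_sub, norm_inv, Complex.norm_intCast]
  rcases eq_or_ne (a - b) 0 with h | h
  · simp [h]
  · exact inv_le_one_of_one_le₀ (by exact_mod_cast Int.one_le_abs h)

/-- Identifies the entries of Kp with the sums in the second assumption on V, up to a constant
factor. -/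
lemma IsReducedResolvent.coeff_comp_pot {hV : IsStrongL2 ω V}
    (hV₁ : Summable fun n : ℤ => ‖potCoeff ω V hV n‖ ^ 2) {M : ℝ} {ℓ : ℤ}
    {Γ K : L2 ω H →L[ℂ] L2 ω H} (h : IsReducedResolvent hV M ℓ Γ K) (j : ℤ) :
    (coeff ω j).comp (K.comp (pot hV ℓ)) = (-(2 * Real.pi * Complex.I / ω : ℂ)⁻¹) •
      ∑' n : {n : ℤ // n ≠ ℓ}, ((ℓ : ℂ) - (n : ℤ))⁻¹ •
        (potCoeff ω V hV (j + n)).comp (potCoeff ω V hV (ℓ + n)) := by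
  set t : ℤ → H →L[ℂ] H := fun n => ((ℓ : ℂ) - (n : ℤ))⁻¹ •
        (potCoeff ω V hV (j + n)).comp (potCoeff ω V hV (ℓ + n)) with ht
  have hts : Summable t := by
    refine Summable.of_norm_bounded (summable_mul_and_tsum_mul_le
      (f := fun n => ‖potCoeff ω V hV (j + n)‖) (g := fun n => ‖potCoeff ω V hV (ℓ + n)‖)
      (fun _ => norm_nonneg _) (fun _ => norm_nonneg _)
      (hV₁.comp_injective (add_right_injective j))
      (hV₁.comp_injective (add_right_injective ℓ))).1 fun n => ?_
    rw [norm_smul]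
    refine (mul_le_of_le_one_left (norm_nonneg _) (norm_int_inv_le_one _ _)).trans ?_
    exact ContinuousLinearMap.opNorm_comp_le _ _
  -- The term n = ℓ vanishes since 0⁻¹ = 0, so the restriction n ≠ ℓ costs nothing.
  have hsub : ∑' n : {n : ℤ // n ≠ ℓ}, t n = ∑' n, t n :=
    tsum_subtype_eq_of_support_subset (s := {n : ℤ | n ≠ ℓ}) fun n hn hnℓ => by
      apply hn
      simp only [ht, hnℓ, sub_self, inv_zero, zero_smul]
  change _ = (-(2 * Real.pi * Complex.I / ω : ℂ)⁻¹) • ∑' n : {n : ℤ // n ≠ ℓ}, t n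
  rw [hsub]
  refine ContinuousLinearMap.ext fun x => ?_
  have h1 := h.hasSum_coeff j (pot hV ℓ x)
  have h2 := (hts.hasSum.mapL (ContinuousLinearMap.apply ℂ H x)).const_smul
    (-(2 * Real.pi * Complex.I / ω : ℂ)⁻¹)
  refine h1.unique ?_
  convert h2 using 2 with n
  · simp only [ht, ContinuousLinearMap.apply_apply, smul_apply,
      ContinuousLinearMap.comp_apply, coeff_pot, smul_smul]
    rw [add_comm n ℓ]
    congr 1
    rw [← neg_sub (n : ℂ) ℓ, inv_neg, neg_mul_neg, ← mul_inv]
    congr 1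
    simp only [freq]
    push_cast
    ring
  · rfl

lemma summable_second_column (hω : 0 < ω) {hV : IsStrongL2 ω V}
    (hV₁ : Summable fun n : ℤ => ‖potCoeff ω V hV n‖ ^ 2)
    (hV₂ : Summable fun p : ℤ × ℤ =>
      ‖∑' n : {n : ℤ // n ≠ p.2}, ((p.2 : ℂ) - (n : ℤ))⁻¹ •
        (potCoeff ω V hV (p.1 + n)).comp (potCoeff ω V hV (p.2 + n))‖ ^ 2) {M : ℝ}
    {Γ K : ℤ → L2 ω H →L[ℂ] L2 ω H} (h : ∀ ℓ, IsReducedResolvent hV M ℓ (Γ ℓ) (K ℓ)) :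
    Summable fun ℓ => ‖(K ℓ).comp (pot hV ℓ)‖ ^ 2 := by
  have h1 : Summable fun q : ℤ × ℤ => ‖(coeff ω q.2).comp ((K q.1).comp (pot hV q.1))‖ ^ 2 := by
    refine ((hV₂.mul_left (‖-(2 * Real.pi * Complex.I / ω : ℂ)⁻¹‖ ^ 2)).prod_symm).congr
      fun q => ?_
    rw [(h q.1).coeff_comp_pot hV₁, norm_smul, mul_pow]
    rfl
  exact Summable.of_nonneg_of_le (fun _ => by positivity)
    (fun ℓ => opNorm_sq_le_tsum hω _ (h1.prod_factor ℓ)) h1.prod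

/-- A solution of the quadratic equation gives an invariant column of `L`. -/
lemma IsReducedResolvent.isFourierValueL (hω : 0 < ω) {hV : IsStrongL2 ω V} {M : ℝ} {ℓ : ℤ}
    {Γ K : L2 ω H →L[ℂ] L2 ω H} (h : IsReducedResolvent hV M ℓ Γ K) {y x : H →L[ℂ] L2 ω H}
    {β : H →L[ℂ] H} (hx : x = Γ.comp y) (hβ : β = (coeff ω ℓ).comp (pot hV ℓ + K.comp y))
    (hy : y = pot hV ℓ + K.comp y - x.comp β) (v : H) :
    IsFourierValueL hV (harmonic ω ℓ v + x v)
      (harmonic ω ℓ (freq ω ℓ • v - β v) + x (freq ω ℓ • v - β v)) := by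
  have hxc : ∀ n w, coeff ω n (x w) = (freq ω (n - ℓ))⁻¹ • coeff ω n (y w) := fun n w => by
    rw [hx]; exact h.coeff_left n (y w)
  have hyv : pot hV ℓ v + K (y v) = y v + x (β v) := by
    have h1 : y v = pot hV ℓ v + K (y v) - x (β v) :=
      congrArg (fun T : H →L[ℂ] L2 ω H => T v) hy
    exact (eq_sub_iff_add_eq.1 h1).symm
  have hβv : β v = coeff ω ℓ (y v + x (β v)) := by
    rw [← hyv, hβ]; rfl
  -- The perturbation sends e_ℓ v + xv to `pot hV ℓ v + K (y v)`, so the derivative has to be the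
  -- claimed value of L plus this.
  refine ⟨harmonic ω ℓ (freq ω ℓ • v - β v) + x (freq ω ℓ • v - β v) + (pot hV ℓ v + K (y v)),
    fun n => ?_, ?_⟩
  · rw [hyv]
    simp only [map_add, map_sub, map_smul, coeff_harmonic hω, hxc]
    -- In row ℓ the column x vanishes, so βv is the ℓ-th coefficient of yv and cancels the term −βv.
    -- In the other rows, multiplying by the frequency of n − ℓ undoes Γ.
    by_cases hn : n = ℓ
    · subst hn
      rw [map_add, hxc] at hβv
      simp only [sub_self, freq_zero, inv_zero, zero_smul, add_zero, if_true, smul_zero] at hβv ⊢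
      rw [← hβv]
      abel
    · have hne : freq ω (n - ℓ) ≠ 0 := freq_ne_zero hω (sub_ne_zero.2 hn)
      have h3 : coeff ω n (y v) = freq ω (n - ℓ) • (freq ω (n - ℓ))⁻¹ • coeff ω n (y v) :=
        (smul_inv_smul₀ hne _).symm
      simp only [if_neg hn, zero_add, smul_zero, sub_zero]
      conv_lhs => enter [2, 1]; rw [h3, ← freq_sub, sub_smul]
      rw [freq_sub]
      abel
  · have h1 : HasSum (fun n => pot hV n (coeff ω n (harmonic ω ℓ v))) (pot hV ℓ v) := by
      convert hasSum_ite_eq ℓ (pot hV ℓ v) using 2 with n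
      rw [coeff_harmonic hω]
      split_ifs with hn
      · rw [hn]
      · simp
    have h2 := h1.add (h.hasSum_right (y v))
    have h3 : x v = Γ (y v) := by rw [hx]; rfl
    simp only [← map_add, ← h3] at h2
    rw [h2.tsum_eq, add_sub_cancel_right]

/-- Square summability makes Γp, Kp and the ℓ-th coefficient of p small for all but finitely many ℓ,
so the quadratic equation is solvable there; its bound on z transfers square summability to the
columns and blocks. -/
lemma exists_invariant_columns (hω : 0 < ω) {hV : IsStrongL2 ω V}
    (hV₁ : Summable fun n : ℤ => ‖potCoeff ω V hV n‖ ^ 2)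
    (hV₂ : Summable fun p : ℤ × ℤ =>
      ‖∑' n : {n : ℤ // n ≠ p.2}, ((p.2 : ℂ) - (n : ℤ))⁻¹ •
        (potCoeff ω V hV (p.1 + n)).comp (potCoeff ω V hV (p.2 + n))‖ ^ 2) :
    ∃ (k : ℕ) (x : ℤ → H →L[ℂ] L2 ω H) (b : ℤ → H →L[ℂ] H),
      (Summable fun q : ℤ × ℤ => ‖(coeff ω q.1).comp (x q.2)‖ ^ 2) ∧
      (Summable fun ℓ => ‖b ℓ‖ ^ 2) ∧
      ∀ ℓ : ℤ, (k : ℤ) < |ℓ| → ∀ v, IsFourierValueL hV (harmonic ω ℓ v + x ℓ v)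
        (harmonic ω ℓ (freq ω ℓ • v + b ℓ v) + x ℓ (freq ω ℓ • v + b ℓ v)) := by
  obtain ⟨M, hM, hΓK⟩ := exists_isReducedResolvent hω hV
  choose Γ K h using hΓK
  have hM0 : 0 ≤ M := by linarith
  obtain ⟨ε, hε, C, hric⟩ := exists_riccati_solution (H := H) (X := L2 ω H) hM
  have hs1 := summable_first_column hω hV₁ h
  have hs2 := summable_second_column hω hV₁ hV₂ h
  have hs0 := summable_coeff_comp_pot hV₁
  have hs1' : Summable fun ℓ => ‖(Γ ℓ).comp (pot hV ℓ)‖ ^ 2 :=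
    Summable.of_nonneg_of_le (fun _ => by positivity)
      (fun ℓ => opNorm_sq_le_tsum hω _ (hs1.prod_symm.prod_factor ℓ)) hs1.prod_symm.prod
  have hev : ∀ᶠ ℓ in cofinite, ∃ z : H →L[ℂ] L2 ω H,
      z = (K ℓ).comp (pot hV ℓ) + (K ℓ).comp z - ((Γ ℓ).comp (pot hV ℓ + z)).comp
        ((coeff ω ℓ).comp (pot hV ℓ) + (coeff ω ℓ).comp ((K ℓ).comp (pot hV ℓ))
          + (coeff ω ℓ).comp ((K ℓ).comp z)) ∧
      ‖z‖ ≤ C * (‖(K ℓ).comp (pot hV ℓ)‖ + ‖(coeff ω ℓ).comp (pot hV ℓ)‖) := by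
    have E0 := eventually_le_of_summable_sq (fun _ => by positivity) hs0 hε
    have E1 := eventually_le_of_summable_sq (fun _ => by positivity) hs1' hε
    have E2 := eventually_le_of_summable_sq (fun _ => by positivity) hs2 hε
    have E3 := (IsReducedResolvent.tendsto_norm_sq hω hV₁ hM0 h).eventually_le_const
      (show (0 : ℝ) < 1 / 2 by norm_num)
    filter_upwards [E0, E1, E2, E3] with ℓ e0 e1 e2 e3
    exact hric (K ℓ) (Γ ℓ) (coeff ω ℓ) (pot hV ℓ) (h ℓ).norm_right (h ℓ).norm_left
      (opNorm_coeff_le hω ℓ) e3 e1 e2 e0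
  obtain ⟨k, hk⟩ := exists_forall_of_eventually_cofinite hev
  -- Setting z = 0 for the excluded ℓ gives a bound valid for all ℓ; |C| replaces C, whose sign is
  -- unknown.
  have hz' : ∀ ℓ : ℤ, ∃ z : H →L[ℂ] L2 ω H, ((k : ℤ) < |ℓ| →
      z = (K ℓ).comp (pot hV ℓ) + (K ℓ).comp z - ((Γ ℓ).comp (pot hV ℓ + z)).comp
        ((coeff ω ℓ).comp (pot hV ℓ) + (coeff ω ℓ).comp ((K ℓ).comp (pot hV ℓ))
          + (coeff ω ℓ).comp ((K ℓ).comp z))) ∧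
      ‖z‖ ≤ |C| * (‖(K ℓ).comp (pot hV ℓ)‖ + ‖(coeff ω ℓ).comp (pot hV ℓ)‖) := fun ℓ => by
    by_cases hℓ : (k : ℤ) < |ℓ|
    · obtain ⟨z, h1, h2⟩ := hk ℓ hℓ
      exact ⟨z, fun _ => h1, h2.trans (mul_le_mul_of_nonneg_right (le_abs_self C) (by positivity))⟩
    · exact ⟨0, fun h' => absurd h' hℓ, ContinuousLinearMap.opNorm_zero.trans_le (by positivity)⟩
  choose z hz hzn using hz'
  have hzs : Summable fun ℓ => ‖z ℓ‖ ^ 2 := by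
    refine summable_sq_of_le (fun _ => by positivity) hzn ?_
    simp only [mul_pow]
    exact (summable_sq_add hs2 hs0).mul_left _
  refine ⟨k, fun ℓ => (Γ ℓ).comp (pot hV ℓ + z ℓ),
    fun ℓ => -(coeff ω ℓ).comp (pot hV ℓ + (K ℓ).comp (pot hV ℓ + z ℓ)), ?_, ?_,
    fun ℓ hℓ v => ?_⟩
  · have h2 : Summable fun q : ℤ × ℤ => (‖(freq ω (q.1 - q.2))⁻¹‖ * ‖z q.2‖) ^ 2 := by
      have h3 := (summable_norm_freq_inv_sq hω).mul_of_nonneg hzs (fun _ => by positivity)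
        (fun _ => by positivity)
      have hinj : Function.Injective fun q : ℤ × ℤ => (q.1 - q.2, q.2) := fun a b hab => by
        simp only [Prod.mk.injEq] at hab
        ext <;> omega
      refine (h3.comp_injective hinj).congr fun q => ?_
      rw [mul_pow]
      rfl
    refine summable_sq_of_le (fun _ => by positivity) (fun q => ?_) (summable_sq_add hs1 h2)
    dsimp only
    rw [ContinuousLinearMap.comp_add, ContinuousLinearMap.comp_add]
    refine (norm_add_le _ _).trans ?_
    gcongr
    rw [(h q.2).coeff_comp, norm_smul]
    gcongr
    refine (ContinuousLinearMap.opNorm_comp_le _ _).trans ?_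
    exact mul_le_of_le_one_left (norm_nonneg _) (opNorm_coeff_le hω _)
  · have h4 : Summable fun ℓ => (M * ‖z ℓ‖) ^ 2 := by
      simp only [mul_pow]
      exact hzs.mul_left _
    refine summable_sq_of_le (fun _ => by positivity) (fun ℓ => ?_)
      (summable_sq_add hs0 (summable_sq_add hs2 h4))
    rw [norm_neg, ContinuousLinearMap.comp_add]
    refine (norm_add_le _ _).trans ?_
    gcongr
    refine (ContinuousLinearMap.opNorm_comp_le _ _).trans ?_
    refine (mul_le_of_le_one_left (norm_nonneg _) (opNorm_coeff_le hω _)).trans ?_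
    rw [ContinuousLinearMap.comp_add]
    refine (norm_add_le _ _).trans ?_
    gcongr
    refine (ContinuousLinearMap.opNorm_comp_le _ _).trans ?_
    gcongr
    exact (h ℓ).norm_right
  · have h5 := (h ℓ).isFourierValueL hω (y := pot hV ℓ + z ℓ)
      (x := (Γ ℓ).comp (pot hV ℓ + z ℓ)) rfl rfl ?_ v
    · simpa only [sub_eq_add_neg, neg_apply] using h5
    · conv_lhs => rw [hz ℓ hℓ]
      rw [ContinuousLinearMap.comp_add (K ℓ), ContinuousLinearMap.comp_add (coeff ω ℓ),
        ContinuousLinearMap.comp_add (coeff ω ℓ)]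
      simp only [add_assoc, add_sub_assoc]

end Columns

/-! ### The transform 1 + W₀ diagonalizing the high harmonics. -/

section PartialTransform

lemma exists_tail_le {a : ℤ → ℝ} (ha₀ : ∀ n, 0 ≤ a n) (ha : Summable a) {ε : ℝ} (hε : 0 < ε)
    (k₀ : ℕ) : ∃ k, k₀ ≤ k ∧ ∑' n : ℤ, (if (k : ℤ) < |n| then a n else 0) ≤ ε := by
  have h : Tendsto (fun k : ℕ => ∑' n : ℤ, (if (k : ℤ) < |n| then a n else 0)) atTop
      (𝓝 (∑' _ : ℤ, (0 : ℝ))) := by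
    refine tendsto_tsum_of_dominated_convergence ha (fun n => ?_)
      (Eventually.of_forall fun k n => ?_)
    · refine tendsto_const_nhds.congr' ?_
      filter_upwards [eventually_ge_atTop n.natAbs] with k hk
      rw [if_neg]
      rw [Int.abs_eq_natAbs]
      omega
    · split_ifs
      · exact (Real.norm_of_nonneg (ha₀ n)).le
      · rw [norm_zero]; exact ha₀ n
  rw [tsum_zero] at h
  obtain ⟨k, h1, h2⟩ := ((h.eventually_le_const hε).and (eventually_ge_atTop k₀)).exists
  exact ⟨k, h2, h1⟩

variable {H : Type*} [NormedAddCommGroup H] [InnerProductSpace ℂ H] [CompleteSpace H]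
  {ω : ℝ} {V : ℝ → H →L[ℂ] H}

lemma coeff_projBlock (hω : 0 < ω) (k : ℕ) (j : ℤ) (f : L2 ω H) :
    coeff ω j (projBlock ω k f) = if (k : ℤ) < |j| then 0 else coeff ω j f := by
  simp only [projBlock, sum_apply, map_sum, proj_apply, coeff_harmonic hω]
  rw [Finset.sum_ite_eq]
  simp only [Finset.mem_Icc, ← abs_le]
  by_cases h : (k : ℤ) < |j|
  · rw [if_neg (not_le.2 h), if_pos h]
  · rw [if_pos (not_lt.1 h), if_neg h]

lemma norm_proj_comp_comp_proj_le (hω : 0 < ω) (j ℓ : ℤ) (X : L2 ω H →L[ℂ] L2 ω H) :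
    ‖(proj ω j).comp (X.comp (proj ω ℓ))‖ ≤ ‖(coeff ω j).comp (X.comp (harmonic ω ℓ))‖ := by
  refine ContinuousLinearMap.opNorm_le_bound _ (by positivity) fun f => ?_
  change ‖harmonic ω j (coeff ω j (X (harmonic ω ℓ (coeff ω ℓ f))))‖ ≤ _
  rw [norm_harmonic hω]
  refine (((coeff ω j).comp (X.comp (harmonic ω ℓ))).le_opNorm (coeff ω ℓ f)).trans ?_
  gcongr
  exact norm_coeff_le hω ℓ f

/-- The rows of a Hilbert–Schmidt operator are square summable. -/
lemma summable_rows (hω : 0 < ω) {X : L2 ω H →L[ℂ] L2 ω H}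
    (hX : Summable fun q : ℤ × ℤ => ‖(coeff ω q.1).comp (X.comp (harmonic ω q.2))‖ ^ 2) :
    Summable fun j => ‖(coeff ω j).comp X‖ ^ 2 := by
  refine Summable.of_nonneg_of_le (fun _ => by positivity) (fun j => ?_) hX.prod
  have hj := hX.prod_factor j
  have h0 : 0 ≤ ∑' ℓ, ‖(coeff ω j).comp (X.comp (harmonic ω ℓ))‖ ^ 2 :=
    tsum_nonneg fun _ => by positivity
  refine (Real.le_sqrt (by positivity) h0).1
    (ContinuousLinearMap.opNorm_le_bound _ (Real.sqrt_nonneg _) fun f => ?_)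
  obtain ⟨h1, h2⟩ := summable_mul_and_tsum_mul_le
    (f := fun ℓ => ‖(coeff ω j).comp (X.comp (harmonic ω ℓ))‖) (g := fun ℓ => ‖coeff ω ℓ f‖)
    (fun _ => by positivity) (fun _ => norm_nonneg _) hj (hasSum_norm_coeff_sq hω f).summable
  rw [(hasSum_norm_coeff_sq hω f).tsum_eq, Real.sqrt_sq (norm_nonneg f)] at h2
  refine le_trans ?_ h2
  have h3 := (hasSum_proj hω f).mapL ((coeff ω j).comp X)
  rw [← h3.tsum_eq]
  exact tsum_of_norm_bounded h1.hasSum fun ℓ =>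
    ((coeff ω j).comp (X.comp (harmonic ω ℓ))).le_opNorm (coeff ω ℓ f)

/-- `1 + W` maps the `ℓ`-th harmonics to an invariant subspace of `L` for every `|ℓ| > k`. -/
structure IsPartialTransform (hV : IsStrongL2 ω V) (k : ℕ) (W : L2 ω H →L[ℂ] L2 ω H)
    (b : ℤ → H →L[ℂ] H) : Prop where
  norm_le : ‖W‖ ≤ 1 / 2
  hilbertSchmidt : Summable fun q : ℤ × ℤ => ‖(coeff ω q.1).comp (W.comp (harmonic ω q.2))‖ ^ 2
  apply_harmonic : ∀ ℓ : ℤ, ¬ (k : ℤ) < |ℓ| → ∀ v, W (harmonic ω ℓ v) = 0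
  summable : Summable fun ℓ => ‖b ℓ‖ ^ 2
  isFourierValueL : ∀ ℓ : ℤ, (k : ℤ) < |ℓ| → ∀ v,
    IsFourierValueL hV (harmonic ω ℓ v + W (harmonic ω ℓ v))
      (harmonic ω ℓ (freq ω ℓ • v + b ℓ v) + W (harmonic ω ℓ (freq ω ℓ • v + b ℓ v)))

lemma exists_isPartialTransform (hω : 0 < ω) {hV : IsStrongL2 ω V}
    (hV₁ : Summable fun n : ℤ => ‖potCoeff ω V hV n‖ ^ 2)
    (hV₂ : Summable fun p : ℤ × ℤ =>
      ‖∑' n : {n : ℤ // n ≠ p.2}, ((p.2 : ℂ) - (n : ℤ))⁻¹ •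
        (potCoeff ω V hV (p.1 + n)).comp (potCoeff ω V hV (p.2 + n))‖ ^ 2) :
    ∃ k W b, IsPartialTransform hV k W b := by
  obtain ⟨k₀, x, b, hx, hb, hL⟩ := exists_invariant_columns hω hV₁ hV₂
  have hxs : Summable fun ℓ => ‖x ℓ‖ ^ 2 :=
    Summable.of_nonneg_of_le (fun _ => by positivity)
      (fun ℓ => opNorm_sq_le_tsum hω _ (hx.prod_symm.prod_factor ℓ)) hx.prod_symm.prod
  -- Discarding further columns until the tail is at most 1/4 gives ‖W‖ ≤ 1/2, hence 1 + W
  -- invertible.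
  obtain ⟨k, hk, htail⟩ := exists_tail_le (fun _ => by positivity) hxs
    (show (0 : ℝ) < 1 / 4 by norm_num) k₀
  set x' : ℤ → H →L[ℂ] L2 ω H := fun ℓ => if (k : ℤ) < |ℓ| then x ℓ else 0 with hx'
  have hx'n : ∀ ℓ, ‖x' ℓ‖ ^ 2 = if (k : ℤ) < |ℓ| then ‖x ℓ‖ ^ 2 else 0 := fun ℓ => by
    by_cases h : (k : ℤ) < |ℓ|
    · simp only [hx', if_pos h]
    · simp only [hx', if_neg h]
      rw [ContinuousLinearMap.opNorm_zero]
      norm_num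
  have hx's : Summable fun ℓ => ‖x' ℓ‖ ^ 2 := by
    refine Summable.of_nonneg_of_le (fun _ => by positivity) (fun ℓ => ?_) hxs
    rw [hx'n]
    split_ifs
    · exact le_rfl
    · positivity
  obtain ⟨W, hW, -, -, hWn⟩ := exists_ofColumns hω x' hx's
  have hWe : ∀ ℓ v, W (harmonic ω ℓ v) = x' ℓ v := fun ℓ v => by
    refine (hW _).unique ?_
    convert hasSum_ite_eq ℓ (x' ℓ v) using 2 with n
    rw [coeff_harmonic hω]
    split_ifs with hn
    · rw [hn]
    · exact map_zero _
  refine ⟨k, W, b, ?_, ?_, fun ℓ hℓ v => ?_, hb, fun ℓ hℓ v => ?_⟩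
  · refine hWn.trans (Real.sqrt_le_iff.2 ⟨by norm_num, ?_⟩)
    simp only [hx'n]
    exact htail.trans (by norm_num)
  · refine summable_sq_of_le (fun _ => by positivity) (fun q => ?_) hx
    refine ContinuousLinearMap.opNorm_le_bound _ (by positivity) fun v => ?_
    change ‖coeff ω q.1 (W (harmonic ω q.2 v))‖ ≤ _
    rw [hWe]
    simp only [hx']
    split_ifs
    · exact ((coeff ω q.1).comp (x q.2)).le_opNorm v
    · rw [zero_apply, map_zero, norm_zero]
      positivity
  · rw [hWe]
    simp only [hx', if_neg hℓ]
    rfl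
  · rw [hWe, hWe]
    simp only [hx', if_pos hℓ]
    exact hL ℓ (by omega) v

lemma isFourierValueL_harmonic (hω : 0 < ω) (hV : IsStrongL2 ω V) (ℓ : ℤ) (v : H) :
    IsFourierValueL hV (harmonic ω ℓ v) (freq ω ℓ • harmonic ω ℓ v - pot hV ℓ v) := by
  refine ⟨freq ω ℓ • harmonic ω ℓ v, fun n => ?_, ?_⟩
  · rw [map_smul, coeff_harmonic hω]
    split_ifs with h
    · rw [h]
    · simp
  · congr 1
    refine (HasSum.tsum_eq ?_).symm
    convert hasSum_ite_eq ℓ (pot hV ℓ v) using 2 with n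
    rw [coeff_harmonic hω]
    split_ifs with hn
    · rw [hn]
    · exact map_zero _

/-- The restriction of `L` to a finite number of harmonics. -/
lemma exists_restriction_projBlock (hω : 0 < ω) (hV : IsStrongL2 ω V) (k : ℕ) :
    ∃ A : L2 ω H →L[ℂ] L2 ω H, (∀ f, A (projBlock ω k f) = A f) ∧
      ∀ f, IsFourierValueL hV (projBlock ω k f) (A f) := by
  refine ⟨∑ ℓ ∈ Finset.Icc (-(k : ℤ)) k,
    (freq ω ℓ • harmonic ω ℓ - pot hV ℓ).comp (coeff ω ℓ), fun f => ?_, fun f => ?_⟩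
  · simp only [sum_apply]
    refine Finset.sum_congr rfl fun ℓ hℓ => ?_
    rw [ContinuousLinearMap.comp_apply, ContinuousLinearMap.comp_apply, coeff_projBlock hω,
      if_neg]
    rwa [not_lt, abs_le, ← Finset.mem_Icc]
  · simp only [projBlock, sum_apply]
    exact IsFourierValueL.sum hω hV _ fun ℓ _ => isFourierValueL_harmonic hω hV ℓ (coeff ω ℓ f)

/-- Closedness of L passes from single harmonics to their L² sums. -/
lemma IsPartialTransform.of_coeff (hω : 0 < ω) {hV : IsStrongL2 ω V} {k : ℕ}
    {W : L2 ω H →L[ℂ] L2 ω H} {b : ℤ → H →L[ℂ] H} (h : IsPartialTransform hV k W b)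
    {f g : L2 ω H} (hf : ∀ ℓ : ℤ, ¬ (k : ℤ) < |ℓ| → coeff ω ℓ f = 0)
    (hg : ∀ ℓ : ℤ, ¬ (k : ℤ) < |ℓ| → coeff ω ℓ g = 0)
    (hfg : ∀ ℓ : ℤ, (k : ℤ) < |ℓ| → coeff ω ℓ g = freq ω ℓ • coeff ω ℓ f + b ℓ (coeff ω ℓ f)) :
    IsFourierValueL hV (f + W f) (g + W g) := by
  refine IsFourierValueL.of_hasSum hω hV (fun ℓ => ?_)
    ((hasSum_proj hω f).add ((hasSum_proj hω f).mapL W))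
    ((hasSum_proj hω g).add ((hasSum_proj hω g).mapL W))
  simp only [proj_apply]
  by_cases hℓ : (k : ℤ) < |ℓ|
  · rw [hfg ℓ hℓ]
    exact h.isFourierValueL ℓ hℓ _
  · rw [hf ℓ hℓ, hg ℓ hℓ, map_zero, map_zero, add_zero]
    exact IsFourierValueL.zero hω hV

end PartialTransform

/-! ### Decoupling the finite block by Sylvester equations. -/

section BlockDiagonalization

/-- The map Y ↦ z⁻¹(c − βY + YN) contracts by 1/2 once z dominates β and N. -/
lemma exists_sylvester_solution {E F : Type*} [NormedAddCommGroup E] [NormedSpace ℂ E]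
    [NormedAddCommGroup F] [NormedSpace ℂ F] [CompleteSpace F] (β : F →L[ℂ] F) (N : E →L[ℂ] E)
    (c : E →L[ℂ] F) {z : ℂ} (hz : z ≠ 0) (h : ‖z⁻¹‖ * (‖β‖ + ‖N‖) ≤ 1 / 2) :
    ∃ Y : E →L[ℂ] F, (∀ x, z • Y x + β (Y x) - Y (N x) = c x) ∧ ‖Y‖ ≤ 2 * (‖z⁻¹‖ * ‖c‖) := by
  obtain ⟨Y, hY, hYn⟩ := exists_fixedPoint_of_contracting
    (G := fun Y : E →L[ℂ] F => z⁻¹ • (c - β.comp Y + Y.comp N)) (r := 2 * (‖z⁻¹‖ * ‖c‖))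
    (fun Y Y' _ _ => by
      have h1 : z⁻¹ • (c - β.comp Y + Y.comp N) - z⁻¹ • (c - β.comp Y' + Y'.comp N)
          = z⁻¹ • ((Y - Y').comp N - β.comp (Y - Y')) := by
        rw [← smul_sub, ContinuousLinearMap.comp_sub, ContinuousLinearMap.sub_comp]
        congr 1
        abel
      rw [h1, norm_smul]
      calc _ ≤ ‖z⁻¹‖ * (‖Y - Y'‖ * ‖N‖ + ‖β‖ * ‖Y - Y'‖) := by
            gcongr
            exact (norm_sub_le _ _).trans (add_le_add (ContinuousLinearMap.opNorm_comp_le _ _)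
              (ContinuousLinearMap.opNorm_comp_le _ _))
        _ = ‖z⁻¹‖ * (‖β‖ + ‖N‖) * ‖Y - Y'‖ := by ring
        _ ≤ _ := by gcongr)
    (by
      simp only [ContinuousLinearMap.comp_zero, ContinuousLinearMap.zero_comp, sub_zero, add_zero]
      rw [norm_smul]
      linarith)
  refine ⟨Y, fun x => ?_, ?_⟩
  · have h1 : z • Y x = c x - β (Y x) + Y (N x) := by
      conv_lhs => rw [← hY]
      exact smul_inv_smul₀ hz _
    rw [h1]
    abel
  · simpa only [ContinuousLinearMap.comp_zero, ContinuousLinearMap.zero_comp, sub_zero, add_zero,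
      norm_smul] using hYn

variable {H : Type*} [NormedAddCommGroup H] [InnerProductSpace ℂ H] [CompleteSpace H]
  {ω : ℝ} {V : ℝ → H →L[ℂ] H}

/-- The operator `Y` that decouples the invariant complement from the block of the harmonics
`|ℓ| ≤ k`. -/
lemma exists_decoupling (hω : 0 < ω) {b : ℤ → H →L[ℂ] H} (hb : Summable fun ℓ => ‖b ℓ‖ ^ 2)
    {k : ℕ} {N : L2 ω H →L[ℂ] L2 ω H} (hN : ∀ f, N (projBlock ω k f) = N f) :
    ∃ (m : ℕ) (Y : L2 ω H →L[ℂ] L2 ω H) (D : ℝ), k ≤ m ∧ 0 ≤ D ∧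
      (∀ f, Y (projBlock ω k f) = Y f) ∧
      (∀ j f, ¬ (m : ℤ) < |j| → coeff ω j (Y f) = 0) ∧
      (∀ j f, (m : ℤ) < |j| → freq ω j • coeff ω j (Y f) + b j (coeff ω j (Y f))
        = coeff ω j (Y (N f)) - coeff ω j (N f)) ∧
      ∀ j f, ‖coeff ω j (Y f)‖ ≤ D * ‖(freq ω j)⁻¹‖ * ‖f‖ := by
  set P := projBlock (H := H) ω k with hP
  have hPP : ∀ f, P (P f) = P f := fun f => ext_coeff hω fun ℓ => by
    rw [hP, coeff_projBlock hω, coeff_projBlock hω]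
    split_ifs <;> rfl
  -- The frequency dominates only in rows |j| > m. The harmonics k < |j| ≤ m, where this may fail,
  -- are later absorbed into the finite block.
  have hev : ∀ᶠ j : ℤ in cofinite, ‖(freq ω j)⁻¹‖ * (‖b j‖ + ‖P.comp N‖) ≤ 1 / 2 := by
    have hpos : 0 < 1 / (2 * (1 + ‖P.comp N‖)) := by positivity
    have E1 := eventually_le_of_summable_sq (fun _ => by positivity)
      (summable_norm_freq_inv_sq hω) hpos
    have E2 := eventually_le_of_summable_sq (fun _ => by positivity) hb zero_lt_one
    filter_upwards [E1, E2] with j h1 h2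
    calc _ ≤ 1 / (2 * (1 + ‖P.comp N‖)) * (1 + ‖P.comp N‖) := by gcongr
      _ = 1 / 2 := by field_simp
  obtain ⟨m₀, hm₀⟩ := exists_forall_of_eventually_cofinite hev
  set m := max m₀ k with hm
  have hrow : ∀ j : ℤ, ∃ Z : L2 ω H →L[ℂ] H, ((m : ℤ) < |j| → ∀ f,
      freq ω j • Z f + b j (Z f) - Z (P (N f)) = -coeff ω j (N f)) ∧
      (¬ (m : ℤ) < |j| → Z = 0) ∧ ‖Z‖ ≤ 2 * ‖N‖ * ‖(freq ω j)⁻¹‖ := fun j => by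
    by_cases hj : (m : ℤ) < |j|
    · have hj0 : j ≠ 0 := by rintro rfl; simp at hj; omega
      obtain ⟨Z, h1, h2⟩ := exists_sylvester_solution (b j) (P.comp N) (-(coeff ω j).comp N)
        (freq_ne_zero hω hj0) (hm₀ j (lt_of_le_of_lt (by simp [hm]) hj))
      refine ⟨Z, fun _ => h1, fun h => absurd hj h, h2.trans ?_⟩
      rw [norm_neg]
      calc _ ≤ 2 * (‖(freq ω j)⁻¹‖ * (1 * ‖N‖)) := by
            gcongr
            refine (ContinuousLinearMap.opNorm_comp_le _ _).trans ?_
            gcongr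
            exact opNorm_coeff_le hω j
        _ = _ := by ring
    · refine ⟨0, fun h => absurd h hj, fun _ => rfl, ?_⟩
      exact ContinuousLinearMap.opNorm_zero.trans_le (by positivity)
  choose Z hZ hZ0 hZn using hrow
  set D := 2 * ‖N‖ * ‖P‖ with hD
  have hle : ∀ j f, ‖(Z j).comp P f‖ ≤ D * ‖(freq ω j)⁻¹‖ * ‖f‖ := fun j f => by
    calc ‖Z j (P f)‖ ≤ ‖Z j‖ * (‖P‖ * ‖f‖) := (Z j).le_opNorm_of_le (P.le_opNorm f)
      _ ≤ 2 * ‖N‖ * ‖(freq ω j)⁻¹‖ * (‖P‖ * ‖f‖) := by gcongr; exact hZn j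
      _ = _ := by rw [hD]; ring
  have hle2 : ∀ f j, ‖(Z j).comp P f‖ ^ 2 ≤ (D * ‖f‖) ^ 2 * ‖(freq ω j)⁻¹‖ ^ 2 := fun f j => by
    rw [← mul_pow]
    gcongr
    exact (hle j f).trans_eq (by ring)
  have hsum := fun f : L2 ω H => (summable_norm_freq_inv_sq hω).mul_left ((D * ‖f‖) ^ 2)
  have hs := fun f : L2 ω H => Summable.of_nonneg_of_le (fun _ => by positivity) (hle2 f) (hsum f)
  set σ := ∑' j : ℤ, ‖(freq ω j)⁻¹‖ ^ 2 with hσ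
  have hσ0 : 0 ≤ σ := tsum_nonneg fun _ => by positivity
  obtain ⟨Y, hY, -⟩ := exists_ofCoeff hω (fun j => (Z j).comp P) (M := D * Real.sqrt σ)
    (by positivity) hs (fun f => by
      refine ((hs f).tsum_le_tsum (hle2 f) (hsum f)).trans_eq ?_
      rw [tsum_mul_left, ← hσ]
      simp only [mul_pow, Real.sq_sqrt hσ0]
      ring)
  refine ⟨m, Y, D, le_max_right _ _, by positivity, fun f => ext_coeff hω fun j => ?_,
    fun j f hj => ?_, fun j f hj => ?_, fun j f => ?_⟩
  · rw [hY, hY]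
    change Z j (P (P f)) = Z j (P f)
    rw [hPP]
  · rw [hY, hZ0 j hj]
    rfl
  · rw [hY, hY]
    have h1 := hZ j hj (P f)
    rw [hN] at h1
    change freq ω j • Z j (P f) + b j (Z j (P f)) = Z j (P (N f)) - coeff ω j (N f)
    rw [sub_eq_iff_eq_add.1 h1]
    abel
  · rw [hY]
    exact hle j f

/-- The similarity of `L` to the block diagonal operator given by `A` on the harmonics `|ℓ| ≤ m`
and by the blocks `i 2πℓ / ω + b ℓ` for `|ℓ| > m`. -/
lemma exists_blockDiagonalization (hω : 0 < ω) {hV : IsStrongL2 ω V}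
    (hV₁ : Summable fun n : ℤ => ‖potCoeff ω V hV n‖ ^ 2)
    (hV₂ : Summable fun p : ℤ × ℤ =>
      ‖∑' n : {n : ℤ // n ≠ p.2}, ((p.2 : ℂ) - (n : ℤ))⁻¹ •
        (potCoeff ω V hV (p.1 + n)).comp (potCoeff ω V hV (p.2 + n))‖ ^ 2) :
    ∃ (m : ℕ) (U : L2 ω H ≃L[ℂ] L2 ω H) (W A : L2 ω H →L[ℂ] L2 ω H) (b : ℤ → H →L[ℂ] H),
      (U : L2 ω H →L[ℂ] L2 ω H) = ContinuousLinearMap.id ℂ (L2 ω H) + W ∧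
      IsHilbertSchmidt ω W ∧ (Summable fun ℓ => ‖b ℓ‖ ^ 2) ∧
      (∀ f, A (projBlock ω m f) = A f) ∧ (∀ f, projBlock ω m (A f) = A f) ∧
      ∀ f g, (∀ ℓ : ℤ, (m : ℤ) < |ℓ| →
          coeff ω ℓ g = freq ω ℓ • coeff ω ℓ f + b ℓ (coeff ω ℓ f)) →
        projBlock ω m g = A f → IsFourierValueL hV (U f) (U g) := by
  obtain ⟨k, W₀, b, hW⟩ := exists_isPartialTransform hω hV₁ hV₂
  obtain ⟨A₀, hA₀, hLA₀⟩ := exists_restriction_projBlock hω hV k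
  obtain ⟨S, hS1, hS2⟩ := exists_rightInverse_one_sub (K := -W₀)
    ((norm_neg W₀).trans_lt (hW.norm_le.trans_lt (by norm_num)))
  simp only [neg_apply, sub_neg_eq_add] at hS1 hS2
  -- N is (1 + W₀)⁻¹L(1 + W₀) on the low harmonics, where W₀ vanishes.
  set N := S.comp A₀ with hN
  obtain ⟨m, Y, D, hkm, hD, hYP, hY0, hYeq, hYn⟩ := exists_decoupling hω hW.summable
    (N := N) (k := k) (fun f => by rw [hN]; exact congrArg S (hA₀ f))
  have hlt : ∀ {j : ℤ}, (m : ℤ) < |j| → (k : ℤ) < |j| := fun h => by omega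
  have hYzero : ∀ f, (∀ j : ℤ, ¬ (k : ℤ) < |j| → coeff ω j f = 0) → Y f = 0 := fun f hf => by
    have : projBlock ω k f = 0 := ext_coeff hω fun j => by
      rw [coeff_projBlock hω, map_zero]
      split_ifs with h
      · rfl
      · exact hf j h
    rw [← hYP, this, map_zero]
  -- Y depends only on the harmonics |ℓ| ≤ k and takes values in |j| > m ≥ k. Hence (1 + Y)⁻¹ = 1 −
  -- Y, and `W` below is defined by 1 + W = (1 + W₀)(1 + Y).
  have hYY : ∀ f, Y (Y f) = 0 := fun f => hYzero _ fun j hj => hY0 j f fun h => hj (hlt h)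
  set W := W₀ + Y + W₀.comp Y with hWdef
  set A : L2 ω H →L[ℂ] L2 ω H := ((projBlock ω m).comp N).comp (projBlock ω m) +
    ∑ ℓ ∈ (Finset.Icc (-(m : ℤ)) m).filter (fun ℓ => (k : ℤ) < |ℓ|),
      ((harmonic ω ℓ).comp (freq ω ℓ • ContinuousLinearMap.id ℂ H + b ℓ)).comp (coeff ω ℓ) with hA
  have hNm : ∀ f, N (projBlock ω m f) = N f := fun f => by
    have h1 : projBlock ω k (projBlock ω m f) = projBlock ω k f := ext_coeff hω fun j => by
      simp only [coeff_projBlock hω]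
      split_ifs with h2 h3
      · rfl
      · exact absurd (hlt h3) h2
      · rfl
    change S (A₀ _) = S (A₀ _)
    rw [← hA₀, h1, hA₀]
  have hAc : ∀ j f, coeff ω j (A f) = if (m : ℤ) < |j| then 0 else coeff ω j (N f) +
      if (k : ℤ) < |j| then freq ω j • coeff ω j f + b j (coeff ω j f) else 0 := fun j f => by
    simp only [hA, add_apply, sum_apply, ContinuousLinearMap.comp_apply, map_add, map_sum,
      coeff_harmonic hω, coeff_projBlock hω, hNm]
    rw [Finset.sum_add_distrib, Finset.sum_ite_eq, Finset.sum_ite_eq]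
    simp only [Finset.mem_filter, Finset.mem_Icc, ← abs_le]
    by_cases h1 : (m : ℤ) < |j|
    · have h2 : ¬ (|j| ≤ (m : ℤ) ∧ (k : ℤ) < |j|) := by omega
      rw [if_pos h1, if_pos h1, if_neg h2, if_neg h2, add_zero, add_zero]
    · rw [if_neg h1, if_neg h1]
      congr 1
      by_cases h2 : (k : ℤ) < |j|
      · have h3 : |j| ≤ (m : ℤ) ∧ (k : ℤ) < |j| := ⟨not_lt.1 h1, h2⟩
        rw [if_pos h2, if_pos h3, if_pos h3]
        rfl
      · have h3 : ¬ (|j| ≤ (m : ℤ) ∧ (k : ℤ) < |j|) := fun h => h2 h.2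
        rw [if_neg h2, if_neg h3, if_neg h3, add_zero]
  have hinv₁ : ∀ f, (S f - Y (S f)) + W (S f - Y (S f)) = f := fun f => by
    have h1 := hS1 f
    simp only [hWdef, add_apply, ContinuousLinearMap.comp_apply, map_sub, hYY, map_zero]
    conv_rhs => rw [← h1]
    abel
  have hinv₂ : ∀ f, S (f + W f) - Y (S (f + W f)) = f := fun f => by
    have h1 : f + W f = (f + Y f) + W₀ (f + Y f) := by
      simp only [hWdef, add_apply, ContinuousLinearMap.comp_apply, map_add]
      abel
    rw [h1, hS2, map_add, hYY]
    abel
  let U : L2 ω H ≃L[ℂ] L2 ω H := ContinuousLinearEquiv.equivOfInverse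
    (ContinuousLinearMap.id ℂ (L2 ω H) + W) (S - Y.comp S) hinv₂ hinv₁
  have hU : ∀ f, U f = (f + Y f) + W₀ (f + Y f) := fun f => by
    change f + W f = _
    simp only [hWdef, add_apply, ContinuousLinearMap.comp_apply, map_add]
    abel
  refine ⟨m, U, W, A, b, ContinuousLinearMap.ext fun f => rfl, ?_, hW.summable, fun f => ?_,
    fun f => ?_, fun f g hfg hPg => ?_⟩
  -- Y and W₀Y have only finitely many nonzero columns; their rows are square summable, by the
  -- inverse frequencies and by the rows of W₀ respectively.
  · have hfin : Summable fun ℓ : ℤ => (if (k : ℤ) < |ℓ| then (0 : ℝ) else 1) ^ 2 := by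
      refine summable_of_hasFiniteSupport (((Finset.Icc (-(k : ℤ)) k).finite_toSet).subset
        fun ℓ hℓ => ?_)
      simp only [Function.mem_support] at hℓ
      rw [Finset.coe_Icc, Set.mem_Icc, ← abs_le]
      by_contra h
      exact hℓ (by rw [if_pos (not_le.1 h)]; norm_num)
    have hprod : ∀ {ρ : ℤ → ℝ}, (Summable fun j => ρ j ^ 2) → ∀ D : ℝ,
        Summable fun q : ℤ × ℤ => (D * ρ q.1 * if (k : ℤ) < |q.2| then (0 : ℝ) else 1) ^ 2 :=
      fun {ρ} hρ D => by
        refine ((hρ.mul_of_nonneg hfin (fun _ => by positivity)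
          (fun _ => by positivity)).mul_left (D ^ 2)).congr fun q => ?_
        ring
    have hYe : ∀ ℓ : ℤ, (k : ℤ) < |ℓ| → ∀ v, Y (harmonic ω ℓ v) = 0 := fun ℓ hℓ v =>
      hYzero _ fun j hj => by
        rw [coeff_harmonic hω, if_neg]
        rintro rfl
        exact hj hℓ
    have hYsum := hprod (summable_norm_freq_inv_sq hω) D
    have hWYsum := hprod (summable_rows hω hW.hilbertSchmidt) ‖Y‖
    refine summable_sq_of_le (fun _ => by positivity) (fun q => ?_)
      (summable_sq_add (summable_sq_add hW.hilbertSchmidt hYsum) hWYsum)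
    refine (norm_proj_comp_comp_proj_le hω q.1 q.2 W).trans ?_
    have hρ : 0 ≤ ‖(coeff ω q.1).comp W₀‖ := by positivity
    refine ContinuousLinearMap.opNorm_le_bound _ ?_ fun v => ?_
    · split_ifs <;> positivity
    change ‖coeff ω q.1 (W (harmonic ω q.2 v))‖ ≤ _
    simp only [hWdef, add_apply, ContinuousLinearMap.comp_apply, map_add]
    rw [add_mul, add_mul]
    refine norm_add₃_le.trans (add_le_add (add_le_add ?_ ?_) ?_)
    · exact ((coeff ω q.1).comp (W₀.comp (harmonic ω q.2))).le_opNorm v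
    · split_ifs with hq
      · rw [hYe _ hq, map_zero, norm_zero]; simp
      · refine (hYn _ _).trans_eq ?_
        rw [norm_harmonic hω, mul_one]
    · split_ifs with hq
      · rw [hYe _ hq, map_zero, map_zero, norm_zero]; simp
      · refine (((coeff ω q.1).comp W₀).le_opNorm_of_le (Y.le_opNorm _)).trans_eq ?_
        rw [norm_harmonic hω]
        ring
  · refine ext_coeff hω fun j => ?_
    rw [hAc, hAc, hNm, coeff_projBlock hω]
    by_cases h1 : (m : ℤ) < |j|
    · rw [if_pos h1, if_pos h1]
    · simp only [if_neg h1]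
  · refine ext_coeff hω fun j => ?_
    rw [coeff_projBlock hω, hAc]
    split_ifs <;> rfl
  · have hgc : ∀ j : ℤ, ¬ (m : ℤ) < |j| → coeff ω j g = coeff ω j (A f) := fun j hj => by
      rw [← hPg, coeff_projBlock hω, if_neg hj]
    -- Uf is split as 1 + W₀ applied to the low part of f, to Yf and to the high part of f. The
    -- Sylvester equation is what makes the three values of L add up to Ug.
    have h1 : IsFourierValueL hV (projBlock ω k f + W₀ (projBlock ω k f)) (N f + W₀ (N f)) := by
      have h2 : W₀ (projBlock ω k f) = 0 := by
        simp only [projBlock, sum_apply, map_sum]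
        refine Finset.sum_eq_zero fun ℓ hℓ => hW.apply_harmonic ℓ ?_ _
        rwa [not_lt, abs_le, ← Finset.mem_Icc]
      have h3 : N f + W₀ (N f) = A₀ f := hS1 (A₀ f)
      rw [h2, h3, add_zero]
      exact hLA₀ f
    have h2 : IsFourierValueL hV (Y f + W₀ (Y f))
        ((Y (N f) - (N f - projBlock ω m (N f))) +
          W₀ (Y (N f) - (N f - projBlock ω m (N f)))) := by
      have hz : ∀ j : ℤ, ¬ (m : ℤ) < |j| →
          coeff ω j (Y (N f) - (N f - projBlock ω m (N f))) = 0 := fun j hj => by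
        rw [map_sub, map_sub, coeff_projBlock hω, if_neg hj, hY0 j _ hj, sub_self, sub_zero]
      have hnz : ∀ j : ℤ, (m : ℤ) < |j| → coeff ω j (Y (N f) - (N f - projBlock ω m (N f)))
          = freq ω j • coeff ω j (Y f) + b j (coeff ω j (Y f)) := fun j hj => by
        rw [map_sub, map_sub, coeff_projBlock hω, if_pos hj, sub_zero, hYeq j f hj]
      refine hW.of_coeff hω (fun j hj => hY0 j f fun h => hj (hlt h))
        (fun j hj => hz j fun h => hj (hlt h)) fun j _ => ?_
      by_cases h : (m : ℤ) < |j|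
      · exact hnz j h
      · rw [hz j h, hY0 j f h, smul_zero, map_zero, add_zero]
    have h3 : IsFourierValueL hV ((f - projBlock ω k f) + W₀ (f - projBlock ω k f))
        ((g - projBlock ω m (N f)) + W₀ (g - projBlock ω m (N f))) := by
      refine hW.of_coeff hω (fun j hj => ?_) (fun j hj => ?_) fun j hj => ?_
      · rw [map_sub, coeff_projBlock hω, if_neg hj, sub_self]
      · have hj' : ¬ (m : ℤ) < |j| := fun h => hj (hlt h)
        rw [map_sub, coeff_projBlock hω, if_neg hj', hgc j hj', hAc, if_neg hj', if_neg hj,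
          add_zero, sub_self]
      · rw [map_sub, map_sub, coeff_projBlock hω, coeff_projBlock hω, if_pos hj, sub_zero]
        by_cases h : (m : ℤ) < |j|
        · rw [if_pos h, sub_zero, hfg j h]
        · rw [if_neg h, hgc j h, hAc, if_neg h, if_pos hj, add_sub_cancel_left]
    have hYg : Y g = Y (N f) := by
      rw [← hYP g, ← hYP (N f)]
      congr 1
      refine ext_coeff hω fun j => ?_
      rw [coeff_projBlock hω, coeff_projBlock hω]
      split_ifs with hj
      · rfl
      · have hj' : ¬ (m : ℤ) < |j| := fun h => hj (hlt h)
        rw [hgc j hj', hAc, if_neg hj', if_neg hj, add_zero]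
    have h4 := (h1.add hω hV h2).add hω hV h3
    rw [hU, hU]
    convert h4 using 1
    · simp only [map_add, map_sub]
      abel
    · simp only [map_add, map_sub, hYg]
      abel

end BlockDiagonalization

/-! ### Exponentials of bounded operators. -/

section OperatorExponential

variable {E F : Type*} [NormedAddCommGroup E] [NormedSpace ℂ E] [CompleteSpace E]
  [NormedAddCommGroup F] [NormedSpace ℂ F] [CompleteSpace F]

lemma hasSum_opExp (A : E →L[ℂ] E) :
    HasSum (fun n : ℕ => ((n.factorial : ℂ)⁻¹) • A ^ n) (opExp A) :=
  NormedSpace.exp_series_hasSum_exp' (𝕂 := ℂ) A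

lemma opExp_add {A B : E →L[ℂ] E} (h : Commute A B) : opExp (A + B) = opExp A * opExp B := by
  let +nondep : NormedAlgebra ℚ (E →L[ℂ] E) := .restrictScalars ℚ ℂ (E →L[ℂ] E)
  exact NormedSpace.exp_add_of_commute h

lemma opExp_zero : opExp (0 : E →L[ℂ] E) = 1 := by
  let +nondep : NormedAlgebra ℚ (E →L[ℂ] E) := .restrictScalars ℚ ℂ (E →L[ℂ] E)
  exact NormedSpace.exp_zero

lemma opExp_intertwine {A : E →L[ℂ] E} {B : F →L[ℂ] F} (S : E →L[ℂ] F)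
    (h : ∀ x, S (A x) = B (S x)) (x : E) : S (opExp A x) = opExp B (S x) := by
  have hpow : ∀ (n : ℕ) (x : E), S ((A ^ n) x) = (B ^ n) (S x) := by
    intro n
    induction n with
    | zero => intro x; rfl
    | succ n ih =>
      intro x
      rw [pow_succ, pow_succ]
      change S ((A ^ n) (A x)) = (B ^ n) (B (S x))
      rw [ih, h]
  have h1 := ((hasSum_opExp A).mapL (ContinuousLinearMap.apply ℂ E x)).mapL S
  have h2 := (hasSum_opExp B).mapL (ContinuousLinearMap.apply ℂ F (S x))
  refine h1.unique ?_
  convert h2 using 2 with n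
  · simp only [ContinuousLinearMap.apply_apply, map_smul, hpow]
  · rfl

lemma opExp_smul_intertwine {A : E →L[ℂ] E} {B : F →L[ℂ] F} (S : E →L[ℂ] F)
    (h : ∀ x, S (A x) = B (S x)) (c : ℂ) (x : E) : S (opExp (c • A) x) = opExp (c • B) (S x) :=
  opExp_intertwine S (fun x => by simp only [smul_apply, map_smul, h]) x

lemma opExp_add_smul (A : E →L[ℂ] E) (s t : ℝ) :
    opExp (((s + t : ℝ) : ℂ) • A) = opExp ((s : ℂ) • A) * opExp ((t : ℂ) • A) := by
  rw [Complex.ofReal_add, add_smul]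
  exact opExp_add (((Commute.refl A).smul_left _).smul_right _)

lemma norm_opExp_le (A : E →L[ℂ] E) : ‖opExp A‖ ≤ Real.exp ‖A‖ := by
  have h1 : HasSum (fun n : ℕ => ((n.factorial : ℝ)⁻¹) * ‖A‖ ^ n) (Real.exp ‖A‖) := by
    have := NormedSpace.exp_series_hasSum_exp' (𝕂 := ℝ) ‖A‖
    rw [Real.exp_eq_exp_ℝ]
    exact this
  rw [← (hasSum_opExp A).tsum_eq]
  refine tsum_of_norm_bounded h1 fun n => ?_
  rw [norm_smul, norm_inv, Complex.norm_natCast]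
  gcongr
  cases n with
  | zero => simp only [pow_zero]; exact ContinuousLinearMap.norm_id_le
  | succ n => exact norm_pow_le' A n.succ_pos

lemma opExp_smul_id_add (z : ℂ) (B : E →L[ℂ] E) :
    opExp (z • ContinuousLinearMap.id ℂ E + B) = Complex.exp z • opExp B := by
  have h1 : opExp (z • ContinuousLinearMap.id ℂ E) = Complex.exp z • (1 : E →L[ℂ] E) := by
    have h := NormedSpace.algebraMap_exp_comm (𝕂 := ℂ) (𝔸 := E →L[ℂ] E) z
    rw [← Complex.exp_eq_exp_ℂ, Algebra.algebraMap_eq_smul_one, Algebra.algebraMap_eq_smul_one] at h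
    exact h.symm
  have h2 : Commute (z • ContinuousLinearMap.id ℂ E) B := (Commute.one_left B).smul_left z
  rw [opExp_add h2, h1, smul_mul_assoc, one_mul]

/-- The scalar part commutes with B and contributes a factor of modulus 1, so the growth is governed
by B alone, uniformly in the frequency. -/
lemma norm_opExp_smul_le {z : ℂ} (hz : z.re = 0) (B : E →L[ℂ] E) (t : ℝ) :
    ‖opExp ((t : ℂ) • (z • ContinuousLinearMap.id ℂ E + B))‖ ≤ Real.exp (‖B‖ * |t|) := by
  rw [smul_add, smul_smul, opExp_smul_id_add, norm_smul, Complex.norm_exp]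
  simp only [Complex.mul_re, Complex.ofReal_re, hz, Complex.ofReal_im, mul_zero, zero_mul, sub_zero,
    Real.exp_zero, one_mul]
  refine (norm_opExp_le _).trans_eq ?_
  rw [norm_smul, Complex.norm_real, Real.norm_eq_abs, mul_comm]

lemma hasDerivAt_opExp (A : E →L[ℂ] E) (x : E) (t : ℝ) :
    HasDerivAt (fun t : ℝ => opExp ((t : ℂ) • A) x) (opExp ((t : ℂ) • A) (A x)) t := by
  have h1 : HasDerivAt (fun u : ℂ => opExp (u • A)) (opExp ((t : ℂ) • A) * A) (t : ℂ) :=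
    hasDerivAt_exp_smul_const (𝕂 := ℂ) A (t : ℂ)
  have h2 := h1.clm_apply (hasDerivAt_const (t : ℂ) x)
  simp only [map_zero, add_zero] at h2
  have h3 := h2.scomp t Complex.ofRealCLM.hasDerivAt
  simp only [Complex.ofRealCLM_apply, Complex.ofReal_one, one_smul] at h3
  exact h3

lemma continuous_opExp (A : E →L[ℂ] E) (x : E) : Continuous fun t : ℝ => opExp ((t : ℂ) • A) x :=
  continuous_iff_continuousAt.2 fun t => (hasDerivAt_opExp A x t).continuousAt

lemma integral_opExp (A : E →L[ℂ] E) (x : E) (t : ℝ) :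
    ∫ s in (0 : ℝ)..t, opExp ((s : ℂ) • A) (A x) = opExp ((t : ℂ) • A) x - x := by
  rw [intervalIntegral.integral_eq_sub_of_hasDerivAt (fun s _ => hasDerivAt_opExp A x s)
    ((continuous_opExp A (A x)).intervalIntegrable _ _), Complex.ofReal_zero, zero_smul, opExp_zero]
  rfl

lemma tendsto_slope_zero_complex {φ : ℝ → E} {x : E} (h : HasDerivAt φ x 0) :
    Tendsto (fun t : ℝ => ((t : ℂ)⁻¹) • (φ t - φ 0)) (𝓝[≠] 0) (𝓝 x) := by
  have h1 := h.tendsto_slope_zero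
  simp only [zero_add] at h1
  refine h1.congr fun t => ?_
  rw [← Complex.ofReal_inv, Complex.coe_smul]

lemma tendsto_opExp_slope (A : E →L[ℂ] E) (x : E) :
    Tendsto (fun t : ℝ => ((t : ℂ)⁻¹) • (opExp ((t : ℂ) • A) x - x)) (𝓝[≠] 0) (𝓝 (A x)) := by
  have h1 := tendsto_slope_zero_complex (hasDerivAt_opExp A x 0)
  simpa [opExp_zero] using h1

end OperatorExponential

/-! ### The block diagonal model group and its generator. -/

section ModelGroup

variable {H : Type*} [NormedAddCommGroup H] [InnerProductSpace ℂ H] [CompleteSpace H]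

lemma coeff_projBlock_of_lt {ω : ℝ} (hω : 0 < ω) {m : ℕ} {ℓ : ℤ} (hℓ : (m : ℤ) < |ℓ|)
    (f : L2 ω H) : coeff ω ℓ (projBlock ω m f) = 0 := by
  rw [coeff_projBlock hω, if_pos hℓ]

lemma coeff_projBlock_of_le {ω : ℝ} (hω : 0 < ω) {m : ℕ} {ℓ : ℤ} (hℓ : ¬ (m : ℤ) < |ℓ|)
    (f : L2 ω H) : coeff ω ℓ (projBlock ω m f) = coeff ω ℓ f := by
  rw [coeff_projBlock hω, if_neg hℓ]

lemma projBlock_projBlock {ω : ℝ} (hω : 0 < ω) (m : ℕ) (f : L2 ω H) :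
    projBlock ω m (projBlock ω m f) = projBlock ω m f := by
  refine ext_coeff hω fun ℓ => ?_
  by_cases hℓ : (m : ℤ) < |ℓ|
  · rw [coeff_projBlock_of_lt hω hℓ, coeff_projBlock_of_lt hω hℓ]
  · rw [coeff_projBlock_of_le hω hℓ]

lemma ext_coeff_projBlock {ω : ℝ} (hω : 0 < ω) (m : ℕ) {f g : L2 ω H}
    (h1 : ∀ ℓ : ℤ, (m : ℤ) < |ℓ| → coeff ω ℓ f = coeff ω ℓ g)
    (h2 : projBlock ω m f = projBlock ω m g) : f = g := by
  refine ext_coeff hω fun ℓ => ?_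
  by_cases hℓ : (m : ℤ) < |ℓ|
  · exact h1 ℓ hℓ
  · rw [← coeff_projBlock_of_le hω hℓ f, h2, coeff_projBlock_of_le hω hℓ g]

/-- Off the block, coefficientwise continuity becomes norm continuity by dominated convergence in
Parseval's sum; the coefficients of f give the majorant. -/
lemma continuous_of_coeff_projBlock {ω : ℝ} (hω : 0 < ω) (m : ℕ) {u : ℝ → L2 ω H} (f : L2 ω H)
    {K : ℝ → ℝ} (hK : Continuous K) (hu : Continuous fun t => projBlock ω m (u t))
    (hc : ∀ ℓ : ℤ, (m : ℤ) < |ℓ| → Continuous fun t => coeff ω ℓ (u t))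
    (hb : ∀ ℓ : ℤ, (m : ℤ) < |ℓ| → ∀ t, ‖coeff ω ℓ (u t)‖ ≤ K t * ‖coeff ω ℓ f‖) :
    Continuous u := by
  have hw : Continuous fun t => u t - projBlock ω m (u t) := by
    set w : ℝ → L2 ω H := fun t => u t - projBlock ω m (u t) with hwdef
    have hw1 : ∀ ℓ : ℤ, (m : ℤ) < |ℓ| → ∀ t, coeff ω ℓ (w t) = coeff ω ℓ (u t) := by
      intro ℓ hℓ t
      rw [hwdef, map_sub, coeff_projBlock_of_lt hω hℓ, sub_zero]
    have hw2 : ∀ ℓ : ℤ, ¬ (m : ℤ) < |ℓ| → ∀ t, coeff ω ℓ (w t) = 0 := by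
      intro ℓ hℓ t
      rw [hwdef, map_sub, coeff_projBlock_of_le hω hℓ, sub_self]
    refine continuous_iff_continuousAt.2 fun t₀ => ?_
    have hsum : ∀ t, ‖w t - w t₀‖ ^ 2 = ∑' ℓ, ‖coeff ω ℓ (w t - w t₀)‖ ^ 2 := fun t =>
      (hasSum_norm_coeff_sq hω _).tsum_eq.symm
    have hlim : Tendsto (fun t => ‖w t - w t₀‖ ^ 2) (𝓝 t₀) (𝓝 (∑' _ : ℤ, (0 : ℝ))) := by
      simp only [hsum]
      have hev : ∀ᶠ t in 𝓝 t₀, K t < K t₀ + 1 :=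
        hK.continuousAt.eventually_lt continuousAt_const (lt_add_one _)
      refine tendsto_tsum_of_dominated_convergence
        (bound := fun ℓ => (K t₀ + 1 + K t₀) ^ 2 * ‖coeff ω ℓ f‖ ^ 2)
        ((hasSum_norm_coeff_sq hω f).summable.mul_left _) ?_ ?_
      · intro ℓ
        by_cases hℓ : (m : ℤ) < |ℓ|
        · have h1 : Continuous fun t => ‖coeff ω ℓ (w t - w t₀)‖ ^ 2 := by
            simp only [map_sub, hw1 ℓ hℓ]
            exact ((hc ℓ hℓ).sub continuous_const).norm.pow 2
          have h2 := h1.tendsto t₀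
          simpa using h2
        · simp only [map_sub, hw2 ℓ hℓ, sub_self, norm_zero]
          simp
      · filter_upwards [hev] with t ht ℓ
        rw [Real.norm_of_nonneg (by positivity)]
        by_cases hℓ : (m : ℤ) < |ℓ|
        · rw [map_sub, hw1 ℓ hℓ, hw1 ℓ hℓ, ← mul_pow]
          refine pow_le_pow_left₀ (norm_nonneg _) ((norm_sub_le _ _).trans ?_) 2
          have h1 := hb ℓ hℓ t
          have h2 := hb ℓ hℓ t₀
          have h3 := mul_le_mul_of_nonneg_right ht.le (norm_nonneg (coeff ω ℓ f))
          linarith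
        · rw [map_sub, hw2 ℓ hℓ, hw2 ℓ hℓ, sub_self, norm_zero, zero_pow two_ne_zero]
          positivity
    rw [tsum_zero] at hlim
    have h0 : Tendsto (fun t => ‖w t - w t₀‖) (𝓝 t₀) (𝓝 0) := by
      have h1 := hlim.sqrt
      simpa [Real.sqrt_sq] using h1
    exact tendsto_iff_norm_sub_tendsto_zero.2 h0
  exact (hw.add hu).congr fun t => sub_add_cancel _ _

variable {ω : ℝ} {m : ℕ} {A : L2 ω H →L[ℂ] L2 ω H} {b : ℤ → H →L[ℂ] H}

lemma exists_modelGroup (hω : 0 < ω) {β : ℝ} (hβ : ∀ ℓ, ‖b ℓ‖ ≤ β)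
    (hAP : ∀ f, A (projBlock ω m f) = A f) (hPA : ∀ f, projBlock ω m (A f) = A f) :
    ∃ T : C0Group (L2 ω H),
      (∀ t f (ℓ : ℤ), (m : ℤ) < |ℓ| → coeff ω ℓ (T.op t f) =
        opExp ((t : ℂ) • (freq ω ℓ • ContinuousLinearMap.id ℂ H + b ℓ)) (coeff ω ℓ f)) ∧
      ∀ t f, projBlock ω m (T.op t f) = opExp ((t : ℂ) • A) (projBlock ω m f) := by
  classical
  set F : ℝ → ℤ → H →L[ℂ] H := fun t ℓ => if (m : ℤ) < |ℓ| then
    opExp ((t : ℂ) • (freq ω ℓ • ContinuousLinearMap.id ℂ H + b ℓ)) else 0 with hF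
  have hFle : ∀ t ℓ, ‖F t ℓ‖ ≤ Real.exp (β * |t|) := by
    intro t ℓ
    by_cases hℓ : (m : ℤ) < |ℓ|
    · simp only [hF, if_pos hℓ]
      refine (norm_opExp_smul_le (freq_re ω ℓ) (b ℓ) t).trans (Real.exp_le_exp.2 ?_)
      exact mul_le_mul_of_nonneg_right (hβ ℓ) (abs_nonneg t)
    · simp only [hF, if_neg hℓ, norm_zero]
      positivity
  choose S hS _ using fun t => exists_diag hω (F t) (Real.exp_pos (β * |t|)).le (hFle t)
  have hcomm : ∀ t f, projBlock ω m (opExp ((t : ℂ) • A) f)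
      = opExp ((t : ℂ) • A) (projBlock ω m f) := fun t f =>
    opExp_smul_intertwine (projBlock ω m) (fun x => by rw [hPA, hAP]) _ f
  set op : ℝ → L2 ω H →L[ℂ] L2 ω H := fun t => S t + (opExp ((t : ℂ) • A)).comp (projBlock ω m)
    with hop
  have hPS : ∀ t f, projBlock ω m (S t f) = 0 := by
    intro t f
    refine ext_coeff hω fun ℓ => ?_
    by_cases hℓ : (m : ℤ) < |ℓ|
    · rw [coeff_projBlock_of_lt hω hℓ, map_zero]
    · rw [coeff_projBlock_of_le hω hℓ, hS, hF]
      simp only [if_neg hℓ, zero_apply, map_zero]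
  have hP : ∀ t f, projBlock ω m (op t f) = opExp ((t : ℂ) • A) (projBlock ω m f) := by
    intro t f
    simp only [hop, add_apply, map_add, hPS, zero_add, ContinuousLinearMap.comp_apply]
    rw [hcomm, projBlock_projBlock hω]
  have hC : ∀ t f (ℓ : ℤ), (m : ℤ) < |ℓ| → coeff ω ℓ (op t f) =
      opExp ((t : ℂ) • (freq ω ℓ • ContinuousLinearMap.id ℂ H + b ℓ)) (coeff ω ℓ f) := by
    intro t f ℓ hℓ
    simp only [hop, add_apply, map_add, ContinuousLinearMap.comp_apply]
    rw [← hcomm, coeff_projBlock_of_lt hω hℓ, add_zero, hS, hF]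
    simp only [if_pos hℓ]
  refine ⟨⟨op, ?_, ?_, ?_⟩, hC, hP⟩
  · ext1 f
    refine ext_coeff_projBlock hω m (fun ℓ hℓ => ?_) ?_
    · rw [hC 0 f ℓ hℓ, Complex.ofReal_zero, zero_smul, opExp_zero]
      rfl
    · rw [hP, Complex.ofReal_zero, zero_smul, opExp_zero]
      rfl
  · intro s t
    ext1 f
    refine ext_coeff_projBlock hω m (fun ℓ hℓ => ?_) ?_
    · rw [hC _ _ _ hℓ, ContinuousLinearMap.comp_apply, hC _ _ _ hℓ, hC _ _ _ hℓ, opExp_add_smul]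
      rfl
    · rw [hP, ContinuousLinearMap.comp_apply, hP, hP, opExp_add_smul]
      rfl
  · intro f
    refine continuous_of_coeff_projBlock hω m f (K := fun t => Real.exp (β * |t|))
      (by fun_prop) ?_ ?_ ?_
    · simp only [hP]
      exact continuous_opExp A _
    · intro ℓ hℓ
      simp only [fun t => hC t f ℓ hℓ]
      exact continuous_opExp _ _
    · intro ℓ hℓ t
      rw [hC t f ℓ hℓ]
      refine (ContinuousLinearMap.le_opNorm _ _).trans ?_
      have := hFle t ℓ
      simp only [hF, if_pos hℓ] at this
      exact mul_le_mul_of_nonneg_right this (norm_nonneg _)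

lemma isGeneratorValue_modelGroup_iff (hω : 0 < ω) {T : C0Group (L2 ω H)}
    (hAP : ∀ f, A (projBlock ω m f) = A f)
    (hC : ∀ t f (ℓ : ℤ), (m : ℤ) < |ℓ| → coeff ω ℓ (T.op t f) =
        opExp ((t : ℂ) • (freq ω ℓ • ContinuousLinearMap.id ℂ H + b ℓ)) (coeff ω ℓ f))
    (hP : ∀ t f, projBlock ω m (T.op t f) = opExp ((t : ℂ) • A) (projBlock ω m f))
    (f h : L2 ω H) :
    T.IsGeneratorValue f h ↔
      (∀ ℓ : ℤ, (m : ℤ) < |ℓ| → coeff ω ℓ h = freq ω ℓ • coeff ω ℓ f + b ℓ (coeff ω ℓ f)) ∧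
        projBlock ω m h = A f := by
  constructor
  · intro hg
    refine ⟨fun ℓ hℓ => ?_, ?_⟩
    · have h1 := ((coeff ω ℓ).continuous.tendsto h).comp hg
      have h2 := tendsto_opExp_slope (freq ω ℓ • ContinuousLinearMap.id ℂ H + b ℓ) (coeff ω ℓ f)
      refine tendsto_nhds_unique h1 (h2.congr fun t => ?_)
      simp only [Function.comp_apply, map_smul, map_sub, hC t f ℓ hℓ]
    · have h1 := ((projBlock ω m).continuous.tendsto h).comp hg
      have h2 := tendsto_opExp_slope A (projBlock ω m f)
      rw [hAP] at h2
      refine tendsto_nhds_unique h1 (h2.congr fun t => ?_)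
      simp only [Function.comp_apply, map_smul, map_sub, hP t f]
  · rintro ⟨h1, h2⟩
    -- This integral identity can be checked coefficientwise; differentiating it at 0 gives the
    -- strong limit without exchanging a limit with the infinite sum.
    have hint : ∀ t : ℝ, ∫ s in (0 : ℝ)..t, T.op s h = T.op t f - f := by
      intro t
      have hi : IntervalIntegrable (fun s => T.op s h) volume 0 t :=
        (T.continuous_op h).intervalIntegrable _ _
      refine ext_coeff_projBlock hω m (fun ℓ hℓ => ?_) ?_
      · rw [← ContinuousLinearMap.intervalIntegral_comp_comm _ hi]
        simp only [fun s => hC s h ℓ hℓ, map_sub, hC t f ℓ hℓ]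
        rw [← integral_opExp]
        simp only [add_apply, smul_apply, ContinuousLinearMap.id_apply, h1 ℓ hℓ]
      · rw [← ContinuousLinearMap.intervalIntegral_comp_comm _ hi]
        simp only [hP, map_sub]
        rw [← integral_opExp, hAP, h2]
        rfl
    have hd : HasDerivAt (fun t => ∫ s in (0 : ℝ)..t, T.op s h) (T.op 0 h) 0 :=
      ((T.continuous_op h).integral_hasStrictDerivAt 0 0).hasDerivAt
    have hs := tendsto_slope_zero_complex hd
    simp only [intervalIntegral.integral_same, sub_zero, hint, T.op_zero] at hs
    exact hs

end ModelGroup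

/-! ### The similarity is exact: the conjugated model group is generated by L. -/

section Generation

variable {H : Type*} [NormedAddCommGroup H] [InnerProductSpace ℂ H] [CompleteSpace H]
  {ω : ℝ} {V : ℝ → H →L[ℂ] H}
  {m : ℕ} {A : L2 ω H →L[ℂ] L2 ω H} {b : ℤ → H →L[ℂ] H}

/-- Surjectivity of the model minus μ. Once μ is at least twice the bounds of the blocks, each block
is inverted by a Sylvester equation with N = 0, uniformly in ℓ. -/
lemma exists_model_resolvent (hω : 0 < ω) {β : ℝ} (hβ : ∀ ℓ, ‖b ℓ‖ ≤ β)
    (hAP : ∀ f, A (projBlock ω m f) = A f) (hPA : ∀ f, projBlock ω m (A f) = A f)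
    {μ : ℝ} (hμ : 0 < μ) (hμβ : 2 * β ≤ μ) (hμA : 2 * ‖A‖ ≤ μ) (q : L2 ω H) :
    ∃ f, (∀ ℓ : ℤ, (m : ℤ) < |ℓ| →
        coeff ω ℓ (q + (μ : ℂ) • f) = freq ω ℓ • coeff ω ℓ f + b ℓ (coeff ω ℓ f)) ∧
      projBlock ω m (q + (μ : ℂ) • f) = A f := by
  have hrow : ∀ ℓ : ℤ, ∃ Y : H →L[ℂ] H, ((m : ℤ) < |ℓ| → ∀ x, (freq ω ℓ - μ) • Y x + b ℓ (Y x) = x) ∧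
      (¬ (m : ℤ) < |ℓ| → Y = 0) ∧ ‖Y‖ ≤ 2 * μ⁻¹ := by
    intro ℓ
    by_cases hℓ : (m : ℤ) < |ℓ|
    · have h1 := norm_freq_sub_inv_le ω ℓ hμ
      obtain ⟨Y, hY, hYn⟩ := exists_sylvester_solution (b ℓ) (0 : H →L[ℂ] H)
        (ContinuousLinearMap.id ℂ H) (freq_sub_ne_zero ω ℓ hμ) (by
          rw [norm_zero, add_zero]
          calc _ ≤ μ⁻¹ * (μ / 2) := by
                gcongr
                exact (hβ ℓ).trans (by linarith)
            _ = 1 / 2 := by field_simp)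
      refine ⟨Y, fun _ x => by simpa using hY x, fun h => absurd hℓ h, hYn.trans ?_⟩
      have h2 : ‖ContinuousLinearMap.id ℂ H‖ ≤ 1 := ContinuousLinearMap.norm_id_le
      calc _ ≤ 2 * (μ⁻¹ * 1) := by gcongr
        _ = _ := by ring
    · exact ⟨0, fun h => absurd h hℓ, fun _ => rfl, by rw [norm_zero]; positivity⟩
  choose Y hY hY0 hYn using hrow
  obtain ⟨D, hD, -⟩ := exists_diag hω Y (by positivity) hYn
  have hμ0 : (-(μ : ℂ)) ≠ 0 := neg_ne_zero.2 (Complex.ofReal_ne_zero.2 hμ.ne')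
  obtain ⟨Z, hZ, -⟩ := exists_sylvester_solution A (0 : L2 ω H →L[ℂ] L2 ω H)
    (ContinuousLinearMap.id ℂ (L2 ω H)) hμ0 (by
      rw [norm_zero, add_zero, norm_inv, norm_neg, Complex.norm_real, Real.norm_of_nonneg hμ.le]
      calc _ ≤ μ⁻¹ * (μ / 2) := by
            gcongr
            linarith
        _ = 1 / 2 := by field_simp)
  simp only [zero_apply, map_zero, sub_zero, ContinuousLinearMap.id_apply] at hZ
  have hPD : projBlock ω m (D q) = 0 := by
    refine ext_coeff hω fun ℓ => ?_
    by_cases hℓ : (m : ℤ) < |ℓ|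
    · rw [coeff_projBlock_of_lt hω hℓ, map_zero]
    · rw [coeff_projBlock_of_le hω hℓ, hD, hY0 ℓ hℓ, zero_apply, map_zero]
  refine ⟨D q + projBlock ω m (Z (projBlock ω m q)), fun ℓ hℓ => ?_, ?_⟩
  · have h1 := hY ℓ hℓ (coeff ω ℓ q)
    simp only [map_add, map_smul, coeff_projBlock_of_lt hω hℓ, add_zero, hD]
    nth_rewrite 1 [← h1]
    module
  · have h1 := hZ (projBlock ω m q)
    have h2 : A (D q + projBlock ω m (Z (projBlock ω m q))) = A (Z (projBlock ω m q)) := by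
      rw [← hAP, map_add, hPD, zero_add, projBlock_projBlock hω, hAP]
    have h3 := congrArg (projBlock ω m) h1
    rw [map_add, map_smul, hPA, projBlock_projBlock hω] at h3
    rw [h2, map_add, map_smul, map_add, hPD, zero_add, projBlock_projBlock hω]
    rw [neg_smul, neg_add_eq_sub, sub_eq_iff_eq_add] at h3
    exact h3.symm

/-- An operator that is onto has no proper injective extension: for a common large μ the model minus
μ is onto, and L − μ, which extends its conjugate by U, is injective. -/
lemma isFourierValueL_iff_of_blockDiagonal (hω : 0 < ω) {hV : IsStrongL2 ω V} {β : ℝ}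
    (hβ : ∀ ℓ, ‖b ℓ‖ ≤ β) (hAP : ∀ f, A (projBlock ω m f) = A f)
    (hPA : ∀ f, projBlock ω m (A f) = A f) {U : L2 ω H ≃L[ℂ] L2 ω H}
    (hU : ∀ f g, (∀ ℓ : ℤ, (m : ℤ) < |ℓ| →
          coeff ω ℓ g = freq ω ℓ • coeff ω ℓ f + b ℓ (coeff ω ℓ f)) →
        projBlock ω m g = A f → IsFourierValueL hV (U f) (U g)) (f h : L2 ω H) :
    IsFourierValueL hV (U f) (U h) ↔
      (∀ ℓ : ℤ, (m : ℤ) < |ℓ| → coeff ω ℓ h = freq ω ℓ • coeff ω ℓ f + b ℓ (coeff ω ℓ f)) ∧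
        projBlock ω m h = A f := by
  refine ⟨fun hL => ?_, fun hG => hU f h hG.1 hG.2⟩
  obtain ⟨μ, ⟨R, hR⟩, hμ, hμβ, hμA⟩ := ((eventually_exists_resolvent hω hV).and
    ((eventually_gt_atTop 0).and ((eventually_ge_atTop (2 * β)).and
      (eventually_ge_atTop (2 * ‖A‖))))).exists
  obtain ⟨f', h1, h2⟩ := exists_model_resolvent hω hβ hAP hPA hμ hμβ hμA (h - (μ : ℂ) • f)
  have h3 := (hR _ _).1 (hU f' _ h1 h2)
  have h4 := (hR _ _).1 hL
  have h5 : U f' = U f := by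
    rw [h3, h4, ← map_smul, ← map_smul, ← map_sub, ← map_sub, add_sub_cancel_right]
  have h6 : f' = f := U.injective h5
  rw [h6, sub_add_cancel] at h1 h2
  exact ⟨h1, h2⟩

/-- The group `t ↦ U T(t) U⁻¹`. -/
def C0Group.conj {E : Type*} [NormedAddCommGroup E] [NormedSpace ℂ E] (T : C0Group E)
    (U : E ≃L[ℂ] E) : C0Group E where
  op t := (U : E →L[ℂ] E).comp ((T.op t).comp (U.symm : E →L[ℂ] E))
  op_zero := by
    ext x
    simp [T.op_zero]
  op_add s t := by
    ext x
    simp [T.op_add]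
  continuous_op x := U.continuous.comp (T.continuous_op (U.symm x))

lemma C0Group.isGeneratorValue_conj_iff {E : Type*} [NormedAddCommGroup E] [NormedSpace ℂ E]
    (T : C0Group E) (U : E ≃L[ℂ] E) (f h : E) :
    (T.conj U).IsGeneratorValue f h ↔ T.IsGeneratorValue (U.symm f) (U.symm h) := by
  have h1 : ∀ t : ℝ, ((t : ℂ)⁻¹) • ((T.conj U).op t f - f)
      = U (((t : ℂ)⁻¹) • (T.op t (U.symm f) - U.symm f)) := fun t => by
    simp [C0Group.conj]
  unfold C0Group.IsGeneratorValue
  simp only [h1]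
  constructor
  · intro hg
    have h2 := (U.symm.continuous.tendsto h).comp hg
    refine h2.congr fun t => ?_
    simp only [Function.comp_apply, ContinuousLinearEquiv.symm_apply_apply]
  · intro hg
    have h2 := (U.continuous.tendsto _).comp hg
    rw [ContinuousLinearEquiv.apply_symm_apply] at h2
    exact h2

lemma isGroupOfL_of_isFourierValueL_iff (hω : 0 < ω) {hV : IsStrongL2 ω V} {T : C0Group (L2 ω H)}
    (hT : ∀ f h, T.IsGeneratorValue f h ↔ IsFourierValueL hV f h) : IsGroupOfL ω V T := by
  refine ⟨fun f => ?_, fun f h hg => ((hT f h).1 hg).isValueL hω hV⟩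
  rw [mem_domL_iff hω]
  constructor
  · rintro ⟨h, hg⟩
    obtain ⟨g, hd, -⟩ := (hT f h).1 hg
    exact ⟨g, hd⟩
  · rintro ⟨g, hd⟩
    exact ⟨_, (hT f _).2 ⟨g, hd, rfl⟩⟩

end Generation

/-! ### Transport of the blocks to the spectral subspaces. -/

section SpectralParts

variable {H : Type*} [NormedAddCommGroup H] [InnerProductSpace ℂ H] [CompleteSpace H] {ω : ℝ}

lemma proj_proj (hω : 0 < ω) (ℓ : ℤ) (f : L2 ω H) : proj ω ℓ (proj ω ℓ f) = proj ω ℓ f := by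
  rw [proj_apply, proj_apply, coeff_harmonic hω, if_pos rfl]

lemma completeSpace_range_of_idempotent {E : Type*} [NormedAddCommGroup E] [NormedSpace ℂ E]
    [CompleteSpace E] (P : E →L[ℂ] E) (hP : ∀ x, P (P x) = P x) :
    CompleteSpace (LinearMap.range P.toLinearMap) := by
  have h : (LinearMap.range P.toLinearMap : Set E) = {x | P x = x} := by
    ext x
    constructor
    · rintro ⟨y, rfl⟩
      exact hP y
    · intro hx
      exact ⟨x, hx⟩
  have hc : IsClosed (LinearMap.range P.toLinearMap : Set E) := by
    rw [h]
    exact isClosed_eq P.continuous continuous_id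
  exact hc.completeSpace_coe

lemma completeSpace_specSpace (hω : 0 < ω) (ℓ : ℤ) : CompleteSpace (specSpace ω H ℓ) :=
  completeSpace_range_of_idempotent _ (proj_proj hω ℓ)

lemma completeSpace_specBlock (hω : 0 < ω) (k : ℕ) : CompleteSpace (specBlock ω H k) :=
  completeSpace_range_of_idempotent _ (projBlock_projBlock hω k)

lemma proj_coe_specSpace (hω : 0 < ω) {ℓ : ℤ} (x : specSpace ω H ℓ) :
    proj ω ℓ (x : L2 ω H) = x := by
  obtain ⟨_, y, rfl⟩ := x
  exact proj_proj hω ℓ y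

lemma proj_partExp (hω : 0 < ω) (ℓ : ℤ) (B : specSpace ω H ℓ →L[ℂ] specSpace ω H ℓ) (t : ℝ)
    (x : L2 ω H) : proj ω ℓ (partExp ω ℓ B t x) = partExp ω ℓ B t x :=
  proj_coe_specSpace hω _

lemma coeff_partExp_of_ne (hω : 0 < ω) {ℓ j : ℤ} (hj : j ≠ ℓ)
    (B : specSpace ω H ℓ →L[ℂ] specSpace ω H ℓ) (t : ℝ) (x : L2 ω H) :
    coeff ω j (partExp ω ℓ B t x) = 0 := by
  rw [← proj_partExp hω, proj_apply, coeff_harmonic hω, if_neg hj]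

lemma norm_partExp (hω : 0 < ω) (ℓ : ℤ) (B : specSpace ω H ℓ →L[ℂ] specSpace ω H ℓ) (t : ℝ)
    (x : L2 ω H) : ‖coeff ω ℓ (partExp ω ℓ B t x)‖ = ‖partExp ω ℓ B t x‖ := by
  rw [← norm_harmonic hω ℓ, ← proj_apply, proj_partExp hω]

lemma norm_partExp_le (hω : 0 < ω) (ℓ : ℤ) (B : specSpace ω H ℓ →L[ℂ] specSpace ω H ℓ) (t : ℝ)
    (x : L2 ω H) : ‖partExp ω ℓ B t x‖ ≤ Real.exp (‖B‖ * |t|) * ‖coeff ω ℓ x‖ := by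
  have := completeSpace_specSpace (H := H) hω ℓ
  have h1 := norm_opExp_smul_le (freq_re ω ℓ) B t
  have h2 := ContinuousLinearMap.le_of_opNorm_le _ h1
    ((proj ω ℓ).toLinearMap.rangeRestrict x : specSpace ω H ℓ)
  have h3 : ‖((proj ω ℓ).toLinearMap.rangeRestrict x : specSpace ω H ℓ)‖ = ‖coeff ω ℓ x‖ :=
    norm_harmonic hω ℓ (coeff ω ℓ x)
  rw [h3] at h2
  exact h2

/-- B is b conjugated by h ↦ e_ℓ h; the coefficient map intertwines the two, hence also their
exponentials. -/
lemma exists_specSpace_operator (hω : 0 < ω) (ℓ : ℤ) (b : H →L[ℂ] H) :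
    ∃ B : specSpace ω H ℓ →L[ℂ] specSpace ω H ℓ, ‖B‖ ≤ ‖b‖ ∧
      ∀ t x, coeff ω ℓ (partExp ω ℓ B t x) =
        opExp ((t : ℂ) • (freq ω ℓ • ContinuousLinearMap.id ℂ H + b)) (coeff ω ℓ x) := by
  have := completeSpace_specSpace (H := H) hω ℓ
  set G : L2 ω H →L[ℂ] L2 ω H := (harmonic ω ℓ).comp (b.comp (coeff ω ℓ)) with hG
  have hmem : ∀ f, G f ∈ specSpace ω H ℓ := fun f =>
    ⟨G f, by
      change proj ω ℓ (G f) = G f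
      rw [proj_apply, hG]
      simp only [ContinuousLinearMap.comp_apply]
      rw [coeff_harmonic hω, if_pos rfl]⟩
  set B : specSpace ω H ℓ →L[ℂ] specSpace ω H ℓ :=
    (G.comp (specSpace ω H ℓ).subtypeL).codRestrict (specSpace ω H ℓ) fun x => hmem x with hB
  have hcB : ∀ x : specSpace ω H ℓ, coeff ω ℓ (B x : L2 ω H) = b (coeff ω ℓ (x : L2 ω H)) := by
    intro x
    change coeff ω ℓ (harmonic ω ℓ (b (coeff ω ℓ (x : L2 ω H)))) = _
    rw [coeff_harmonic hω, if_pos rfl]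
  refine ⟨B, ContinuousLinearMap.opNorm_le_bound _ (norm_nonneg _) fun x => ?_, fun t x => ?_⟩
  · change ‖harmonic ω ℓ (b (coeff ω ℓ (x : L2 ω H)))‖ ≤ ‖b‖ * ‖(x : L2 ω H)‖
    rw [norm_harmonic hω]
    exact b.le_opNorm_of_le (norm_coeff_le hω ℓ _)
  · have h1 := opExp_smul_intertwine ((coeff ω ℓ).comp (specSpace ω H ℓ).subtypeL)
      (A := freq ω ℓ • ContinuousLinearMap.id ℂ (specSpace ω H ℓ) + B)
      (B := freq ω ℓ • ContinuousLinearMap.id ℂ H + b)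
      (fun y => by
        change coeff ω ℓ (freq ω ℓ • (y : L2 ω H) + (B y : L2 ω H)) = _
        rw [map_add, map_smul, hcB]
        rfl) (t : ℂ) ((proj ω ℓ).toLinearMap.rangeRestrict x)
    refine Eq.trans h1 ?_
    congr 1
    change coeff ω ℓ (proj ω ℓ x) = _
    rw [proj_apply, coeff_harmonic hω, if_pos rfl]

lemma exists_specBlock_operator (hω : 0 < ω) {m : ℕ} {A : L2 ω H →L[ℂ] L2 ω H}
    (hPA : ∀ f, projBlock ω m (A f) = A f) :
    ∃ Bk : specBlock ω H m →L[ℂ] specBlock ω H m,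
      ∀ t x, blockExp ω m Bk t x = opExp ((t : ℂ) • A) (projBlock ω m x) := by
  have := completeSpace_specBlock (H := H) hω m
  set Bk : specBlock ω H m →L[ℂ] specBlock ω H m :=
    (A.comp (specBlock ω H m).subtypeL).codRestrict (specBlock ω H m)
      fun x => ⟨A x, hPA x⟩ with hBk
  refine ⟨Bk, fun t x => ?_⟩
  exact opExp_smul_intertwine (specBlock ω H m).subtypeL (A := Bk) (B := A) (fun y => rfl) (t : ℂ)
    ((projBlock ω m).toLinearMap.rangeRestrict x)

lemma exists_isBlockDiagonalization (hω : 0 < ω) {m : ℕ} {A : L2 ω H →L[ℂ] L2 ω H}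
    {b : ℤ → H →L[ℂ] H} (hb : Summable fun ℓ => ‖b ℓ‖ ^ 2)
    (hPA : ∀ f, projBlock ω m (A f) = A f) {U : L2 ω H ≃L[ℂ] L2 ω H} {W : L2 ω H →L[ℂ] L2 ω H}
    (hU : (U : L2 ω H →L[ℂ] L2 ω H) = ContinuousLinearMap.id ℂ (L2 ω H) + W)
    (hW : IsHilbertSchmidt ω W) {T : C0Group (L2 ω H)}
    (hC : ∀ t f (ℓ : ℤ), (m : ℤ) < |ℓ| → coeff ω ℓ (T.op t f) =
        opExp ((t : ℂ) • (freq ω ℓ • ContinuousLinearMap.id ℂ H + b ℓ)) (coeff ω ℓ f))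
    (hP : ∀ t f, projBlock ω m (T.op t f) = opExp ((t : ℂ) • A) (projBlock ω m f)) :
    ∃ Bk B, IsBlockDiagonalization ω (T.conj U) m U W Bk B := by
  obtain ⟨Bk, hBk⟩ := exists_specBlock_operator hω hPA
  choose B hB hBc using fun ℓ => exists_specSpace_operator hω ℓ (b ℓ)
  refine ⟨Bk, B, hU, hW, ?_, fun t x => ?_⟩
  · refine Summable.of_nonneg_of_le (fun _ => by positivity) (fun ℓ => ?_)
      (hb.comp_injective Subtype.val_injective)
    have h0 : 0 ≤ ‖B ℓ‖ := by positivity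
    exact pow_le_pow_left₀ h0 (hB ℓ) 2
  · have h1 : U.symm ((T.conj U).op t (U x)) = T.op t x := by
      simp [C0Group.conj]
    rw [h1, hBk, ← hP]
    have h2 := hasSum_proj hω (T.op t x - projBlock ω m (T.op t x))
    have h3 : ∀ ℓ : ℤ, (m : ℤ) < |ℓ| →
        proj ω ℓ (T.op t x - projBlock ω m (T.op t x)) = partExp ω ℓ (B ℓ) t x := by
      intro ℓ hℓ
      rw [← proj_partExp hω, proj_apply, proj_apply, map_sub, coeff_projBlock_of_lt hω hℓ, sub_zero,
        hC t x ℓ hℓ, hBc]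
    have h4 : ∀ ℓ : ℤ, ¬ (m : ℤ) < |ℓ| →
        proj ω ℓ (T.op t x - projBlock ω m (T.op t x)) = 0 := by
      intro ℓ hℓ
      rw [proj_apply, map_sub, coeff_projBlock_of_le hω hℓ, sub_self, map_zero]
    have h5 := (hasSum_subtype_iff_of_support_subset (s := {ℓ : ℤ | (m : ℤ) < |ℓ|})
      (f := fun ℓ => proj ω ℓ (T.op t x - projBlock ω m (T.op t x)))
      (Function.support_subset_iff'.2 fun ℓ hℓ => h4 ℓ hℓ)).2 h2
    exact h5.congr_fun fun ℓ => (h3 ℓ ℓ.2).symm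

end SpectralParts

/-! ### The remainder estimate for an arbitrary block diagonalization. -/

lemma summable_exp_mul {ι : Type*} {γ a : ι → ℝ} (ha : ∀ i, 0 ≤ a i) (hs : Summable a) {κ : ℝ}
    (hγ : ∀ i, γ i ≤ κ) (t : ℝ) :
    (Summable fun i => Real.exp (2 * γ i * |t|) * a i) ∧
      √(∑' i, Real.exp (2 * γ i * |t|) * a i) ≤ Real.exp (κ * |t|) * √(∑' i, a i) := by
  have h1 : ∀ i, Real.exp (2 * γ i * |t|) * a i ≤ Real.exp (κ * |t|) ^ 2 * a i := fun i => by
    rw [← Real.exp_nat_mul]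
    refine mul_le_mul_of_nonneg_right (Real.exp_le_exp.2 ?_) (ha i)
    have := mul_le_mul_of_nonneg_right (hγ i) (abs_nonneg t)
    push_cast
    linarith
  have h2 : Summable fun i => Real.exp (2 * γ i * |t|) * a i :=
    Summable.of_nonneg_of_le (fun i => mul_nonneg (Real.exp_pos _).le (ha i)) h1 (hs.mul_left _)
  refine ⟨h2, ?_⟩
  rw [Real.sqrt_le_left (by positivity), mul_pow, Real.sq_sqrt (tsum_nonneg ha), ← tsum_mul_left]
  exact h2.tsum_le_tsum h1 (hs.mul_left _)

section Estimates

variable {H : Type*} [NormedAddCommGroup H] [InnerProductSpace ℂ H] [CompleteSpace H] {ω : ℝ}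

/-- Only row ℓ of the double sum survives, so the β_ℓ² are the row sums of the convergent double
series for W. -/
lemma beta_sq (hω : 0 < ω) (W : L2 ω H →L[ℂ] L2 ω H) (ℓ : ℤ) :
    beta ω W ℓ ^ 2 = ∑' j, ‖(proj ω ℓ).comp (W.comp (proj ω j))‖ ^ 2 := by
  rw [beta, hsNorm, Real.sq_sqrt (tsum_nonneg fun _ => by positivity)]
  have hinj : Function.Injective fun j : ℤ => (ℓ, j) := Prod.mk_right_injective ℓ
  rw [← hinj.tsum_eq]
  · refine tsum_congr fun j => ?_
    congr 2
    ext1 f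
    exact proj_proj hω ℓ _
  · refine Function.support_subset_iff'.2 fun p hp => ?_
    have h1 : p.1 ≠ ℓ := fun h => hp ⟨p.2, by rw [← h]⟩
    have h2 : (proj ω p.1).comp (((proj ω ℓ).comp W).comp (proj ω p.2))
        = (0 : L2 ω H →L[ℂ] L2 ω H) := by
      ext1 f
      simp only [ContinuousLinearMap.comp_apply, proj_apply, coeff_harmonic hω, if_neg h1, map_zero,
        zero_apply]
    rw [h2, norm_zero, zero_pow two_ne_zero]

lemma summable_beta_sq (hω : 0 < ω) {W : L2 ω H →L[ℂ] L2 ω H} (hW : IsHilbertSchmidt ω W) :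
    Summable fun ℓ => beta ω W ℓ ^ 2 := by
  simp only [beta_sq hω]
  exact Summable.prod hW

variable {T : C0Group (L2 ω H)} {k : ℕ} {U : L2 ω H ≃L[ℂ] L2 ω H} {W : L2 ω H →L[ℂ] L2 ω H}
  {Bk : specBlock ω H k →L[ℂ] specBlock ω H k}
  {B : ∀ ℓ : ℤ, specSpace ω H ℓ →L[ℂ] specSpace ω H ℓ}

lemma IsBlockDiagonalization.exists_norm_le (h : IsBlockDiagonalization ω T k U W Bk B) :
    ∃ M, ∀ ℓ : ℤ, (k : ℤ) < |ℓ| → ‖B ℓ‖ ≤ M := by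
  refine ⟨√(∑' ℓ : {ℓ : ℤ // (k : ℤ) < |ℓ|}, ‖B ℓ‖ ^ 2), fun ℓ hℓ => Real.le_sqrt_of_sq_le ?_⟩
  exact h.summable.le_tsum (⟨ℓ, hℓ⟩ : {ℓ : ℤ // (k : ℤ) < |ℓ|}) fun _ _ => by positivity

lemma IsBlockDiagonalization.norm_le_kappa (h : IsBlockDiagonalization ω T k U W Bk B) {n : ℕ}
    (hn : k < n) {ℓ : ℤ} (hℓ : (n : ℤ) ≤ |ℓ|) : ‖B ℓ‖ ≤ kappa ω B n := by
  obtain ⟨M, hM⟩ := h.exists_norm_le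
  -- A real supremum is meaningful only for a bounded family; n > k keeps the indices where the
  -- square sum of the ‖B ℓ‖ is finite.
  have hbdd : BddAbove (Set.range fun ℓ : {ℓ : ℤ // (n : ℤ) ≤ |ℓ|} => ‖B ℓ‖) := by
    refine ⟨M, ?_⟩
    rintro _ ⟨j, rfl⟩
    exact hM j (lt_of_lt_of_le (by exact_mod_cast hn) j.2)
  exact le_ciSup hbdd (⟨ℓ, hℓ⟩ : {ℓ : ℤ // (n : ℤ) ≤ |ℓ|})

lemma IsBlockDiagonalization.coeff_remainder (hω : 0 < ω)
    (h : IsBlockDiagonalization ω T k U W Bk B) {n : ℕ} (hn : k < n) (t : ℝ) (x : L2 ω H) (j : ℤ) :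
    coeff ω j (U.symm (T.op t (U x)) - blockExp ω k Bk t x -
        ∑ ℓ ∈ (Finset.Icc (-(n : ℤ)) n).filter (fun ℓ => (k : ℤ) < |ℓ|), partExp ω ℓ (B ℓ) t x)
      = if (n : ℤ) < |j| then coeff ω j (partExp ω j (B j) t x) else 0 := by
  classical
  have hkn : (k : ℤ) < n := by exact_mod_cast hn
  have h1 : coeff ω j (U.symm (T.op t (U x)) - blockExp ω k Bk t x)
      = if (k : ℤ) < |j| then coeff ω j (partExp ω j (B j) t x) else 0 := by
    have h2 := (h.directSum t x).mapL (coeff ω j)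
    split_ifs with hj
    · refine h2.unique (hasSum_single (⟨j, hj⟩ : {ℓ : ℤ // (k : ℤ) < |ℓ|}) fun ℓ hℓ => ?_)
      exact coeff_partExp_of_ne hω (fun e => hℓ (Subtype.ext e.symm)) _ _ _
    · have h3 : (fun ℓ : {ℓ : ℤ // (k : ℤ) < |ℓ|} => coeff ω j (partExp ω ℓ (B ℓ) t x))
          = fun _ => 0 := funext fun ℓ =>
        coeff_partExp_of_ne hω (fun e : j = ℓ => hj (e.symm ▸ ℓ.2)) _ _ _
      rw [h3] at h2
      exact h2.unique hasSum_zero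
  have h4 : coeff ω j (∑ ℓ ∈ (Finset.Icc (-(n : ℤ)) n).filter (fun ℓ => (k : ℤ) < |ℓ|),
        partExp ω ℓ (B ℓ) t x)
      = if (k : ℤ) < |j| ∧ |j| ≤ n then coeff ω j (partExp ω j (B j) t x) else 0 := by
    rw [map_sum]
    have h5 : ∀ ℓ ∈ (Finset.Icc (-(n : ℤ)) n).filter (fun ℓ => (k : ℤ) < |ℓ|), ℓ ≠ j →
        coeff ω j (partExp ω ℓ (B ℓ) t x) = 0 := fun ℓ _ hℓ =>
      coeff_partExp_of_ne hω hℓ.symm _ _ _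
    split_ifs with hj
    · refine Finset.sum_eq_single_of_mem j ?_ h5
      rw [Finset.mem_filter, Finset.mem_Icc]
      exact ⟨abs_le.1 hj.2, hj.1⟩
    · refine Finset.sum_eq_zero fun ℓ hℓ => h5 ℓ hℓ ?_
      rintro rfl
      rw [Finset.mem_filter, Finset.mem_Icc] at hℓ
      exact hj ⟨hℓ.2, abs_le.2 hℓ.1⟩
  rw [map_sub, h1, h4]
  by_cases hj : (n : ℤ) < |j|
  · rw [if_pos (hkn.trans hj), if_neg (fun e => absurd e.2 (not_le.2 hj)), if_pos hj, sub_zero]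
  · rw [if_neg hj]
    by_cases hj' : (k : ℤ) < |j|
    · rw [if_pos hj', if_pos ⟨hj', not_lt.1 hj⟩, sub_self]
    · rw [if_neg hj', if_neg (fun e => hj' e.1), sub_self]

lemma IsBlockDiagonalization.norm_remainder_sq_le (hω : 0 < ω)
    (h : IsBlockDiagonalization ω T k U W Bk B) {n : ℕ} (hn : k < n) (t : ℝ) (x : L2 ω H)
    {a : {ℓ : ℤ // (n : ℤ) + 1 ≤ |ℓ|} → ℝ} (ha : ∀ ℓ : {ℓ : ℤ // (n : ℤ) + 1 ≤ |ℓ|}, ‖coeff ω ℓ x‖ ^ 2 ≤ a ℓ)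
    (hs : Summable fun ℓ : {ℓ : ℤ // (n : ℤ) + 1 ≤ |ℓ|} => Real.exp (2 * ‖B ℓ‖ * |t|) * a ℓ) :
    ‖U.symm (T.op t (U x)) - blockExp ω k Bk t x -
        ∑ ℓ ∈ (Finset.Icc (-(n : ℤ)) n).filter (fun ℓ => (k : ℤ) < |ℓ|),
          partExp ω ℓ (B ℓ) t x‖ ^ 2
      ≤ ∑' ℓ : {ℓ : ℤ // (n : ℤ) + 1 ≤ |ℓ|}, Real.exp (2 * ‖B ℓ‖ * |t|) * a ℓ := by
  set d := U.symm (T.op t (U x)) - blockExp ω k Bk t x -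
    ∑ ℓ ∈ (Finset.Icc (-(n : ℤ)) n).filter (fun ℓ => (k : ℤ) < |ℓ|), partExp ω ℓ (B ℓ) t x
    with hd
  have hc : ∀ j, coeff ω j d = if (n : ℤ) < |j| then coeff ω j (partExp ω j (B j) t x) else 0 :=
    h.coeff_remainder hω hn t x
  have h1 := (hasSum_subtype_iff_of_support_subset (s := {ℓ : ℤ | (n : ℤ) + 1 ≤ |ℓ|})
    (f := fun ℓ => ‖coeff ω ℓ d‖ ^ 2)
    (Function.support_subset_iff'.2 fun ℓ hℓ => by
      rw [hc, if_neg (fun e => hℓ (Int.add_one_le_of_lt e)), norm_zero, zero_pow two_ne_zero])).2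
    (hasSum_norm_coeff_sq hω d)
  refine hasSum_le (fun ℓ => ?_) h1 hs.hasSum
  have h2 := norm_partExp_le hω (ℓ : ℤ) (B ℓ) t x
  rw [← norm_partExp hω] at h2
  simp only [Function.comp_apply]
  rw [hc, if_pos (Int.lt_of_add_one_le ℓ.2)]
  refine (pow_le_pow_left₀ (norm_nonneg _) h2 2).trans ?_
  rw [mul_pow, ← Real.exp_nat_mul, Nat.cast_ofNat, mul_assoc]
  exact mul_le_mul_of_nonneg_left (ha ℓ) (Real.exp_pos _).le

lemma IsBlockDiagonalization.estimate (hω : 0 < ω) (h : IsBlockDiagonalization ω T k U W Bk B)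
    (ψ : L2 ω H) {n : ℕ} (hn : k < n) (t : ℝ) :
    (Summable fun ℓ : {ℓ : ℤ // (n : ℤ) + 1 ≤ |ℓ|} =>
      Real.exp (2 * ‖B ℓ‖ * |t|) * (‖coeff ω ℓ ψ‖ ^ 2 + beta ω W ℓ ^ 2 * ‖ψ‖ ^ 2)) ∧
    (Summable fun ℓ : {ℓ : ℤ // (n : ℤ) + 1 ≤ |ℓ|} =>
      ‖coeff ω ℓ ψ‖ ^ 2 + beta ω W ℓ ^ 2 * ‖ψ‖ ^ 2) ∧
    ‖T.op t (U ψ) - partialSum ω k U Bk B n t ψ‖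
      ≤ (‖(U : L2 ω H →L[ℂ] L2 ω H)‖ + 1) * √(∑' ℓ : {ℓ : ℤ // (n : ℤ) + 1 ≤ |ℓ|},
        Real.exp (2 * ‖B ℓ‖ * |t|) *
          (‖coeff ω ℓ ψ‖ ^ 2 + beta ω W ℓ ^ 2 * ‖ψ‖ ^ 2)) ∧
    √(∑' ℓ : {ℓ : ℤ // (n : ℤ) + 1 ≤ |ℓ|},
        Real.exp (2 * ‖B ℓ‖ * |t|) *
          (‖coeff ω ℓ ψ‖ ^ 2 + beta ω W ℓ ^ 2 * ‖ψ‖ ^ 2))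
      ≤ Real.exp (kappa ω B (n + 1) * |t|) *
        √(∑' ℓ : {ℓ : ℤ // (n : ℤ) + 1 ≤ |ℓ|},
          (‖coeff ω ℓ ψ‖ ^ 2 + beta ω W ℓ ^ 2 * ‖ψ‖ ^ 2)) := by
  have hs : Summable fun ℓ : {ℓ : ℤ // (n : ℤ) + 1 ≤ |ℓ|} =>
      ‖coeff ω ℓ ψ‖ ^ 2 + beta ω W ℓ ^ 2 * ‖ψ‖ ^ 2 :=
    ((hasSum_norm_coeff_sq hω ψ).summable.add
      ((summable_beta_sq hω h.hilbertSchmidt).mul_right _)).comp_injective Subtype.val_injective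
  have hκ : ∀ ℓ : {ℓ : ℤ // (n : ℤ) + 1 ≤ |ℓ|}, ‖B ℓ‖ ≤ kappa ω B (n + 1) := fun ℓ =>
    h.norm_le_kappa (Nat.lt_succ_of_lt hn) (by exact_mod_cast ℓ.2)
  obtain ⟨h1, h2⟩ := summable_exp_mul (fun ℓ => by positivity) hs hκ t
  refine ⟨h1, hs, ?_, h2⟩
  -- The remainder is already controlled by the coefficients of ψ; the β-terms are added as
  -- nonnegative slack.
  have h3 := h.norm_remainder_sq_le hω hn t ψ
    (fun ℓ => le_add_of_nonneg_right (by positivity)) h1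
  have h4 : T.op t (U ψ) - partialSum ω k U Bk B n t ψ
      = U (U.symm (T.op t (U ψ)) - blockExp ω k Bk t ψ -
        ∑ ℓ ∈ (Finset.Icc (-(n : ℤ)) n).filter (fun ℓ => (k : ℤ) < |ℓ|),
          partExp ω ℓ (B ℓ) t ψ) := by
    rw [map_sub, map_sub, map_sum, ContinuousLinearEquiv.apply_symm_apply, partialSum, sub_sub]
  rw [h4]
  refine ((U : L2 ω H →L[ℂ] L2 ω H).le_opNorm _).trans ?_
  exact mul_le_mul (le_add_of_nonneg_right (zero_le_one (α := ℝ))) (Real.le_sqrt_of_sq_le h3) (norm_nonneg _)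
    (by positivity)

end Estimates

end MixedProblem

end

theorem theorem2p9 {H : Type*} [NormedAddCommGroup H] [InnerProductSpace ℂ H] [CompleteSpace H]
    (ω : ℝ) (hω : 0 < ω) (V : ℝ → H →L[ℂ] H) (hV : IsStrongL2 ω V)
    (hV₁ : Summable fun n : ℤ => ‖potCoeff ω V hV n‖ ^ 2)
    (hV₂ : Summable fun p : ℤ × ℤ =>
      ‖∑' n : {n : ℤ // n ≠ p.2}, ((p.2 : ℂ) - (n : ℤ))⁻¹ •
        (potCoeff ω V hV (p.1 + n)).comp (potCoeff ω V hV (p.2 + n))‖ ^ 2) :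
    ∃ T : C0Group (L2 ω H), IsGroupOfL ω V T ∧
      (∃ k U W Bk B, IsBlockDiagonalization ω T k U W Bk B) ∧
      ∀ k U W Bk B, IsBlockDiagonalization ω T k U W Bk B →
        ∃ C : ℝ, 0 < C ∧ ∀ (ψ : L2 ω H) (n : ℕ), k < n → ∀ t : ℝ,
          (Summable fun ℓ : {ℓ : ℤ // (n : ℤ) + 1 ≤ |ℓ|} =>
            Real.exp (2 * ‖B ℓ‖ * |t|) * (‖coeff ω ℓ ψ‖ ^ 2 + beta ω W ℓ ^ 2 * ‖ψ‖ ^ 2)) ∧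
          (Summable fun ℓ : {ℓ : ℤ // (n : ℤ) + 1 ≤ |ℓ|} =>
            ‖coeff ω ℓ ψ‖ ^ 2 + beta ω W ℓ ^ 2 * ‖ψ‖ ^ 2) ∧
          ‖T.op t (U ψ) - partialSum ω k U Bk B n t ψ‖
            ≤ C * Real.sqrt (∑' ℓ : {ℓ : ℤ // (n : ℤ) + 1 ≤ |ℓ|},
              Real.exp (2 * ‖B ℓ‖ * |t|) *
                (‖coeff ω ℓ ψ‖ ^ 2 + beta ω W ℓ ^ 2 * ‖ψ‖ ^ 2)) ∧
          C * Real.sqrt (∑' ℓ : {ℓ : ℤ // (n : ℤ) + 1 ≤ |ℓ|},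
              Real.exp (2 * ‖B ℓ‖ * |t|) *
                (‖coeff ω ℓ ψ‖ ^ 2 + beta ω W ℓ ^ 2 * ‖ψ‖ ^ 2))
            ≤ C * Real.exp (kappa ω B (n + 1) * |t|) *
              Real.sqrt (∑' ℓ : {ℓ : ℤ // (n : ℤ) + 1 ≤ |ℓ|},
                (‖coeff ω ℓ ψ‖ ^ 2 + beta ω W ℓ ^ 2 * ‖ψ‖ ^ 2)) := by
  obtain ⟨m, U, W, A, b, hU, hW, hb, hAP, hPA, hUL⟩ := exists_blockDiagonalization hω hV₁ hV₂
  obtain ⟨β, hβ⟩ : ∃ β, ∀ ℓ, ‖b ℓ‖ ≤ β :=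
    ⟨√(∑' ℓ, ‖b ℓ‖ ^ 2), fun ℓ =>
      Real.le_sqrt_of_sq_le (hb.le_tsum ℓ fun _ _ => by positivity)⟩
  obtain ⟨T, hC, hP⟩ := exists_modelGroup hω hβ hAP hPA
  refine ⟨T.conj U, isGroupOfL_of_isFourierValueL_iff (hV := hV) hω fun f h => ?_,
    ⟨m, U, W, exists_isBlockDiagonalization hω hb hPA hU hW hC hP⟩, ?_⟩
  · rw [T.isGeneratorValue_conj_iff, isGeneratorValue_modelGroup_iff hω hAP hC hP,
      ← isFourierValueL_iff_of_blockDiagonal hω hβ hAP hPA hUL,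
      ContinuousLinearEquiv.apply_symm_apply, ContinuousLinearEquiv.apply_symm_apply]
  · intro k U W Bk B h
    -- ‖U‖ suffices for the bound; the added 1 secures C > 0 even when H is trivial.
    refine ⟨‖(U : L2 ω H →L[ℂ] L2 ω H)‖ + 1, by positivity, fun ψ n hn t => ?_⟩
    obtain ⟨h1, h2, h3, h4⟩ := h.estimate hω ψ hn t
    refine ⟨h1, h2, h3, ?_⟩
    rw [mul_assoc]
    exact mul_le_mul_of_nonneg_left h4 (by positivity)
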